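/- Let $G$ be a regular Lie group modelled on a convenient vector space (in the sense of Kriegl–Michor), with neutral element $e$ and Lie algebra $\mathfrak g=T_eG$; write $[a,b]=aba^{-1}b^{-1}$ for commutators in $G$. Define three elements of $\mathbb N\cup\{\infty\}$, each being $\infty$ if no such integer exists. * $N_G$ is the smallest integer $N$ such that for every open neighbourhood $U$ of $e$ in $G$ there are $Y_1,\dots,Y_N\in\mathfrak g$ with $h_i=\exp(Y_i)\in U$, an open neighbourhood $V$ of $e$ in $G$ and smooth maps $S_i:V\to G$ with $S_i(e)=e$ and $[S_1(g),h_1]\cdots[S_N(g),h_N]=g$ for all $g\in V$. * $N_G^{\operatorname{Ad}}$ is the smallest integer $N$ such that for every open neighbourhood $U$ of $e$ in $G$ there are $Y_1,\dots,Y_N\in\mathfrak g$ with $h_i=\exp(Y_i)\in U$ and bounded linear maps $s_i:\mathfrak g\to\mathfrak g$ with $\sum_{i=1}^N(\operatorname{id}-\operatorname{Ad}_{h_i})s_i(X)=X$ for all $X\in\mathfrak g$. * $N_{\mathfrak g}$ is the smallest integer $N$ such that there are $Y_1,\dots,Y_N\in\mathfrak g$ and bounded linear maps $\sigma_i:\mathfrak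 g\to\mathfrak g$ with $\sum_{i=1}^N[\sigma_i(X),Y_i]=X$ for all $X\in\mathfrak g$. Then $N_{\mathfrak g}\le N_G^{\operatorname{Ad}}\le N_G$. If moreover $G$ is a Banach–Lie group (that is, it is modelled on a Banach space), then $N_{\mathfrak g}=N_G^{\operatorname{Ad}}=N_G$. -/

import Mathlib

open Filter Topology

namespace ConvenientLie

/-! ### Convenient vector spaces -/

section VectorSpaces

variable {E : Type*} [AddCommGroup E] [Module ℝ E] [TopologicalSpace E]

/-- A sequence is Mackey–Cauchy if its differences satisfy `x m - x n ∈ μ (m, n) • B` for some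
bounded set `B` and some reals `μ (m, n)` tending to `0`. -/
def IsMackeyCauchy (x : ℕ → E) : Prop :=
  ∃ B : Set E, Bornology.IsVonNBounded ℝ B ∧
    ∃ μ : ℕ × ℕ → ℝ, Tendsto μ atTop (𝓝 0) ∧
      ∀ m n : ℕ, ∃ b ∈ B, x m - x n = μ (m, n) • b

/-- A convenient vector space: a Hausdorff locally convex real topological vector space in which
every Mackey–Cauchy sequence converges. -/
class ConvenientSpace (E : Type*) [AddCommGroup E] [Module ℝ E] [TopologicalSpace E] : Prop
    extends IsTopologicalAddGroup E, ContinuousSMul ℝ E, LocallyConvexSpace ℝ E, T2Space E where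
  exists_tendsto_of_isMackeyCauchy :
    ∀ x : ℕ → E, IsMackeyCauchy x → ∃ a : E, Tendsto x atTop (𝓝 a)

/-- The locally convex space `E` is (the underlying space of) a Banach space: its topology is
given by one single seminorm `p`, for which `E` is complete. (In a Hausdorff space `p` is
then a norm.) -/
def IsBanachSpace (E : Type*) [AddCommGroup E] [Module ℝ E] [TopologicalSpace E] : Prop :=
  ∃ p : Seminorm ℝ E, WithSeminorms (fun _ : Unit => p) ∧
    ∀ x : ℕ → E, (∀ ε > 0, ∃ N, ∀ m ≥ N, ∀ n ≥ N, p (x m - x n) < ε) →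
      ∃ a : E, Tendsto x atTop (𝓝 a)

/-- Bounded linear maps: linear maps that send bounded sets to bounded sets. -/
def IsBoundedLinear (s : E →ₗ[ℝ] E) : Prop :=
  ∀ B : Set E, Bornology.IsVonNBounded ℝ B → Bornology.IsVonNBounded ℝ (s '' B)

/-- The curve `c` is smooth on the open set `J` of parameters: all iterated derivatives
exist at all points of `J` (hence they are continuous there). -/
def IsSmoothCurveOn (c : ℝ → E) (J : Set ℝ) : Prop :=
  ∀ n : ℕ, ∀ t ∈ J, DifferentiableAt ℝ (deriv^[n] c) t

/-- Smooth curves `ℝ → E`. -/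
def IsSmoothCurve (c : ℝ → E) : Prop := IsSmoothCurveOn c Set.univ

/-! The smooth curves form a vector space. -/

theorem hasDerivAt_iff_slope [ContinuousSMul ℝ E] {c : ℝ → E} {v : E} {t : ℝ} :
    HasDerivAt c v t ↔
      Tendsto (fun s => (s - t)⁻¹ • (c s - c t - (s - t) • v)) (𝓝 t) (𝓝 0) := by
  rw [HasDerivAt, HasDerivAtFilter, ← HasFDerivAt, hasFDerivAt_iff_isLittleOTVS,
    Asymptotics.isLittleOTVS_iff_tendsto_inv_smul]
  · simp [ContinuousLinearMap.toSpanSingleton_apply]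
  · refine Eventually.of_forall fun s hs => ?_
    have : s = t := by simpa [sub_eq_zero] using hs
    simp [this]

theorem differentiableAt_iff_exists [ContinuousSMul ℝ E] {c : ℝ → E} {t : ℝ} :
    DifferentiableAt ℝ c t ↔ ∃ v : E, HasDerivAt c v t := by
  constructor
  · rintro ⟨L, hL⟩
    refine ⟨L 1, ?_⟩
    rw [HasDerivAt, HasDerivAtFilter, ← HasFDerivAt]
    convert! hL
    ext
    simp
  · rintro ⟨v, hv⟩
    exact ⟨_, hv⟩

theorem deriv_eq_of_hasDerivAt [IsTopologicalAddGroup E] [ContinuousSMul ℝ E] [T2Space E]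
    {c : ℝ → E} {v : E} {t : ℝ} (h : HasDerivAt c v t) : deriv c t = v := by
  have hd : DifferentiableAt ℝ c t := ⟨_, h⟩
  have := HasFDerivAt.unique hd.hasFDerivAt h
  rw [deriv, this]
  simp

theorem hasDerivAt_deriv [IsTopologicalAddGroup E] [ContinuousSMul ℝ E] [T2Space E]
    {c : ℝ → E} {t : ℝ} (h : DifferentiableAt ℝ c t) : HasDerivAt c (deriv c t) t := by
  obtain ⟨v, hv⟩ := differentiableAt_iff_exists.1 h
  rwa [deriv_eq_of_hasDerivAt hv]

theorem hasDerivAt_add [IsTopologicalAddGroup E] [ContinuousSMul ℝ E]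
    {c d : ℝ → E} {v w : E} {t : ℝ} (hc : HasDerivAt c v t) (hd : HasDerivAt d w t) :
    HasDerivAt (c + d) (v + w) t := by
  rw [hasDerivAt_iff_slope] at *
  have := hc.add hd
  rw [add_zero] at this
  refine this.congr fun s => ?_
  rw [← smul_add]
  congr 1
  simp only [Pi.add_apply, smul_add]
  abel

theorem hasDerivAt_smul [ContinuousSMul ℝ E]
    {c : ℝ → E} {v : E} {t : ℝ} (a : ℝ) (hc : HasDerivAt c v t) :
    HasDerivAt (a • c) (a • v) t := by
  rw [hasDerivAt_iff_slope] at *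
  have := hc.const_smul a
  rw [smul_zero] at this
  refine this.congr fun s => ?_
  rw [smul_comm]
  congr 1
  simp only [Pi.smul_apply, smul_sub]
  rw [smul_comm a (s - t) v]

variable (E)

/-- The vector space `C^∞(ℝ, E)` of smooth curves. -/
def smoothCurves [IsTopologicalAddGroup E] [ContinuousSMul ℝ E] [T2Space E] :
    Submodule ℝ (ℝ → E) where
  carrier := {c | IsSmoothCurve c}
  zero_mem' := by
    have h0 : ∀ t : ℝ, HasDerivAt (0 : ℝ → E) 0 t := fun t => by
      rw [hasDerivAt_iff_slope]; simp
    have hn : ∀ n : ℕ, deriv^[n] (0 : ℝ → E) = 0 := fun n => by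
      induction n with
      | zero => rfl
      | succ n ih =>
        rw [Function.iterate_succ_apply', ih]
        funext t
        exact deriv_eq_of_hasDerivAt (h0 t)
    intro n t _
    rw [hn]
    exact differentiableAt_iff_exists.2 ⟨_, h0 t⟩
  add_mem' := by
    intro c d hc hd
    have hn : ∀ n : ℕ, deriv^[n] (c + d) = deriv^[n] c + deriv^[n] d := fun n => by
      induction n with
      | zero => rfl
      | succ n ih =>
        rw [Function.iterate_succ_apply', ih]
        funext t
        rw [Pi.add_apply, Function.iterate_succ_apply', Function.iterate_succ_apply']
        exact deriv_eq_of_hasDerivAt (hasDerivAt_add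
          (hasDerivAt_deriv (hc n t trivial)) (hasDerivAt_deriv (hd n t trivial)))
    intro n t _
    rw [hn]
    exact differentiableAt_iff_exists.2 ⟨_, hasDerivAt_add
      (hasDerivAt_deriv (hc n t trivial)) (hasDerivAt_deriv (hd n t trivial))⟩
  smul_mem' := by
    intro a c hc
    have hn : ∀ n : ℕ, deriv^[n] (a • c) = a • deriv^[n] c := fun n => by
      induction n with
      | zero => rfl
      | succ n ih =>
        rw [Function.iterate_succ_apply', ih]
        funext t
        rw [Pi.smul_apply, Function.iterate_succ_apply']
        exact deriv_eq_of_hasDerivAt (hasDerivAt_smul a (hasDerivAt_deriv (hc n t trivial)))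
    intro n t _
    rw [hn]
    exact differentiableAt_iff_exists.2 ⟨_, hasDerivAt_smul a (hasDerivAt_deriv (hc n t trivial))⟩

/-- The space `C^∞(ℝ, E)` of smooth curves, to be equipped with its own topology. -/
def CurveSpace [IsTopologicalAddGroup E] [ContinuousSMul ℝ E] [T2Space E] : Type _ :=
  smoothCurves E

noncomputable instance [IsTopologicalAddGroup E] [ContinuousSMul ℝ E] [T2Space E] :
    AddCommGroup (CurveSpace E) :=
  inferInstanceAs (AddCommGroup (smoothCurves E))

noncomputable instance [IsTopologicalAddGroup E] [ContinuousSMul ℝ E] [T2Space E] :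
    Module ℝ (CurveSpace E) :=
  inferInstanceAs (Module ℝ (smoothCurves E))

/-- The topology of `C^∞(ℝ, E)`: uniform convergence on compact sets of each derivative
separately. -/
noncomputable instance [IsTopologicalAddGroup E] [ContinuousSMul ℝ E] [T2Space E] :
    TopologicalSpace (CurveSpace E) :=
  letI : UniformSpace E := IsTopologicalAddGroup.rightUniformSpace E
  ⨅ n : ℕ, TopologicalSpace.induced
    (fun c : CurveSpace E => UniformOnFun.ofFun {K : Set ℝ | IsCompact K} (deriv^[n] c.1))
    (UniformOnFun.topologicalSpace ℝ E {K : Set ℝ | IsCompact K})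

/-- A copy of `E`, to be equipped with the `c^∞`-topology. It is the model space for manifolds. -/
def CInf (E : Type*) : Type _ := E

/-- The identity map from `E` to its copy `CInf E`. -/
def toCInf : E ≃ CInf E := Equiv.refl E

/-- The `c^∞`-topology on `E`: the final topology with respect to all smooth curves `ℝ → E`. -/
instance cInfTopology : TopologicalSpace (CInf E) :=
  ⨆ c : {c : ℝ → E // IsSmoothCurve c},
    TopologicalSpace.coinduced (fun t => toCInf E (c.1 t)) inferInstance

end VectorSpaces

/-! ### Manifolds and Lie groups modelled on `E`

Charts are homeomorphisms from open sets of `G` onto `c^∞`-open subsets of `E`. -/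

section Manifolds

variable (E : Type*) [AddCommGroup E] [Module ℝ E] [TopologicalSpace E]
variable {G : Type*} [TopologicalSpace G] [ChartedSpace (CInf E) G]

/-- The preferred chart at `g`, as a function with values in `E` (meaningful on its domain). -/
noncomputable def coord (g : G) : G → E := fun x => (toCInf E).symm (chartAt (CInf E) g x)

/-- The inverse of the preferred chart at `g` (meaningful on the range of the chart). -/
noncomputable def coordSymm (g : G) : E → G :=
  fun x => (chartAt (CInf E) g).symm (toCInf E x)

/-- Smooth curves `ℝ → G`: continuous curves which are smooth in every chart. -/
def IsSmoothCurveIn (c : ℝ → G) : Prop :=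
  Continuous c ∧ ∀ φ ∈ atlas (CInf E) G,
    IsSmoothCurveOn (fun t => (toCInf E).symm (φ (c t))) (c ⁻¹' φ.source)

/-- A map `f` defined on an open subset `V` of `G`, with values in `G`, is smooth if it maps smooth
curves in `V` to smooth curves. -/
def IsSmoothMapOn (f : G → G) (V : Set G) : Prop :=
  ∀ c : ℝ → G, IsSmoothCurveIn E c → (∀ t, c t ∈ V) → IsSmoothCurveIn E (fun t => f (c t))

/-- The velocity of a curve at time `t`, an element of the tangent space at `c t`, which is
identified with `E` through the preferred chart at `c t`. -/
noncomputable def velocity (c : ℝ → G) (t : ℝ) : E :=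
  deriv (fun s => coord E (c t) (c s)) t

/-- The tangent map at `g` of a smooth map `f : G → G`. The tangent spaces at `g` and at `f g` are
identified with `E` through the preferred charts there. -/
noncomputable def tangentMapAt (f : G → G) (g : G) (v : E) : E :=
  deriv (fun s : ℝ => coord E (f g) (f (coordSymm E g (coord E g g + s • v)))) 0

variable (G) [Group G]

/-- Lie groups modelled on the convenient vector space `E`: the chart changings
are smooth, which means that they map smooth curves to smooth curves; multiplication
and inversion are smooth. The smooth curves in the product manifold `G × G` are the pairs of smooth
curves in `G`. -/
class ConvenientLieGroup : Prop where
  smooth_chart_change : ∀ φ ∈ atlas (CInf E) G, ∀ ψ ∈ atlas (CInf E) G, ∀ c : ℝ → E,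
    IsSmoothCurve c → (∀ t, toCInf E (c t) ∈ (φ.symm.trans ψ).source) →
      IsSmoothCurve (fun t => (toCInf E).symm (ψ (φ.symm (toCInf E (c t)))))
  smooth_mul : ∀ c d : ℝ → G, IsSmoothCurveIn E c → IsSmoothCurveIn E d →
    IsSmoothCurveIn E (fun t => c t * d t)
  smooth_inv : ∀ c : ℝ → G, IsSmoothCurveIn E c → IsSmoothCurveIn E (fun t => (c t)⁻¹)

/-! ### The Lie algebra

The Lie algebra is the tangent space at the identity, identified with `E` through the
preferred chart at the identity, with the bracket of left invariant vector fields. -/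

/-- The left invariant vector field `g ↦ T (x ↦ g * x) X`, written in the preferred chart at the
identity. -/
noncomputable def leftInvariantField (X : E) (x : E) : E :=
  deriv (fun s : ℝ => coord E (1 : G)
    (coordSymm E (1 : G) x * coordSymm E (1 : G) (coord E (1 : G) 1 + s • X))) 0

/-- The Lie bracket of `X` and `Y`: the value at the identity of the bracket of vector fields
`[L_X, L_Y] = dL_Y (L_X) - dL_X (L_Y)` computed in the preferred chart at the identity. -/
noncomputable def lieBracket (X Y : E) : E :=
  let x₀ : E := coord E (1 : G) 1
  deriv (fun s : ℝ => leftInvariantField E G Y (x₀ + s • leftInvariantField E G X x₀)) 0 -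
    deriv (fun s : ℝ => leftInvariantField E G X (x₀ + s • leftInvariantField E G Y x₀)) 0

variable {G}

/-- The adjoint action of `h`: the tangent map at the identity of `g ↦ h * g * h⁻¹`, in
the preferred chart at the identity. -/
noncomputable def Ad (h : G) (X : E) : E :=
  deriv (fun s : ℝ => coord E (1 : G)
    (h * coordSymm E (1 : G) (coord E (1 : G) 1 + s • X) * h⁻¹)) 0

/-- `h = exp Y`: there is a smooth one-parameter subgroup `α` with velocity `Y` at time `0` and
`α 1 = h`. -/
def IsExp (Y : E) (h : G) : Prop :=
  ∃ α : ℝ → G, IsSmoothCurveIn E α ∧ α 0 = 1 ∧ (∀ s t : ℝ, α (s + t) = α s * α t) ∧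
    deriv (fun s : ℝ => coord E (1 : G) (α s)) 0 = Y ∧ α 1 = h

variable (G)

/-- Regular Lie groups: each smooth curve `X` in the Lie algebra is the right logarithmic derivative
of a smooth curve `γ` in `G` with `γ 0 = 1`, and the map `X ↦ γ 1` from `C^∞(ℝ, 𝔤)` to `G`
is smooth. -/
def IsRegular [IsTopologicalAddGroup E] [ContinuousSMul ℝ E] [T2Space E] : Prop :=
  ∃ evol : CurveSpace E → G,
    (∀ X : CurveSpace E, ∃ γ : ℝ → G, IsSmoothCurveIn E γ ∧ γ 0 = 1 ∧
      (∀ t : ℝ, velocity E γ t = tangentMapAt E (fun g => g * γ t) 1 (X.1 t)) ∧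
      γ 1 = evol X) ∧
    ∀ X : ℝ → CurveSpace E, IsSmoothCurve X → IsSmoothCurveIn E (fun s => evol (X s))

/-! ### The three numbers

Each is the smallest natural number with a certain property, and `⊤` if there is none. -/

/-- The number `N_G`: near `1` every `g` is a product of `N` commutators `S_i(g) h_i S_i(g)⁻¹ h_i⁻¹`. -/
noncomputable def groupNumber : ℕ∞ :=
  sInf {M : ℕ∞ | ∃ N : ℕ, M = N ∧
    ∀ U : Set G, IsOpen U → (1 : G) ∈ U →
      ∃ (Y : Fin N → E) (h : Fin N → G), (∀ i, IsExp E (Y i) (h i) ∧ h i ∈ U) ∧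
        ∃ V : Set G, IsOpen V ∧ (1 : G) ∈ V ∧
          ∃ S : Fin N → G → G, (∀ i, IsSmoothMapOn E (S i) V ∧ S i 1 = 1) ∧
            ∀ g ∈ V, (List.ofFn fun i => S i g * h i * (S i g)⁻¹ * (h i)⁻¹).prod = g}

/-- The number `N_G^Ad`. -/
noncomputable def adNumber : ℕ∞ :=
  sInf {M : ℕ∞ | ∃ N : ℕ, M = N ∧
    ∀ U : Set G, IsOpen U → (1 : G) ∈ U →
      ∃ (Y : Fin N → E) (h : Fin N → G), (∀ i, IsExp E (Y i) (h i) ∧ h i ∈ U) ∧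
        ∃ s : Fin N → E →ₗ[ℝ] E, (∀ i, IsBoundedLinear (s i)) ∧
          ∀ X : E, ∑ i, (s i X - Ad E (h i) (s i X)) = X}

variable {E}

/-- The number `N_𝔤` of the Lie algebra `𝔤` with underlying space `E` and bracket `br`. -/
noncomputable def lieAlgebraNumber (br : E → E → E) : ℕ∞ :=
  sInf {M : ℕ∞ | ∃ N : ℕ, M = N ∧
    ∃ (Y : Fin N → E) (σ : Fin N → E →ₗ[ℝ] E), (∀ i, IsBoundedLinear (σ i)) ∧
      ∀ X : E, ∑ i, br (σ i X) (Y i) = X}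

end Manifolds

end ConvenientLie

/-!
# Three numbers attached to a regular Lie group

Smoothness in the sense of Kriegl and Michor is smoothness along smooth curves. The tools that
make this notion usable are the following. By Mackey's theorem and Mackey completeness, a curve in
a convenient vector space is smooth as soon as its compositions with enough continuous linear
functionals are (`DetectsBounded.isSmoothCurveOn`, `isSmoothCurve_iff`). By Boman's theorem
(`contDiffOn_of_smooth_along_curves`), a map from a finite-dimensional space which maps smooth
curves to smooth curves is smooth after composition with functionals (`weakSmoothOn_of_curves`).
So the differential calculus needed here is the classical one, applied to plots, that is, to
smooth maps from finite-dimensional parameter spaces to the group: partial derivatives commute,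
derivatives are linear and bounded, and the chain rule holds (`ESmoothOn.hasDerivAt_comp`).

*The adjoint action and the group.* If `∏ i, [S i g, h i] = g` near the identity, the derivatives
`s i` of the maps `S i` at the identity satisfy `∑ i, (s i X - Ad (h i) (s i X)) = X`, since a
curve `a` with `a 0 = 1` and velocity `v` has the commutators `[a, h]` with velocity `v - Ad h v`
(`HasVelocity.commutator`, `adNumber_le_groupNumber`).

*The Lie algebra and the adjoint action.* Along a one-parameter subgroup `a` with velocity `Y`,
the derivative of `Ad (a t) X` is `[Y, Ad (a t) X]` (`HasVelocity.hasDerivAt_Ad`,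
`hasDerivAt_Ad_oneParameter`). Hence `X - Ad (a 1) X = [∫ Ad (a t) X, Y]`, the integral being over
`[0, 1]`, and composition with this integral, a bounded operator, turns solutions of the equation
for the adjoint action into solutions of the equation for the bracket (`lieBracket_adIntegral`,
`lieAlgebraNumber_le_adNumber`).

*Banach–Lie groups.* Let `∑ i, [σ i X, Y i] = X`. Regularity provides the one-parameter subgroups
`γ i` with velocities `Y i` (`IsRegular.exists_oneParameter`). The operators
`∑ i, (id - Ad (γ i t)) ∘ σ i` depend smoothly on `t` in the operator norm, vanish at `t = 0` and
have the derivative `id` there, so that they are invertible for small `t ≠ 0`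
(`eventually_isUnit_commutatorOperator`). Such an operator is the derivative at the origin of
`X ↦ ∏ i, [exp (σ i X), γ i t]`, where any chart may take the place of `exp`. In Banach spaces,
smooth maps in the sense of curves are smooth in the sense of Fréchet (`ESmoothOn.contDiffOn`, a
consequence of the uniform boundedness principle), and the inverse function theorem solves
`∏ i, [S i g, γ i t] = g` near the identity (`exists_local_solution`). So all three numbers agree.
-/

open scoped ContDiff

namespace ConvenientLie

/-! ### Bounded sets and continuous linear functionals -/

section Scalarization

variable {E : Type*} [AddCommGroup E] [Module ℝ E] [TopologicalSpace E]

/-- A set `Λ` of continuous linear functionals detects boundedness if every set on which each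
member of `Λ` is bounded is von Neumann bounded. -/
def DetectsBounded (Λ : Set (E →L[ℝ] ℝ)) : Prop :=
  ∀ B : Set E, (∀ l ∈ Λ, ∃ C, ∀ x ∈ B, |l x| ≤ C) → Bornology.IsVonNBounded ℝ B

/-- In a seminormed space, weakly bounded sets are bounded: the uniform boundedness principle on the
dual, which is a Banach space. -/
theorem exists_norm_le_of_dual_bounded {F : Type*} [SeminormedAddCommGroup F] [NormedSpace ℝ F]
    {B : Set F} (h : ∀ l : F →ₗ[ℝ] ℝ, (∃ C, ∀ x, |l x| ≤ C * ‖x‖) → ∃ C, ∀ x ∈ B, |l x| ≤ C) :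
    ∃ C, ∀ x ∈ B, ‖x‖ ≤ C := by
  obtain ⟨C, hC⟩ := banach_steinhaus (E := F →L[ℝ] ℝ) (F := ℝ) (𝕜 := ℝ) (𝕜₂ := ℝ)
    (g := fun x : B => ContinuousLinearMap.apply ℝ ℝ (x : F)) (fun l => by
      obtain ⟨C, hC⟩ := h l ⟨‖l‖, l.le_opNorm⟩
      exact ⟨C, fun x => by simpa using hC x x.2⟩)
  refine ⟨C, fun x hx => ?_⟩
  obtain ⟨l, hl, hlx⟩ := exists_dual_vector'' ℝ x
  have h1 : ‖ContinuousLinearMap.apply ℝ ℝ x l‖ ≤ ‖ContinuousLinearMap.apply ℝ ℝ x‖ * ‖l‖ :=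
    ContinuousLinearMap.le_opNorm _ _
  have h2 := hC ⟨x, hx⟩
  have h3 : l x = ‖x‖ := by simpa using hlx
  simp only [ContinuousLinearMap.apply_apply, h3, norm_norm] at h1
  calc ‖x‖ ≤ ‖ContinuousLinearMap.apply ℝ ℝ x‖ * ‖l‖ := h1
    _ ≤ ‖ContinuousLinearMap.apply ℝ ℝ x‖ * 1 := by gcongr
    _ ≤ C := by simpa using h2

/-- Mackey's theorem: weakly bounded sets in locally convex spaces are bounded. -/
theorem detectsBounded_univ [IsTopologicalAddGroup E] [ContinuousSMul ℝ E]
    [LocallyConvexSpace ℝ E] : DetectsBounded (Set.univ : Set (E →L[ℝ] ℝ)) := by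
  intro B hB
  rw [(PolynormableSpace.withSeminorms ℝ E).isVonNBounded_iff_seminorm_bounded]
  rintro ⟨p, hp⟩
  have key : ∃ C, ∀ x ∈ B, p x ≤ C := by
    let iN : SeminormedAddCommGroup E := p.toAddGroupSeminorm.toSeminormedAddCommGroup
    let iS : @NormedSpace ℝ E _ iN :=
      @NormedSpace.mk ℝ E _ iN inferInstance (fun a b => (map_smul_eq_mul p a b).le)
    refine @exists_norm_le_of_dual_bounded E iN iS B fun l hl => ?_
    obtain ⟨C, hC⟩ := hl
    have hcont : Continuous l := by
      refine continuous_of_continuousAt_zero l ?_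
      rw [ContinuousAt, map_zero, tendsto_zero_iff_norm_tendsto_zero]
      have h0 : Tendsto (fun x => C * p x) (𝓝 0) (𝓝 0) := by
        have := (hp.tendsto 0).const_mul C
        simpa using this
      exact squeeze_zero (fun _ => norm_nonneg _) (fun x => hC x) h0
    exact hB ⟨l, hcont⟩ trivial
  obtain ⟨C, hC⟩ := key
  exact ⟨max C 0 + 1, by positivity, fun x hx =>
    lt_of_le_of_lt ((hC x hx).trans (le_max_left _ _)) (lt_add_one _)⟩

theorem exists_bound_of_isVonNBounded (l : E →L[ℝ] ℝ) {B : Set E}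
    (hB : Bornology.IsVonNBounded ℝ B) : ∃ C, ∀ x ∈ B, |l x| ≤ C := by
  have h := hB.image l
  rw [NormedSpace.isVonNBounded_iff, isBounded_iff_forall_norm_le] at h
  obtain ⟨C, hC⟩ := h
  exact ⟨C, fun x hx => hC _ ⟨x, hx, rfl⟩⟩

theorem DetectsBounded.eq_zero [ContinuousSMul ℝ E] [T2Space E]
    {Λ : Set (E →L[ℝ] ℝ)} (hΛ : DetectsBounded Λ) {x : E} (h : ∀ l ∈ Λ, l x = 0) : x = 0 := by
  have hB : Bornology.IsVonNBounded ℝ (Set.range fun n : ℕ => (n + 1 : ℝ) • x) := by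
    refine hΛ _ fun l hl => ⟨0, ?_⟩
    rintro _ ⟨n, rfl⟩
    simp [h l hl]
  have ht := hB.smul_tendsto_zero (ε := fun n : ℕ => 1 / ((n : ℝ) + 1))
    (x := fun n : ℕ => (n + 1 : ℝ) • x) (l := atTop) (Eventually.of_forall fun n => ⟨n, rfl⟩)
    tendsto_one_div_add_atTop_nhds_zero_nat
  refine tendsto_nhds_unique (f := fun _ : ℕ => x) (l := atTop) tendsto_const_nhds ?_
  refine ht.congr fun n => ?_
  have : (n + 1 : ℝ) ≠ 0 := by positivity
  simp only [Pi.smul_apply', smul_smul]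
  rw [one_div, inv_mul_cancel₀ this, one_smul]

theorem DetectsBounded.ext [ContinuousSMul ℝ E] [T2Space E]
    {Λ : Set (E →L[ℝ] ℝ)} (hΛ : DetectsBounded Λ) {x y : E} (h : ∀ l ∈ Λ, l x = l y) : x = y := by
  rw [← sub_eq_zero]
  exact hΛ.eq_zero fun l hl => by rw [map_sub, h l hl, sub_self]

theorem ext_dual [IsTopologicalAddGroup E] [ContinuousSMul ℝ E]
    [LocallyConvexSpace ℝ E] [T2Space E] {x y : E} (h : ∀ l : E →L[ℝ] ℝ, l x = l y) : x = y :=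
  detectsBounded_univ.ext fun l _ => h l

/-- Mackey completeness, tested on functionals: exponentially fast convergence of the scalar
sequences `l (x n)` yields a limit of the sequence `x n`. -/
theorem DetectsBounded.exists_tendsto [ConvenientSpace E] {Λ : Set (E →L[ℝ] ℝ)}
    (hΛ : DetectsBounded Λ) {x : ℕ → E}
    (h : ∀ l ∈ Λ, ∃ d C, ∀ n, |l (x n) - d| ≤ C * (1 / 2) ^ n) :
    ∃ a, Tendsto x atTop (𝓝 a) := by
  refine ConvenientSpace.exists_tendsto_of_isMackeyCauchy x
    ⟨Set.range fun p : ℕ × ℕ => (2 : ℝ) ^ (min p.1 p.2) • (x p.1 - x p.2), hΛ _ fun l hl => ?_,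
      fun p => (1 / 2) ^ (min p.1 p.2), ?_, fun m n => ⟨_, ⟨(m, n), rfl⟩, ?_⟩⟩
  · obtain ⟨d, C, hC⟩ := h l hl
    have hC0 : 0 ≤ C := by simpa using (abs_nonneg _).trans (hC 0)
    refine ⟨2 * C, ?_⟩
    rintro _ ⟨⟨m, n⟩, rfl⟩
    have e1 : (1 / 2 : ℝ) ^ m ≤ (1 / 2) ^ (min m n) :=
      pow_le_pow_of_le_one (by norm_num) (by norm_num) (min_le_left _ _)
    have e2 : (1 / 2 : ℝ) ^ n ≤ (1 / 2) ^ (min m n) :=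
      pow_le_pow_of_le_one (by norm_num) (by norm_num) (min_le_right _ _)
    have e3 : |l (x m) - l (x n)| ≤ 2 * C * (1 / 2) ^ (min m n) := by
      calc |l (x m) - l (x n)| = |(l (x m) - d) - (l (x n) - d)| := by ring_nf
        _ ≤ |l (x m) - d| + |l (x n) - d| := abs_sub _ _
        _ ≤ C * (1 / 2) ^ m + C * (1 / 2) ^ n := add_le_add (hC m) (hC n)
        _ ≤ C * (1 / 2) ^ (min m n) + C * (1 / 2) ^ (min m n) := by gcongr
        _ = _ := by ring
    simp only [map_smul, map_sub, smul_eq_mul, abs_mul, abs_pow, Nat.abs_ofNat]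
    calc (2 : ℝ) ^ (min m n) * |l (x m) - l (x n)|
        ≤ 2 ^ (min m n) * (2 * C * (1 / 2) ^ (min m n)) := by gcongr
      _ = 2 * C * (2 * (1 / 2)) ^ (min m n) := by rw [mul_pow]; ring
      _ = 2 * C := by norm_num
  · refine (tendsto_pow_atTop_nhds_zero_of_lt_one (by norm_num) (by norm_num)).comp ?_
    refine tendsto_atTop.2 fun b => ?_
    filter_upwards [eventually_ge_atTop ((b, b) : ℕ × ℕ)] with p hp
    exact le_min hp.1 hp.2
  · simp only [smul_smul, ← mul_pow]
    norm_num

/-! ### Smooth curves and continuous linear functionals -/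

/-- Continuous linear functionals commute with derivatives, also of curves in spaces without a
norm. -/
theorem HasDerivAt.clm_apply' [ContinuousSMul ℝ E] {c : ℝ → E} {v : E} {t : ℝ}
    (h : HasDerivAt c v t) (l : E →L[ℝ] ℝ) : HasDerivAt (fun s => l (c s)) (l v) t := by
  rw [hasDerivAt_iff_slope] at *
  have := (l.continuous.tendsto 0).comp h
  rw [map_zero] at this
  refine this.congr fun s => ?_
  simp

/-- The quadratic bound of the remainder in Taylor's formula, uniform near `t`. -/
theorem second_order_bound {g : ℝ → ℝ} {J : Set ℝ} (hJ : IsOpen J) (hg : ContDiffOn ℝ ∞ g J)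
    {t δ : ℝ} (hδ : Set.Icc (t - δ) (t + δ) ⊆ J) :
    ∃ C, ∀ h, |h| ≤ δ → |g (t + h) - g t - h * deriv g t| ≤ C * h ^ 2 := by
  have hg' : ContDiffOn ℝ ∞ (deriv g) J := hg.deriv_of_isOpen hJ (by simp)
  have hg'' : ContinuousOn (deriv (deriv g)) J :=
    (hg'.deriv_of_isOpen (m := ∞) hJ (by simp)).continuousOn
  obtain ⟨C, hC⟩ := isCompact_Icc.exists_bound_of_continuousOn (hg''.mono hδ)
  have hd : ∀ s ∈ J, HasDerivAt g (deriv g s) s := fun s hs =>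
    ((hg.differentiableOn (by simp)).differentiableAt (hJ.mem_nhds hs)).hasDerivAt
  have hd' : ∀ s ∈ J, HasDerivAt (deriv g) (deriv (deriv g) s) s := fun s hs =>
    ((hg'.differentiableOn (by simp)).differentiableAt (hJ.mem_nhds hs)).hasDerivAt
  refine ⟨C, fun h hh => ?_⟩
  have hh' := abs_le.1 hh
  have ht : t ∈ Set.Icc (t - δ) (t + δ) := ⟨by linarith [abs_nonneg h], by linarith [abs_nonneg h]⟩
  have hth : t + h ∈ Set.Icc (t - δ) (t + δ) := ⟨by linarith, by linarith⟩
  have hsub : Set.uIcc t (t + h) ⊆ Set.Icc (t - δ) (t + δ) := Set.uIcc_subset_Icc ht hth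
  have hC0 : 0 ≤ C := (norm_nonneg _).trans (hC t ht)
  have step1 : ∀ s ∈ Set.uIcc t (t + h), |deriv g s - deriv g t| ≤ C * |h| := by
    intro s hs
    have := (convex_uIcc t (t + h)).norm_image_sub_le_of_norm_hasDerivWithin_le
      (fun x hx => (hd' x (hδ (hsub hx))).hasDerivWithinAt) (fun x hx => hC x (hsub hx))
      Set.left_mem_uIcc hs
    refine this.trans ?_
    gcongr
    have := Set.abs_sub_left_of_mem_uIcc hs
    simpa [Real.norm_eq_abs, abs_sub_comm] using this
  have := (convex_uIcc t (t + h)).norm_image_sub_le_of_norm_hasDerivWithin_le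
      (f := fun s => g s - s * deriv g t) (f' := fun s => deriv g s - 1 * deriv g t) (C := C * |h|)
      (fun x hx => ((hd x (hδ (hsub hx))).sub
        ((hasDerivAt_id x).mul_const _)).hasDerivWithinAt)
      (fun x hx => by simpa using step1 x hx)
      Set.left_mem_uIcc Set.right_mem_uIcc
  rw [Real.norm_eq_abs, Real.norm_eq_abs] at this
  calc |g (t + h) - g t - h * deriv g t|
      = |g (t + h) - (t + h) * deriv g t - (g t - t * deriv g t)| := by congr 1; ring
    _ ≤ C * |h| * |t + h - t| := this
    _ = C * h ^ 2 := by rw [add_sub_cancel_left, mul_assoc, ← sq, sq_abs]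

variable [ConvenientSpace E]

/-- A curve which is smooth when composed with enough functionals has a derivative in the
convenient space `E`. By Taylor's formula the difference quotients are Mackey–Cauchy, and they
converge to their limit `v` at the rate `s - t` times a bounded set. -/
theorem DetectsBounded.exists_hasDerivAt {Λ : Set (E →L[ℝ] ℝ)} (hΛ : DetectsBounded Λ)
    {c : ℝ → E} {J : Set ℝ} (hJ : IsOpen J) (hc : ∀ l ∈ Λ, ContDiffOn ℝ ∞ (fun s => l (c s)) J)
    {t : ℝ} (ht : t ∈ J) : ∃ v, HasDerivAt c v t := by
  obtain ⟨δ, hδ, hδJ⟩ : ∃ δ > 0, Set.Icc (t - δ) (t + δ) ⊆ J := by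
    obtain ⟨δ, hδ, h⟩ := Metric.nhds_basis_closedBall.mem_iff.1 (hJ.mem_nhds ht)
    exact ⟨δ, hδ, by rwa [Real.closedBall_eq_Icc] at h⟩
  have hT : ∀ l ∈ Λ, ∃ C, ∀ h, |h| ≤ δ →
      |l (c (t + h)) - l (c t) - h * deriv (fun s => l (c s)) t| ≤ C * h ^ 2 :=
    fun l hl => second_order_bound hJ (hc l hl) hδJ
  set q : ℝ → E := fun h => h⁻¹ • (c (t + h) - c t) with hq
  have hTq : ∀ l ∈ Λ, ∃ C, ∀ h, h ≠ 0 → |h| ≤ δ →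
      |l (q h) - deriv (fun s => l (c s)) t| ≤ C * |h| := by
    intro l hl
    obtain ⟨C, hC⟩ := hT l hl
    refine ⟨C, fun h h0 hh => ?_⟩
    have e : l (q h) - deriv (fun s => l (c s)) t
        = h⁻¹ * (l (c (t + h)) - l (c t) - h * deriv (fun s => l (c s)) t) := by
      simp only [hq, map_smul, map_sub, smul_eq_mul]
      field_simp
    rw [e, abs_mul, abs_inv]
    calc |h|⁻¹ * _ ≤ |h|⁻¹ * (C * h ^ 2) := by gcongr; exact hC h hh
      _ = C * |h| := by
        rw [← sq_abs]
        have := abs_ne_zero.2 h0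
        field_simp
  obtain ⟨v, hv⟩ : ∃ v, Tendsto (fun n : ℕ => q (δ * (1 / 2) ^ n)) atTop (𝓝 v) := by
    refine hΛ.exists_tendsto fun l hl => ?_
    obtain ⟨C, hC⟩ := hTq l hl
    refine ⟨deriv (fun s => l (c s)) t, C * δ, fun n => ?_⟩
    have e : |δ * (1 / 2) ^ n| = δ * (1 / 2) ^ n := abs_of_pos (by positivity)
    have := hC (δ * (1 / 2) ^ n) (by positivity) (by
      rw [e]
      exact mul_le_of_le_one_right hδ.le (pow_le_one₀ (by norm_num) (by norm_num)))
    rw [e] at this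
    linarith
  have hlv : ∀ l ∈ Λ, l v = deriv (fun s => l (c s)) t := by
    intro l hl
    obtain ⟨C, hC⟩ := hTq l hl
    refine tendsto_nhds_unique ((l.continuous.tendsto v).comp hv) ?_
    rw [tendsto_iff_norm_sub_tendsto_zero]
    have h0 : Tendsto (fun n : ℕ => C * δ * (1 / 2) ^ n) atTop (𝓝 0) := by
      have := (tendsto_pow_atTop_nhds_zero_of_lt_one (r := (1 / 2 : ℝ)) (by norm_num)
        (by norm_num)).const_mul (C * δ)
      simpa using this
    refine squeeze_zero (fun _ => norm_nonneg _) (fun n => ?_) h0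
    have e : |δ * (1 / 2) ^ n| = δ * (1 / 2) ^ n := abs_of_pos (by positivity)
    have := hC (δ * (1 / 2) ^ n) (by positivity) (by
      rw [e]
      exact mul_le_of_le_one_right hδ.le (pow_le_one₀ (by norm_num) (by norm_num)))
    rw [e] at this
    simp only [Function.comp_apply, Real.norm_eq_abs]
    linarith
  refine ⟨v, ?_⟩
  rw [hasDerivAt_iff_slope]
  set b : ℝ → E := fun s => ((s - t) ^ 2)⁻¹ • (c s - c t - (s - t) • v) with hb
  have hB : Bornology.IsVonNBounded ℝ (b '' Metric.closedBall t δ) := by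
    refine hΛ _ fun l hl => ?_
    obtain ⟨C, hC⟩ := hT l hl
    refine ⟨|C|, ?_⟩
    rintro _ ⟨s, hs, rfl⟩
    have hs' : |s - t| ≤ δ := by simpa [Real.dist_eq] using hs
    have := hC (s - t) hs'
    simp only [add_sub_cancel] at this
    simp only [hb, map_smul, map_sub, smul_eq_mul, hlv l hl, abs_mul, abs_inv]
    rw [abs_of_nonneg (sq_nonneg (s - t))]
    rcases eq_or_ne s t with rfl | hst
    · simp
    have hpos : 0 < (s - t) ^ 2 := by have := sub_ne_zero.2 hst; positivity
    rw [inv_mul_le_iff₀ hpos]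
    calc _ ≤ C * (s - t) ^ 2 := this
      _ ≤ |C| * (s - t) ^ 2 := by gcongr; exact le_abs_self C
      _ = _ := by ring
  have h1 : Tendsto (fun s : ℝ => s - t) (𝓝 t) (𝓝 0) := by
    have : Tendsto (fun s : ℝ => s - t) (𝓝 t) (𝓝 (t - t)) := by
      exact (continuous_id.sub continuous_const).tendsto t
    simpa using this
  have := hB.smul_tendsto_zero (ε := fun s : ℝ => s - t) (x := b) (l := 𝓝 t) (by
    filter_upwards [Metric.closedBall_mem_nhds t hδ] with s hs using ⟨s, hs, rfl⟩) h1
  refine this.congr fun s => ?_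
  simp only [hb, Pi.smul_apply', smul_smul]
  rcases eq_or_ne s t with rfl | hst
  · simp
  have : s - t ≠ 0 := sub_ne_zero.2 hst
  congr 1
  field_simp

/-- Smoothness of curves can be tested on any set of functionals that detects boundedness. -/
theorem DetectsBounded.isSmoothCurveOn {Λ : Set (E →L[ℝ] ℝ)} (hΛ : DetectsBounded Λ)
    {c : ℝ → E} {J : Set ℝ} (hJ : IsOpen J)
    (hc : ∀ l ∈ Λ, ContDiffOn ℝ ∞ (fun s => l (c s)) J) : IsSmoothCurveOn c J := by
  intro n
  induction n generalizing c with
  | zero =>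
    intro t ht
    exact differentiableAt_iff_exists.2 (hΛ.exists_hasDerivAt hJ hc ht)
  | succ n ih =>
    intro t ht
    rw [Function.iterate_succ_apply]
    refine ih (fun l hl => ?_) t ht
    refine ((hc l hl).deriv_of_isOpen (m := ∞) hJ (by simp)).congr fun s hs => ?_
    obtain ⟨v, hv⟩ := hΛ.exists_hasDerivAt hJ hc hs
    rw [deriv_eq_of_hasDerivAt hv]
    exact (HasDerivAt.clm_apply' hv l).deriv.symm

theorem IsSmoothCurveOn.contDiffOn {c : ℝ → E} {J : Set ℝ} (hJ : IsOpen J)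
    (hc : IsSmoothCurveOn c J) (l : E →L[ℝ] ℝ) : ContDiffOn ℝ ∞ (fun s => l (c s)) J := by
  have key : ∀ n : ℕ, ∀ c : ℝ → E, IsSmoothCurveOn c J → ContDiffOn ℝ n (fun s => l (c s)) J := by
    intro n
    induction n with
    | zero =>
      intro c hc
      refine contDiffOn_zero.2 fun t ht => ?_
      exact (HasDerivAt.clm_apply' (hasDerivAt_deriv (hc 0 t ht)) l).continuousAt.continuousWithinAt
    | succ n ih =>
      intro c hc
      have hd : ∀ t ∈ J, HasDerivAt (fun s => l (c s)) (l (deriv c t)) t := fun t ht =>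
        HasDerivAt.clm_apply' (hasDerivAt_deriv (hc 0 t ht)) l
      push_cast
      rw [contDiffOn_succ_iff_deriv_of_isOpen hJ]
      refine ⟨fun t ht => (hd t ht).differentiableAt.differentiableWithinAt, by simp, ?_⟩
      refine (ih (deriv c) fun k t ht => ?_).congr fun t ht => (hd t ht).deriv
      have := hc (k + 1) t ht
      rwa [Function.iterate_succ_apply] at this
  exact contDiffOn_infty.2 fun n => key n c hc

theorem isSmoothCurveOn_iff {c : ℝ → E} {J : Set ℝ} (hJ : IsOpen J) :
    IsSmoothCurveOn c J ↔ ∀ l : E →L[ℝ] ℝ, ContDiffOn ℝ ∞ (fun s => l (c s)) J :=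
  ⟨fun h l => h.contDiffOn hJ l, fun h => detectsBounded_univ.isSmoothCurveOn hJ fun l _ => h l⟩

theorem isSmoothCurve_iff {c : ℝ → E} :
    IsSmoothCurve c ↔ ∀ l : E →L[ℝ] ℝ, ContDiff ℝ ∞ (fun s => l (c s)) := by
  simp only [← contDiffOn_univ]
  exact isSmoothCurveOn_iff isOpen_univ

theorem hasDerivAt_of_dual {c : ℝ → E} {J : Set ℝ} (hJ : IsOpen J)
    (hc : ∀ l : E →L[ℝ] ℝ, ContDiffOn ℝ ∞ (fun s => l (c s)) J) {t : ℝ} (ht : t ∈ J) :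
    HasDerivAt c (deriv c t) t :=
  hasDerivAt_deriv ((isSmoothCurveOn_iff hJ).2 hc 0 t ht)

end Scalarization

/-! ### Curves through rapidly decreasing sequences -/

section SpecialCurves

/-- A smooth function equal to `1` near `1` and vanishing outside `(3 / 4, 5 / 4)`. -/
noncomputable def bumpAtOne : ContDiffBump (1 : ℝ) := ⟨1 / 8, 1 / 4, by norm_num, by norm_num⟩

theorem bumpAtOne_eq_zero {u : ℝ} (h : u ∉ Set.Ioo (3 / 4 : ℝ) (5 / 4)) : bumpAtOne u = 0 := by
  refine bumpAtOne.zero_of_le_dist ?_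
  rw [Real.dist_eq]
  by_contra hlt
  have := abs_lt.1 (not_le.1 hlt)
  refine h ⟨?_, ?_⟩ <;> simp only [bumpAtOne] at this <;> linarith

theorem bumpAtOne_eq_one {u : ℝ} (h : |u - 1| ≤ 1 / 8) : bumpAtOne u = 1 :=
  bumpAtOne.one_of_mem_closedBall (by simpa [Real.dist_eq, bumpAtOne] using h)

/-- The sum of the scaled copies `F (2 ^ n * t) • a n` of one profile `F`. -/
noncomputable def pulse {E : Type*} [AddCommGroup E] [Module ℝ E] (F : ℝ → ℝ) (a : ℕ → E)
    (t : ℝ) : E :=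
  ∑ᶠ n : ℕ, F (2 ^ n * t) • a n

/-- The profiles considered vanish outside `(3 / 4, 5 / 4)`, so that the scaled copies have disjoint
supports. -/
def IsProfile (F : ℝ → ℝ) : Prop :=
  ContDiff ℝ ∞ F ∧ ∀ u, u ∉ Set.Ioo (3 / 4 : ℝ) (5 / 4) → F u = 0

theorem eq_of_scaled_mem {t : ℝ} {m n : ℕ} (hm : 2 ^ m * t ∈ Set.Ioo (3 / 4 : ℝ) (5 / 4))
    (hn : 2 ^ n * t ∈ Set.Ioo (3 / 4 : ℝ) (5 / 4)) : m = n := by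
  have key : ∀ m n : ℕ, 2 ^ m * t ∈ Set.Ioo (3 / 4 : ℝ) (5 / 4) →
      2 ^ n * t ∈ Set.Ioo (3 / 4 : ℝ) (5 / 4) → ¬ m < n := by
    intro m n hm hn hlt
    obtain ⟨k, rfl⟩ := Nat.exists_eq_add_of_lt hlt
    have h1 : (2 : ℝ) ^ (m + k + 1) * t = 2 ^ k * 2 * (2 ^ m * t) := by ring
    have h2 : (1 : ℝ) ≤ 2 ^ k := one_le_pow₀ (by norm_num)
    rw [h1] at hn
    nlinarith [hm.1, hn.2]
  exact le_antisymm (not_lt.1 (key n m hn hm)) (not_lt.1 (key m n hm hn))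

section Algebra

variable {E : Type*} [AddCommGroup E] [Module ℝ E]

theorem pulse_eq_single {F : ℝ → ℝ} (hF : IsProfile F) (a : ℕ → E) {t : ℝ} {n : ℕ}
    (hn : 2 ^ n * t ∈ Set.Ioo (3 / 4 : ℝ) (5 / 4)) : pulse F a t = F (2 ^ n * t) • a n := by
  refine finsum_eq_single _ n fun m hm => ?_
  rw [hF.2, zero_smul]
  exact fun h => hm (eq_of_scaled_mem h hn)

theorem pulse_eq_zero {F : ℝ → ℝ} (hF : IsProfile F) (a : ℕ → E) {t : ℝ}
    (h : ∀ n : ℕ, 2 ^ n * t ∉ Set.Ioo (3 / 4 : ℝ) (5 / 4)) : pulse F a t = 0 := by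
  refine finsum_eq_zero_of_forall_eq_zero fun m => ?_
  rw [hF.2 _ (h m), zero_smul]

theorem pulse_zero {F : ℝ → ℝ} (hF : IsProfile F) (a : ℕ → E) : pulse F a 0 = 0 :=
  pulse_eq_zero hF a fun n => by simp only [mul_zero, Set.mem_Ioo, not_and_or]; left; norm_num

theorem map_pulse {F : ℝ → ℝ} (hF : IsProfile F) {E' : Type*} [AddCommGroup E'] [Module ℝ E']
    (l : E →ₗ[ℝ] E') (a : ℕ → E) (t : ℝ) : l (pulse F a t) = pulse F (fun n => l (a n)) t := by
  by_cases h : ∃ n : ℕ, 2 ^ n * t ∈ Set.Ioo (3 / 4 : ℝ) (5 / 4)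
  · obtain ⟨n, hn⟩ := h
    rw [pulse_eq_single hF _ hn, pulse_eq_single hF _ hn, map_smul]
  · push Not at h
    rw [pulse_eq_zero hF _ h, pulse_eq_zero hF _ h, map_zero]

end Algebra

/-- A sequence decreasing faster than every power of `2 ^ n`. -/
def Rapid {V : Type*} [NormedAddCommGroup V] (a : ℕ → V) : Prop :=
  ∀ k : ℕ, ∃ C, ∀ n : ℕ, ((2 : ℝ) ^ n) ^ k * ‖a n‖ ≤ C

/-- The weights `2 ^ (-n ^ 2)` used for rapidly decreasing sequences. -/
noncomputable def weight (n : ℕ) : ℝ := (1 / 2) ^ (n ^ 2)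

theorem weight_pos (n : ℕ) : 0 < weight n := by unfold weight; positivity

theorem rapid_of_le_weight {V : Type*} [NormedAddCommGroup V] {a : ℕ → V} {C : ℝ}
    (h : ∀ n, ‖a n‖ ≤ C * weight n) : Rapid a := by
  have hC : 0 ≤ C := by
    have := (norm_nonneg _).trans (h 0)
    simpa [weight] using this
  refine fun k => ⟨2 ^ (k ^ 2) * C, fun n => ?_⟩
  have h1 : ((2 : ℝ) ^ n) ^ k ≤ 2 ^ (k ^ 2) * 2 ^ (n ^ 2) := by
    rw [← pow_mul, ← pow_add]
    exact pow_le_pow_right₀ (by norm_num) (by nlinarith [Nat.le_total n k, sq_nonneg ((n : ℤ) - k)])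
  have h2 : (2 : ℝ) ^ (n ^ 2) * weight n = 1 := by
    unfold weight; rw [← mul_pow]; norm_num
  calc ((2 : ℝ) ^ n) ^ k * ‖a n‖ ≤ (2 ^ (k ^ 2) * 2 ^ (n ^ 2)) * (C * weight n) := by
        gcongr
        exact h n
    _ = 2 ^ (k ^ 2) * C * (2 ^ (n ^ 2) * weight n) := by ring
    _ = _ := by rw [h2, mul_one]

/-- The `k`-th derivatives of the summands grow by the factor `2 ^ (n * k)` only, which the sequence
`a` absorbs. -/
theorem contDiff_pulse {V : Type*} [NormedAddCommGroup V] [NormedSpace ℝ V] [CompleteSpace V]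
    {F : ℝ → ℝ} (hF : IsProfile F) {a : ℕ → V} (ha : Rapid a) : ContDiff ℝ ∞ (pulse F a) := by
  have hsupp : HasCompactSupport F := HasCompactSupport.intro (isCompact_Icc (a := (3 / 4 : ℝ))
    (b := 5 / 4)) fun x hx => hF.2 x fun h => hx (Set.Ioo_subset_Icc_self h)
  have hbd : ∀ k : ℕ, ∃ C, ∀ x, ‖iteratedDeriv k F x‖ ≤ C := by
    intro k
    obtain ⟨C, hC⟩ := (hF.1.continuous_iteratedFDeriv (m := k)
      (by exact_mod_cast le_top)).bounded_above_of_compact_support (hsupp.iteratedFDeriv k)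
    exact ⟨C, fun x => by rw [← norm_iteratedFDeriv_eq_norm_iteratedDeriv]; exact hC x⟩
  choose C hC using hbd
  choose D hD using ha
  have heq : pulse F a = fun t => ∑' n : ℕ, F (2 ^ n * t) • a n := by
    funext t
    refine (tsum_eq_finsum ?_).symm
    by_cases h : ∃ n : ℕ, 2 ^ n * t ∈ Set.Ioo (3 / 4 : ℝ) (5 / 4)
    · obtain ⟨n, hn⟩ := h
      refine (Set.finite_singleton n).subset fun m hm => ?_
      by_contra hne
      refine hm ?_
      simp only
      rw [hF.2, zero_smul]
      exact fun h => hne (eq_of_scaled_mem h hn)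
    · push Not at h
      refine Set.finite_empty.subset fun m hm => hm ?_
      simp only
      rw [hF.2 _ (h m), zero_smul]
  have hsm : ∀ n : ℕ, ContDiff ℝ ∞ fun t : ℝ => F (2 ^ n * t) := fun n =>
    hF.1.comp (contDiff_const.mul contDiff_id)
  rw [heq]
  refine contDiff_tsum (N := ⊤) (v := fun k n => C k * D (k + 1) * (1 / 2) ^ n) (fun n => ?_)
    (fun k _ => (summable_geometric_of_lt_one (by norm_num) (by norm_num)).mul_left _) ?_
  · exact (hsm n).smul contDiff_const
  · intro k n x _
    have hC0 : 0 ≤ C k := (norm_nonneg _).trans (hC k 0)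
    have h1 := (ContinuousLinearMap.toSpanSingleton ℝ (a n)).norm_iteratedFDeriv_comp_left
      (f := fun t : ℝ => F (2 ^ n * t)) (x := x) (N := ∞) (n := k) (hsm n).contDiffAt
      (by exact_mod_cast le_top)
    rw [norm_iteratedFDeriv_eq_norm_iteratedDeriv (f := fun t : ℝ => F (2 ^ n * t)),
      iteratedDeriv_comp_const_mul (hF.1.of_le (by exact_mod_cast le_top)),
      ContinuousLinearMap.norm_toSpanSingleton] at h1
    refine h1.trans ?_
    rw [norm_mul, norm_pow, norm_pow, Real.norm_ofNat]
    have h2 : ((2 : ℝ) ^ n) ^ k * ‖a n‖ ≤ D (k + 1) * (1 / 2) ^ n := by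
      have := hD (k + 1) n
      rw [one_div, inv_pow, ← div_eq_mul_inv, le_div_iff₀ (by positivity)]
      calc _ = ((2 : ℝ) ^ n) ^ (k + 1) * ‖a n‖ := by ring
        _ ≤ _ := this
    calc ‖a n‖ * ((2 ^ n) ^ k * ‖iteratedDeriv k F (2 ^ n * x)‖)
        = ‖iteratedDeriv k F (2 ^ n * x)‖ * (((2 : ℝ) ^ n) ^ k * ‖a n‖) := by ring
      _ ≤ C k * (D (k + 1) * (1 / 2) ^ n) := by
          gcongr
          exact hC k _
      _ = _ := by ring

theorem isProfile_bump : IsProfile bumpAtOne :=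
  ⟨bumpAtOne.contDiff, fun _ h => bumpAtOne_eq_zero h⟩

theorem isProfile_bump_mul : IsProfile fun u => bumpAtOne u * (u - 1) :=
  ⟨bumpAtOne.contDiff.mul (contDiff_id.sub contDiff_const), fun u h => by
    simp only [bumpAtOne_eq_zero h, zero_mul]⟩

/-- A curve that passes through the point `a n` at the time `2 ^ (-n)`, with constant velocity `b n`
near that time. -/
noncomputable def specialCurve {E : Type*} [AddCommGroup E] [Module ℝ E] (a b : ℕ → E)
    (t : ℝ) : E :=
  pulse bumpAtOne a t + pulse (fun u => bumpAtOne u * (u - 1)) (fun n => (1 / 2 : ℝ) ^ n • b n) t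

theorem specialCurve_zero {E : Type*} [AddCommGroup E] [Module ℝ E] (a b : ℕ → E) :
    specialCurve a b 0 = 0 := by
  rw [specialCurve, pulse_zero isProfile_bump, pulse_zero isProfile_bump_mul, add_zero]

theorem map_specialCurve {E : Type*} [AddCommGroup E] [Module ℝ E]
    {E' : Type*} [AddCommGroup E'] [Module ℝ E'] (l : E →ₗ[ℝ] E') (a b : ℕ → E) (t : ℝ) :
    l (specialCurve a b t) = specialCurve (fun n => l (a n)) (fun n => l (b n)) t := by
  simp only [specialCurve, map_add, map_pulse isProfile_bump, map_pulse isProfile_bump_mul,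
    map_smul]

theorem specialCurve_eventuallyEq {E : Type*} [AddCommGroup E] [Module ℝ E] (a b : ℕ → E) (n : ℕ) :
    ∀ᶠ t in 𝓝 ((1 / 2 : ℝ) ^ n), specialCurve a b t = a n + (t - (1 / 2) ^ n) • b n := by
  have hlim : Tendsto (fun t : ℝ => 2 ^ n * t) (𝓝 ((1 / 2 : ℝ) ^ n)) (𝓝 1) := by
    have : (2 : ℝ) ^ n * (1 / 2) ^ n = 1 := by rw [← mul_pow]; norm_num
    have hcont : Continuous fun t : ℝ => (2 : ℝ) ^ n * t := by fun_prop
    have hl := hcont.tendsto ((1 / 2 : ℝ) ^ n)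
    rwa [this] at hl
  filter_upwards [hlim (Metric.closedBall_mem_nhds 1 (by norm_num : (0 : ℝ) < 1 / 8))] with t ht
  have ht' : |2 ^ n * t - 1| ≤ 1 / 8 := by simpa [Real.dist_eq] using ht
  have hmem : 2 ^ n * t ∈ Set.Ioo (3 / 4 : ℝ) (5 / 4) := by
    have := abs_le.1 ht'
    exact ⟨by linarith, by linarith⟩
  rw [specialCurve, pulse_eq_single isProfile_bump _ hmem,
    pulse_eq_single isProfile_bump_mul _ hmem, bumpAtOne_eq_one ht', one_smul, one_mul, smul_smul]
  congr 2
  have : (2 : ℝ) ^ n * (1 / 2) ^ n = 1 := by rw [← mul_pow]; norm_num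
  linear_combination t * this

theorem specialCurve_apply {E : Type*} [AddCommGroup E] [Module ℝ E] (a b : ℕ → E) (n : ℕ) :
    specialCurve a b ((1 / 2 : ℝ) ^ n) = a n := by
  simpa using (specialCurve_eventuallyEq a b n).self_of_nhds

theorem Rapid.half_pow_smul {V : Type*} [NormedAddCommGroup V] [NormedSpace ℝ V] {b : ℕ → V}
    (hb : Rapid b) : Rapid fun n => (1 / 2 : ℝ) ^ n • b n := by
  intro k
  obtain ⟨C, hC⟩ := hb k
  refine ⟨C, fun n => le_trans ?_ (hC n)⟩
  gcongr
  rw [norm_smul]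
  refine mul_le_of_le_one_left (norm_nonneg _) ?_
  rw [norm_pow]
  exact pow_le_one₀ (norm_nonneg _) (by norm_num)

theorem contDiff_specialCurve {V : Type*} [NormedAddCommGroup V] [NormedSpace ℝ V]
    [CompleteSpace V] {a b : ℕ → V} (ha : Rapid a) (hb : Rapid b) :
    ContDiff ℝ ∞ (specialCurve a b) :=
  (contDiff_pulse isProfile_bump ha).add (contDiff_pulse isProfile_bump_mul hb.half_pow_smul)

theorem rapid_zero {V : Type*} [NormedAddCommGroup V] : Rapid fun _ : ℕ => (0 : V) :=
  fun _ => ⟨0, fun n => by simp⟩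

theorem tendsto_half_pow : Tendsto (fun n : ℕ => (1 / 2 : ℝ) ^ n) atTop (𝓝 0) :=
  tendsto_pow_atTop_nhds_zero_of_lt_one (by norm_num) (by norm_num)

/-- In a Banach space, sets whose preimages under all smooth curves are open are open. -/
theorem isOpen_of_forall_curve {V : Type*} [NormedAddCommGroup V] [NormedSpace ℝ V]
    [CompleteSpace V] {W : Set V} (h : ∀ c : ℝ → V, ContDiff ℝ ∞ c → IsOpen (c ⁻¹' W)) :
    IsOpen W := by
  rw [isOpen_iff_mem_nhds]
  intro x hx
  by_contra hW
  have hex : ∀ n : ℕ, ∃ y ∈ Metric.ball x (weight n), y ∉ W := by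
    intro n
    by_contra hcon
    push Not at hcon
    exact hW (mem_of_superset (Metric.ball_mem_nhds x (weight_pos n)) hcon)
  choose y hy hyW using hex
  have hr : Rapid fun n => y n - x := rapid_of_le_weight (C := 1) fun n => by
    have := hy n
    rw [Metric.mem_ball, dist_eq_norm] at this
    simpa using this.le
  have hc : ContDiff ℝ ∞ fun t => x + specialCurve (fun n => y n - x) (fun _ => 0) t :=
    contDiff_const.add (contDiff_specialCurve hr rapid_zero)
  have h0 : (0 : ℝ) ∈ (fun t => x + specialCurve (fun n => y n - x) (fun _ => 0) t) ⁻¹' W := by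
    simpa [specialCurve_zero] using hx
  have := tendsto_half_pow.eventually ((h _ hc).mem_nhds h0)
  obtain ⟨n, hn⟩ := this.exists
  simp only [specialCurve_apply, add_sub_cancel] at hn
  exact hyW n hn

/-- A special curve of a convenient vector space through sequences that are weakly of the order of
`weight`. -/
theorem isSmoothCurve_specialCurve {E : Type*} [AddCommGroup E] [Module ℝ E] [TopologicalSpace E]
    [ConvenientSpace E] {a b : ℕ → E}
    (ha : ∀ l : E →L[ℝ] ℝ, ∃ C, ∀ n, |l (a n)| ≤ C * weight n)
    (hb : ∀ l : E →L[ℝ] ℝ, ∃ C, ∀ n, |l (b n)| ≤ C * weight n) :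
    IsSmoothCurve (specialCurve a b) := by
  rw [isSmoothCurve_iff]
  intro l
  obtain ⟨C, hC⟩ := ha l
  obtain ⟨D, hD⟩ := hb l
  have : (fun s => l (specialCurve a b s)) =
      specialCurve (fun n => l (a n)) (fun n => l (b n)) := by
    funext s
    exact map_specialCurve (l : E →ₗ[ℝ] ℝ) a b s
  rw [this]
  exact contDiff_specialCurve (rapid_of_le_weight hC) (rapid_of_le_weight hD)

/-- A linear functional which is bounded near `0` along every smooth curve through `0` is bounded
on bounded sets. -/
theorem bounded_of_locally_bounded_along_curves {E : Type*} [AddCommGroup E] [Module ℝ E]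
    [TopologicalSpace E] [ConvenientSpace E] (f : E →ₗ[ℝ] ℝ)
    (hf : ∀ y : ℝ → E, IsSmoothCurve y → y 0 = 0 → ∃ C, ∀ᶠ t in 𝓝 0, |f (y t)| ≤ C)
    {B : Set E} (hB : Bornology.IsVonNBounded ℝ B) : ∃ C, ∀ x ∈ B, |f x| ≤ C := by
  by_contra hcon
  push Not at hcon
  -- The points `weight n • x n` lie on a smooth curve, while `f` takes values of size `n` there.
  choose x hxB hx using fun n : ℕ => hcon (n / weight n)
  have hsm : IsSmoothCurve (specialCurve (fun n => weight n • x n) (fun _ => 0)) := by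
    refine isSmoothCurve_specialCurve (fun l => ?_) (fun l => ⟨0, fun n => by simp⟩)
    obtain ⟨C, hC⟩ := exists_bound_of_isVonNBounded l hB
    refine ⟨C, fun n => ?_⟩
    rw [map_smul, smul_eq_mul, abs_mul, abs_of_pos (weight_pos n), mul_comm]
    exact mul_le_mul_of_nonneg_right (hC _ (hxB n)) (weight_pos n).le
  obtain ⟨C, hC⟩ := hf _ hsm (specialCurve_zero _ _)
  obtain ⟨N, hN⟩ := (tendsto_half_pow.eventually hC).exists_forall_of_atTop
  obtain ⟨M, hM⟩ := exists_nat_gt C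
  have h1 := hN (max N M) (le_max_left _ _)
  have h2 := hx (max N M)
  rw [specialCurve_apply, map_smul, smul_eq_mul, abs_mul, abs_of_pos (weight_pos _)] at h1
  rw [div_lt_iff₀ (weight_pos _), mul_comm] at h2
  have h3 : (M : ℝ) ≤ ((max N M : ℕ) : ℝ) := by exact_mod_cast le_max_right _ _
  linarith

end SpecialCurves

/-! ### Boman's theorem -/

section Boman

open MeasureTheory FourierTransform

theorem norm_fwdDiff_iter_le {F : Type*} [NormedAddCommGroup F] [NormedSpace ℝ F] {δ C : ℝ}
    (hδ : 0 ≤ δ) (k : ℕ) {g : ℝ → F} (hg : ContDiff ℝ ∞ g)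
    (hC : ∀ t, ‖iteratedDeriv k g t‖ ≤ C) (t : ℝ) : ‖(fwdDiff δ)^[k] g t‖ ≤ C * δ ^ k := by
  induction k generalizing g C with
  | zero => simpa using hC t
  | succ k ih =>
    rw [Function.iterate_succ_apply]
    have hshift : ContDiff ℝ ∞ fun s => g (s + δ) := hg.comp (contDiff_id.add contDiff_const)
    have hd : ∀ s, iteratedDeriv k (fwdDiff δ g) s
        = iteratedDeriv k g (s + δ) - iteratedDeriv k g s := by
      intro s
      have h1 : fwdDiff δ g = (fun s => g (s + δ)) - g := rfl
      rw [h1, iteratedDeriv_sub ((hshift.of_le (by exact_mod_cast le_top)).contDiffAt)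
        ((hg.of_le (by exact_mod_cast le_top)).contDiffAt), iteratedDeriv_comp_add_const]
    have hdiff : Differentiable ℝ (iteratedDeriv k g) :=
      hg.differentiable_iteratedDeriv k (by exact_mod_cast ENat.natCast_lt_top k)
    have hb : ∀ s, ‖iteratedDeriv k (fwdDiff δ g) s‖ ≤ C * δ := by
      intro s
      rw [hd]
      have := convex_univ.norm_image_sub_le_of_norm_deriv_le (f := iteratedDeriv k g) (C := C)
        (fun x _ => hdiff x) (fun x _ => by rw [← iteratedDeriv_succ]; exact hC x)
        (Set.mem_univ s) (Set.mem_univ (s + δ))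
      simpa [abs_of_nonneg hδ] using this
    have := ih (g := fwdDiff δ g) (C := C * δ) (hshift.sub hg) hb
    calc _ ≤ _ := this
      _ = _ := by ring

variable {V : Type*} [NormedAddCommGroup V] [InnerProductSpace ℝ V] [FiniteDimensional ℝ V]

theorem weight_anti {m n : ℕ} (h : m ≤ n) : weight n ≤ weight m :=
  pow_le_pow_of_le_one (by norm_num) (by norm_num) (Nat.pow_le_pow_left h 2)

/-- The derivatives along lines of a function which is smooth along curves are bounded: otherwise a
special curve that moves along bad lines, with the velocities `weight j`, would pass through
points at which the `k`-th derivative exceeds `j`. -/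
theorem exists_bound_directional_deriv {f : V → ℂ}
    (hf : ∀ c : ℝ → V, ContDiff ℝ ∞ c → ContDiff ℝ ∞ fun t => f (c t)) (hs : HasCompactSupport f)
    (k : ℕ) : ∃ C, ∀ x v : V, ‖v‖ ≤ 1 → ‖iteratedDeriv k (fun s : ℝ => f (x + s • v)) 0‖ ≤ C := by
  by_contra hcon
  push Not at hcon
  choose x v hv hx using fun n : ℕ => hcon (n * (weight n ^ k)⁻¹)
  have hxs : ∀ n, x n ∈ tsupport f := by
    intro n
    by_contra hn
    have h1 : ∀ᶠ y in 𝓝 (x n), f y = 0 := by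
      filter_upwards [(isClosed_tsupport f).isOpen_compl.mem_nhds hn] with y hy
      exact image_eq_zero_of_notMem_tsupport hy
    have h2 : (fun s : ℝ => f (x n + s • v n)) =ᶠ[𝓝 0] fun _ => 0 := by
      have : Tendsto (fun s : ℝ => x n + s • v n) (𝓝 0) (𝓝 (x n)) := by
        have hc : Continuous fun s : ℝ => x n + s • v n := by fun_prop
        simpa using hc.tendsto 0
      exact this.eventually h1
    have h3 := hx n
    rw [h2.iteratedDeriv_eq] at h3
    have h4 : iteratedDeriv k (fun _ : ℝ => (0 : ℂ)) 0 = 0 := by simp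
    rw [h4, norm_zero] at h3
    have := weight_pos n
    exact absurd h3 (not_lt.2 (by positivity))
  obtain ⟨x₀, -, φ, hφ, hlim⟩ := IsCompact.tendsto_subseq hs hxs
  obtain ⟨ψ, hψ, hψx⟩ := extraction_forall_of_eventually'
    (P := fun j m => ‖x (φ m) - x₀‖ ≤ weight j) fun j => by
      obtain ⟨N, hN⟩ :=
        (hlim.eventually (Metric.ball_mem_nhds x₀ (weight_pos j))).exists_forall_of_atTop
      exact ⟨N, fun m hm => by
        have := hN m hm
        rw [Function.comp_apply, dist_eq_norm] at this
        exact this.le⟩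
  have hge : ∀ j, j ≤ φ (ψ j) := fun j => (hφ.comp hψ).id_le j
  set a : ℕ → V := fun j => x (φ (ψ j)) - x₀ with ha
  set b : ℕ → V := fun j => weight j • v (φ (ψ j)) with hb
  have hc : ContDiff ℝ ∞ fun t => x₀ + specialCurve a b t := by
    refine contDiff_const.add (contDiff_specialCurve
      (rapid_of_le_weight (C := 1) fun j => by simpa using hψx j)
      (rapid_of_le_weight (C := 1) fun j => ?_))
    rw [hb, norm_smul, Real.norm_of_nonneg (weight_pos j).le, mul_comm]
    exact mul_le_mul_of_nonneg_right (hv _) (weight_pos j).le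
  have hfc := hf _ hc
  obtain ⟨M, hM⟩ := (isCompact_Icc (a := (0 : ℝ)) (b := 1)).exists_bound_of_continuousOn
    (hfc.continuous_iteratedDeriv k (by exact_mod_cast le_top)).continuousOn
  obtain ⟨j, hj⟩ := exists_nat_gt M
  have h1 := hM ((1 / 2) ^ j) ⟨by positivity, pow_le_one₀ (by norm_num) (by norm_num)⟩
  have h2 : (fun t => f (x₀ + specialCurve a b t)) =ᶠ[𝓝 ((1 / 2 : ℝ) ^ j)]
      fun t => f (x (φ (ψ j)) + (weight j * (t - (1 / 2) ^ j)) • v (φ (ψ j))) := by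
    filter_upwards [specialCurve_eventuallyEq a b j] with t ht
    rw [ht, ha, hb]
    congr 1
    simp only [smul_smul, mul_comm]
    abel
  have hline : ContDiff ℝ ∞ fun s : ℝ => f (x (φ (ψ j)) + s • v (φ (ψ j))) :=
    hf _ (contDiff_const.add (contDiff_id.smul contDiff_const))
  have h3 := iteratedDeriv_comp_sub_const k
    (fun t => f (x (φ (ψ j)) + (weight j * t) • v (φ (ψ j)))) ((1 / 2 : ℝ) ^ j)
  have h4 := iteratedDeriv_comp_const_smul (n := k) (hline.of_le (by exact_mod_cast le_top))
    (weight j)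
  rw [h2.iteratedDeriv_eq, h3] at h1
  have h5 := congrFun h4 0
  simp only [sub_self] at h1
  rw [h5, norm_smul, norm_pow, Real.norm_of_nonneg (weight_pos j).le, mul_zero] at h1
  have h6 := hx (φ (ψ j))
  have h7 : (j : ℝ) ≤ φ (ψ j) := by exact_mod_cast hge j
  have hw := weight_pos j
  have hw' := weight_pos (φ (ψ j))
  have h8 : (j : ℝ) * (weight j ^ k)⁻¹ ≤ φ (ψ j) * (weight (φ (ψ j)) ^ k)⁻¹ := by
    gcongr
    exact weight_anti (hge j)
  have h9 := h8.trans_lt h6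
  rw [← div_eq_mul_inv, div_lt_iff₀ (by positivity), mul_comm] at h9
  linarith

omit [FiniteDimensional ℝ V] in
theorem fwdDiff_iter_line {F : Type*} [AddCommGroup F] (f : V → F) (x v : V) (δ : ℝ) (k : ℕ) :
    (fwdDiff (δ • v))^[k] f x = (fwdDiff δ)^[k] (fun s : ℝ => f (x + s • v)) 0 := by
  rw [fwdDiff_iter_eq_sum_shift, fwdDiff_iter_eq_sum_shift]
  refine Finset.sum_congr rfl fun i _ => ?_
  simp only [zero_add, nsmul_eq_mul, mul_smul, Nat.cast_smul_eq_nsmul]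

theorem continuous_of_smooth_along_curves {f : V → ℂ}
    (hf : ∀ c : ℝ → V, ContDiff ℝ ∞ c → ContDiff ℝ ∞ fun t => f (c t)) : Continuous f :=
  continuous_def.2 fun _ hO => isOpen_of_forall_curve fun c hc => hO.preimage (hf c hc).continuous

omit [InnerProductSpace ℝ V] [FiniteDimensional ℝ V] in
theorem fwdDiff_iter_support {f : V → ℂ} {R : ℝ} (hR : ∀ x, R < ‖x‖ → f x = 0) (a : V) (k : ℕ) :
    ∀ x, R + k * ‖a‖ < ‖x‖ → (fwdDiff a)^[k] f x = 0 := by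
  intro x hx
  rw [fwdDiff_iter_eq_sum_shift]
  refine Finset.sum_eq_zero fun i hi => ?_
  rw [hR, smul_zero]
  have h1 : ‖x‖ ≤ ‖x + i • a‖ + ‖i • a‖ := by
    simpa using norm_sub_le (x + i • a) (i • a)
  have h2 : ‖i • a‖ ≤ i * ‖a‖ := norm_nsmul_le
  have h3 : (i : ℝ) * ‖a‖ ≤ k * ‖a‖ := by
    gcongr
    exact Finset.mem_range_succ_iff.1 hi
  linarith

variable [MeasurableSpace V] [BorelSpace V]

/-- On the Fourier side a difference operator is the multiplication by a character minus one. -/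
theorem fourier_fwdDiff_iter {f : V → ℂ} (hf : Continuous f) {R : ℝ}
    (hR : ∀ x, R < ‖x‖ → f x = 0) (a w : V) (k : ℕ) :
    𝓕 ((fwdDiff a)^[k] f) w = ((Real.fourierChar (inner ℝ a w) : ℂ) - 1) ^ k * 𝓕 f w := by
  have hint : ∀ {g : V → ℂ} {r : ℝ}, Continuous g → (∀ x, r < ‖x‖ → g x = 0) → Integrable g :=
    fun {g r} hg hr => hg.integrable_of_hasCompactSupport
      (HasCompactSupport.intro (isCompact_closedBall (0 : V) r) fun x hx =>
        hr x (by simpa using hx))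
  induction k generalizing f R with
  | zero => simp
  | succ k ih =>
    have hR' : ∀ x, R + ‖a‖ < ‖x‖ → fwdDiff a f x = 0 := by
      simpa using fwdDiff_iter_support hR a 1
    have hshift : Continuous fun x => f (x + a) := by fun_prop
    have hR'' : ∀ x, R + ‖a‖ < ‖x‖ → f (x + a) = 0 := by
      intro x hx
      refine hR _ ?_
      have : ‖x‖ ≤ ‖x + a‖ + ‖a‖ := by simpa using norm_sub_le (x + a) a
      linarith
    rw [Function.iterate_succ_apply, ih (f := fwdDiff a f) (hshift.sub hf) hR']
    have h1 : 𝓕 (fun x => f (x + a)) w = Real.fourierChar (inner ℝ a w) • 𝓕 f w :=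
      congrFun (VectorFourier.fourierIntegral_comp_add_right Real.fourierChar volume
        (innerₗ V) f a) w
    have h2 : 𝓕 (fwdDiff a f) w = 𝓕 (fun x => f (x + a)) w - 𝓕 f w := by
      rw [Real.fourier_eq, Real.fourier_eq, Real.fourier_eq, ← integral_sub]
      · simp only [fwdDiff, smul_sub]
      · exact (Real.fourierIntegral_convergent_iff w).2 (hint hshift hR'')
      · exact (Real.fourierIntegral_convergent_iff w).2 (hint hf hR)
    rw [h2, h1, Circle.smul_def, smul_eq_mul]
    ring

/-- Rapid decrease of the Fourier transform: at the frequency `w` it is, up to a power of two, the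
transform of the `k`-th difference of `f` with step of size `1 / (2 * ‖w‖)` in the direction `w`,
and this difference is of order `‖w‖ ^ (-k)`. -/
theorem exists_bound_fourier {f : V → ℂ}
    (hf : ∀ c : ℝ → V, ContDiff ℝ ∞ c → ContDiff ℝ ∞ fun t => f (c t)) (hs : HasCompactSupport f)
    (k : ℕ) : ∃ C, ∀ w : V, ‖w‖ ^ k * ‖𝓕 f w‖ ≤ C := by
  have hcont := continuous_of_smooth_along_curves hf
  obtain ⟨C, hC⟩ := exists_bound_directional_deriv hf hs k
  obtain ⟨R, hR⟩ : ∃ R, ∀ x, R < ‖x‖ → f x = 0 := by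
    obtain ⟨R, hR⟩ := (isBounded_iff_forall_norm_le.1 hs.isCompact.isBounded)
    refine ⟨R, fun x hx => image_eq_zero_of_notMem_tsupport fun h => ?_⟩
    exact absurd (hR x h) (not_le.2 hx)
  have hC0 : 0 ≤ C := (norm_nonneg _).trans (hC 0 0 (by simp))
  refine ⟨max (∫ x, ‖f x‖) (C * volume.real (Metric.closedBall (0 : V) (R + k))), fun w => ?_⟩
  rcases le_total ‖w‖ 1 with hw | hw
  · refine le_trans ?_ (le_max_left _ _)
    calc ‖w‖ ^ k * ‖𝓕 f w‖ ≤ 1 * ‖𝓕 f w‖ := by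
          gcongr
          exact pow_le_one₀ (norm_nonneg _) hw
      _ ≤ _ := by
          rw [one_mul]
          exact VectorFourier.norm_fourierIntegral_le_integral_norm _ _ _ _ _
  · refine le_trans ?_ (le_max_right _ _)
    have hw0 : 0 < ‖w‖ := by linarith
    -- The shift `a` is chosen such that the character takes the value `-1` at `⟪a, w⟫ = 1 / 2`.
    set v : V := ‖w‖⁻¹ • w with hv
    set δ : ℝ := (2 * ‖w‖)⁻¹ with hδ
    have hδ0 : 0 < δ := by positivity
    have hv1 : ‖v‖ = 1 := by
      rw [hv, norm_smul, norm_inv, norm_norm, inv_mul_cancel₀ hw0.ne']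
    have hδ1 : δ ≤ 1 := by
      rw [hδ]
      exact inv_le_one_of_one_le₀ (by linarith)
    have hin : inner ℝ (δ • v) w = 1 / 2 := by
      rw [real_inner_smul_left, hv, real_inner_smul_left, real_inner_self_eq_norm_sq, hδ]
      field_simp
    have hchar : (Real.fourierChar (1 / 2 : ℝ) : ℂ) = -1 := by
      rw [Real.fourierChar_apply, ← Complex.exp_pi_mul_I]
      congr 2
      push_cast
      ring
    have hF := fourier_fwdDiff_iter hcont hR (δ • v) w k
    rw [hin, hchar] at hF
    have hΔ : ∀ x, ‖(fwdDiff (δ • v))^[k] f x‖ ≤ C * δ ^ k := by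
      intro x
      rw [fwdDiff_iter_line]
      have hline : ContDiff ℝ ∞ fun s : ℝ => f (x + s • v) :=
        hf _ (contDiff_const.add (contDiff_id.smul contDiff_const))
      refine norm_fwdDiff_iter_le hδ0.le k hline (fun t => ?_) 0
      have h1 := iteratedDeriv_comp_const_add k (fun s : ℝ => f (x + s • v)) t
      have h2 := congrFun h1 0
      simp only [add_zero] at h2
      rw [← h2]
      have := hC (x + t • v) v hv1.le
      simpa only [add_smul, add_assoc] using this
    have hsupp : ∀ x, x ∉ Metric.closedBall (0 : V) (R + k) → (fwdDiff (δ • v))^[k] f x = 0 := by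
      intro x hx
      refine fwdDiff_iter_support hR _ k x ?_
      have hx' : R + k < ‖x‖ := by simpa using hx
      have : (k : ℝ) * ‖δ • v‖ ≤ k * 1 := by
        gcongr
        rw [norm_smul, hv1, mul_one, Real.norm_of_nonneg hδ0.le]
        exact hδ1
      linarith
    have hint : ‖𝓕 ((fwdDiff (δ • v))^[k] f) w‖
        ≤ C * δ ^ k * volume.real (Metric.closedBall (0 : V) (R + k)) := by
      refine (VectorFourier.norm_fourierIntegral_le_integral_norm _ _ _ _ _).trans ?_
      rw [← setIntegral_eq_integral_of_forall_compl_eq_zero (s := Metric.closedBall (0 : V) (R + k))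
        (fun x hx => by rw [hsupp x hx, norm_zero])]
      refine (le_abs_self _).trans ?_
      rw [← Real.norm_eq_abs]
      refine norm_setIntegral_le_of_norm_le_const (measure_closedBall_lt_top) fun x _ => ?_
      rw [norm_norm]
      exact hΔ x
    rw [hF, norm_mul, norm_pow] at hint
    have h2 : ‖(-1 - 1 : ℂ)‖ = 2 := by norm_num
    rw [h2] at hint
    have hδk : ‖w‖ ^ k * δ ^ k ≤ 1 := by
      rw [← mul_pow]
      refine pow_le_one₀ (by positivity) ?_
      rw [hδ]
      field_simp
      norm_num
    calc ‖w‖ ^ k * ‖𝓕 f w‖ ≤ ‖w‖ ^ k * (2 ^ k * ‖𝓕 f w‖) := by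
          gcongr
          exact le_mul_of_one_le_left (norm_nonneg _) (one_le_pow₀ (by norm_num))
      _ ≤ ‖w‖ ^ k * (C * δ ^ k * volume.real (Metric.closedBall (0 : V) (R + k))) := by gcongr
      _ = (‖w‖ ^ k * δ ^ k) * (C * volume.real (Metric.closedBall (0 : V) (R + k))) := by ring
      _ ≤ 1 * (C * volume.real (Metric.closedBall (0 : V) (R + k))) := by gcongr
      _ = _ := one_mul _

/-- Boman's theorem for functions with compact support: the bounds of the Fourier transform
obtained by differentiating along lines suffice for Fourier inversion. -/
theorem contDiff_of_smooth_along_curves {f : V → ℂ}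
    (hf : ∀ c : ℝ → V, ContDiff ℝ ∞ c → ContDiff ℝ ∞ fun t => f (c t))
    (hs : HasCompactSupport f) : ContDiff ℝ ∞ f := by
  have hcont := continuous_of_smooth_along_curves hf
  have hfi : Integrable f := hcont.integrable_of_hasCompactSupport hs
  have hFc : Continuous (𝓕 f) :=
    VectorFourier.fourierIntegral_continuous Real.continuous_fourierChar
      (by exact continuous_inner) hfi
  have hmom : ∀ n : ℕ, Integrable fun w : V => ‖w‖ ^ n * ‖𝓕 f w‖ := by
    intro n
    set d := Module.finrank ℝ V + 1 with hd
    obtain ⟨C1, hC1⟩ := exists_bound_fourier hf hs n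
    obtain ⟨C2, hC2⟩ := exists_bound_fourier hf hs (n + d)
    have hi : Integrable fun w : V => (1 + ‖w‖) ^ (-(d : ℝ)) :=
      integrable_one_add_norm (by rw [hd]; push_cast; linarith)
    refine (hi.const_mul (2 ^ d * (C1 + C2))).mono'
      (by fun_prop) (Eventually.of_forall fun w => ?_)
    rw [Real.norm_of_nonneg (by positivity), Real.rpow_neg (by positivity), Real.rpow_natCast,
      ← div_eq_mul_inv, le_div_iff₀ (by positivity)]
    have h1 : (1 + ‖w‖) ^ d ≤ 2 ^ d * (1 + ‖w‖ ^ d) := by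
      have h0 : (1 + ‖w‖) ≤ 2 * max 1 ‖w‖ := by
        linarith [le_max_left 1 ‖w‖, le_max_right 1 ‖w‖]
      calc (1 + ‖w‖) ^ d ≤ (2 * max 1 ‖w‖) ^ d := by gcongr
        _ = 2 ^ d * (max 1 ‖w‖) ^ d := mul_pow _ _ _
        _ ≤ _ := by
          gcongr
          rcases le_total 1 ‖w‖ with h | h
          · rw [max_eq_right h]; linarith
          · rw [max_eq_left h, one_pow]
            have : 0 ≤ ‖w‖ ^ d := by positivity
            linarith
    calc ‖w‖ ^ n * ‖𝓕 f w‖ * (1 + ‖w‖) ^ d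
        ≤ ‖w‖ ^ n * ‖𝓕 f w‖ * (2 ^ d * (1 + ‖w‖ ^ d)) := by gcongr
      _ = 2 ^ d * (‖w‖ ^ n * ‖𝓕 f w‖ + ‖w‖ ^ (n + d) * ‖𝓕 f w‖) := by ring
      _ ≤ _ := by
        gcongr
        · exact hC1 w
        · exact hC2 w
  have hFi : Integrable (𝓕 f) := by
    have := hmom 0
    simp only [pow_zero, one_mul] at this
    exact (integrable_norm_iff hFc.aestronglyMeasurable).1 this
  rw [← hcont.fourierInv_fourier_eq hfi hFi]
  have heq : 𝓕⁻ (𝓕 f) = fun x => 𝓕 (𝓕 f) (-x) := by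
    funext x
    exact Real.fourierInv_eq_fourier_neg _ _
  rw [heq]
  exact (Real.contDiff_fourier (N := ⊤) fun n _ => hmom n).comp contDiff_neg

end Boman

/-- **Boman's theorem**: a function on an open subset of a finite-dimensional space which is smooth
along all smooth curves is smooth. -/
theorem contDiffOn_of_smooth_along_curves {V : Type*} [NormedAddCommGroup V] [NormedSpace ℝ V]
    [FiniteDimensional ℝ V] {f : V → ℝ} {W : Set V} (hW : IsOpen W)
    (hf : ∀ c : ℝ → V, ContDiff ℝ ∞ c → (∀ t, c t ∈ W) → ContDiff ℝ ∞ fun t => f (c t)) :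
    ContDiffOn ℝ ∞ f W := by
  intro p hp
  refine ContDiffAt.contDiffWithinAt ?_
  set e := toEuclidean (E := V) with he
  have hWe : IsOpen (e.symm ⁻¹' W) := hW.preimage e.symm.continuous
  obtain ⟨r, hr, hrW⟩ := Metric.isOpen_iff.1 hWe (e p) (by simpa using hp)
  let χ : ContDiffBump (e p) := ⟨r / 2, r, by positivity, by linarith⟩
  -- The map `y ↦ e p + χ y • (y - e p)` maps everything into the ball of radius `r`.
  have hρ : ∀ y, e.symm (e p + χ y • (y - e p)) ∈ W := by
    intro y
    refine hrW ?_
    rw [Metric.mem_ball, dist_eq_norm, add_sub_cancel_left, norm_smul,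
      Real.norm_of_nonneg χ.nonneg]
    rcases lt_or_ge (dist y (e p)) r with h | h
    · rw [← dist_eq_norm]
      exact lt_of_le_of_lt (mul_le_of_le_one_left dist_nonneg χ.le_one) h
    · rw [χ.zero_of_le_dist h, zero_mul]
      exact hr
  let _ : MeasurableSpace (EuclideanSpace ℝ (Fin (Module.finrank ℝ V))) := borel _
  have _ : BorelSpace (EuclideanSpace ℝ (Fin (Module.finrank ℝ V))) := ⟨rfl⟩
  have hsm : ContDiff ℝ ∞ fun y => ((χ y * f (e.symm (e p + χ y • (y - e p))) : ℝ) : ℂ) := by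
    refine contDiff_of_smooth_along_curves (fun c hc => ?_) ?_
    · have h1 : ContDiff ℝ ∞ fun t => χ (c t) := χ.contDiff.comp hc
      have h2 : ContDiff ℝ ∞ fun t => f (e.symm (e p + χ (c t) • (c t - e p))) := by
        refine hf _ (e.symm.contDiff.comp (contDiff_const.add (h1.smul (hc.sub contDiff_const))))
          fun t => hρ _
      exact Complex.ofRealCLM.contDiff.comp (h1.mul h2)
    · refine HasCompactSupport.intro (isCompact_closedBall (e p) r) fun y hy => ?_
      have : r ≤ dist y (e p) := (not_le.1 fun h => hy (Metric.mem_closedBall.2 h)).le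
      rw [χ.zero_of_le_dist this, zero_mul, Complex.ofReal_zero]
  have hre : ContDiff ℝ ∞ fun x : V => χ (e x) * f (e.symm (e p + χ (e x) • (e x - e p))) :=
    (Complex.reCLM.contDiff.comp hsm).comp e.contDiff
  refine hre.contDiffAt.congr_of_eventuallyEq ?_
  have h1 : ∀ᶠ y in 𝓝 (e p), χ y = 1 := χ.eventuallyEq_one
  filter_upwards [e.continuous.continuousAt.eventually h1] with x hx
  rw [hx, one_mul, one_smul, add_sub_cancel, e.symm_apply_apply]

/-! ### Calculus in convenient vector spaces -/

section Hadamard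

theorem hasDerivAt_integral_param {H : ℝ × ℝ → ℝ} (hH : ContDiff ℝ ∞ H) (s : ℝ) :
    HasDerivAt (fun s => ∫ u in (0 : ℝ)..1, H (s, u))
      (∫ u in (0 : ℝ)..1, fderiv ℝ H (s, u) (1, 0)) s := by
  have hH' : Continuous fun p : ℝ × ℝ => fderiv ℝ H p (1, 0) :=
    (hH.continuous_fderiv (by simp)).clm_apply continuous_const
  obtain ⟨C, hC⟩ := ((isCompact_closedBall s 1).prod (isCompact_Icc (a := (0 : ℝ))
    (b := 1))).exists_bound_of_continuousOn hH'.continuousOn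
  refine (intervalIntegral.hasDerivAt_integral_of_dominated_loc_of_deriv_le
    (F := fun s u => H (s, u)) (F' := fun s u => fderiv ℝ H (s, u) (1, 0))
    (bound := fun _ => C) (Metric.ball_mem_nhds s one_pos) ?_ ?_ ?_ ?_ ?_ ?_).2
  · exact Eventually.of_forall fun x => (hH.continuous.comp
      (continuous_const.prodMk continuous_id)).aestronglyMeasurable
  · exact (hH.continuous.comp (continuous_const.prodMk continuous_id)).intervalIntegrable _ _
  · exact (hH'.comp (continuous_const.prodMk continuous_id)).aestronglyMeasurable
  · refine Eventually.of_forall fun u hu x hx => hC (x, u) ⟨Metric.ball_subset_closedBall hx, ?_⟩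
    rw [Set.uIoc_of_le zero_le_one] at hu
    exact Set.Ioc_subset_Icc_self hu
  · exact intervalIntegrable_const
  · refine Eventually.of_forall fun u _ x _ => ?_
    have h1 : HasDerivAt (fun x : ℝ => (x, u)) (1, 0) x :=
      (hasDerivAt_id x).prodMk (hasDerivAt_const x u)
    exact ((hH.differentiable (by simp)) (x, u)).hasFDerivAt.comp_hasDerivAt x h1

theorem contDiff_integral_param {H : ℝ × ℝ → ℝ} (hH : ContDiff ℝ ∞ H) :
    ContDiff ℝ ∞ fun s => ∫ u in (0 : ℝ)..1, H (s, u) := by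
  refine contDiff_infty.2 fun n => ?_
  induction n generalizing H with
  | zero =>
    exact contDiff_zero.2 (continuous_iff_continuousAt.2 fun s =>
      (hasDerivAt_integral_param hH s).continuousAt)
  | succ n ih =>
    push_cast
    rw [contDiff_succ_iff_deriv]
    refine ⟨fun s => (hasDerivAt_integral_param hH s).differentiableAt, by simp, ?_⟩
    rw [funext fun s => (hasDerivAt_integral_param hH s).deriv]
    exact ih ((hH.fderiv_right (m := ∞) (by simp)).clm_apply contDiff_const)

/-- Hadamard's lemma for smooth real functions: the quotient is the integral of `deriv g (s * u)`
over `u`. -/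
theorem contDiff_quotient {g : ℝ → ℝ} (hg : ContDiff ℝ ∞ g) (h0 : g 0 = 0) :
    ContDiff ℝ ∞ fun s => if s = 0 then deriv g 0 else s⁻¹ * g s := by
  have hg' : ContDiff ℝ ∞ (deriv g) := (contDiff_infty_iff_deriv.1 hg).2
  have hH : ContDiff ℝ ∞ fun p : ℝ × ℝ => deriv g (p.1 * p.2) :=
    hg'.comp (contDiff_fst.mul contDiff_snd)
  convert! contDiff_integral_param hH using 1
  funext s
  split_ifs with hs
  · simp [hs]
  · have h1 : ∀ u ∈ Set.uIcc (0 : ℝ) 1, HasDerivAt (fun u => s⁻¹ * g (s * u))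
        (deriv g (s * u)) u := by
      intro u _
      have h2 : HasDerivAt (fun u : ℝ => s * u) s u := by
        simpa using (hasDerivAt_id u).const_mul s
      have h3 := (((hg.differentiable (by simp)) (s * u)).hasDerivAt.comp u h2).const_mul s⁻¹
      convert! h3 using 1
      field_simp
    rw [intervalIntegral.integral_eq_sub_of_hasDerivAt h1
      ((hg'.continuous.comp (continuous_const.mul continuous_id)).intervalIntegrable _ _)]
    simp [h0]

end Hadamard

section WeakSmooth

variable {E : Type*} [AddCommGroup E] [Module ℝ E] [TopologicalSpace E]
variable {V : Type*} [NormedAddCommGroup V] [NormedSpace ℝ V]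
variable {V' : Type*} [NormedAddCommGroup V'] [NormedSpace ℝ V']

/-- A map from an open subset `W` of a normed space to `E` is weakly smooth if its compositions with
all continuous linear functionals are smooth. -/
def WeakSmoothOn (x : V → E) (W : Set V) : Prop :=
  ∀ l : E →L[ℝ] ℝ, ContDiffOn ℝ ∞ (fun p => l (x p)) W

theorem WeakSmoothOn.mono {x : V → E} {W W' : Set V} (hx : WeakSmoothOn x W) (h : W' ⊆ W) :
    WeakSmoothOn x W' := fun l => (hx l).mono h

theorem WeakSmoothOn.comp {x : V → E} {W : Set V} (hx : WeakSmoothOn x W) {φ : V' → V}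
    {W' : Set V'} (hφ : ContDiffOn ℝ ∞ φ W') (h : Set.MapsTo φ W' W) :
    WeakSmoothOn (fun p => x (φ p)) W' := fun l => (hx l).comp hφ h

theorem WeakSmoothOn.congr {x y : V → E} {W : Set V} (hx : WeakSmoothOn x W)
    (h : ∀ p ∈ W, y p = x p) : WeakSmoothOn y W :=
  fun l => (hx l).congr fun p hp => by simp only [h p hp]

theorem weakSmoothOn_const (a : E) (W : Set V) : WeakSmoothOn (fun _ => a) W :=
  fun _ => contDiffOn_const

theorem WeakSmoothOn.add {x y : V → E} {W : Set V} (hx : WeakSmoothOn x W)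
    (hy : WeakSmoothOn y W) : WeakSmoothOn (fun p => x p + y p) W :=
  fun l => by simpa only [map_add] using (hx l).add (hy l)

theorem WeakSmoothOn.sub {x y : V → E} {W : Set V} (hx : WeakSmoothOn x W)
    (hy : WeakSmoothOn y W) : WeakSmoothOn (fun p => x p - y p) W :=
  fun l => by simpa only [map_sub] using (hx l).sub (hy l)

theorem WeakSmoothOn.smul {φ : V → ℝ} {x : V → E} {W : Set V} (hx : WeakSmoothOn x W)
    (hφ : ContDiffOn ℝ ∞ φ W) : WeakSmoothOn (fun p => φ p • x p) W :=
  fun l => by simpa only [map_smul, smul_eq_mul] using hφ.mul (hx l)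

/-- The derivative of `f` at `x` in the direction `v`. As with `deriv`, this is meaningful only if
`s ↦ f (x + s • v)` is differentiable at `0`. -/
noncomputable def dirDeriv {M : Type*} [AddCommGroup M] [Module ℝ M] (f : M → E) (x v : M) : E :=
  deriv (fun s : ℝ => f (x + s • v)) 0

variable [ConvenientSpace E]

theorem weakSmoothOn_univ_iff {c : ℝ → E} : WeakSmoothOn c Set.univ ↔ IsSmoothCurve c := by
  rw [isSmoothCurve_iff]
  simp only [WeakSmoothOn, contDiffOn_univ]

theorem WeakSmoothOn.hasDerivAt {c : ℝ → E} {J : Set ℝ} (hc : WeakSmoothOn c J) (hJ : IsOpen J)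
    {t : ℝ} (ht : t ∈ J) : HasDerivAt c (deriv c t) t := hasDerivAt_of_dual hJ hc ht

theorem WeakSmoothOn.map_deriv {c : ℝ → E} {J : Set ℝ} (hc : WeakSmoothOn c J) (hJ : IsOpen J)
    {t : ℝ} (ht : t ∈ J) (l : E →L[ℝ] ℝ) : l (deriv c t) = deriv (fun s => l (c s)) t :=
  (HasDerivAt.clm_apply' (hc.hasDerivAt hJ ht) l).deriv.symm

theorem WeakSmoothOn.hasDerivAt_of_dual {c : ℝ → E} {J : Set ℝ} (hc : WeakSmoothOn c J)
    (hJ : IsOpen J) {t : ℝ} (ht : t ∈ J) {v : E}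
    (h : ∀ l : E →L[ℝ] ℝ, HasDerivAt (fun s => l (c s)) (l v) t) : HasDerivAt c v t := by
  have : v = deriv c t := ext_dual fun l => by rw [hc.map_deriv hJ ht, (h l).deriv]
  rw [this]
  exact hc.hasDerivAt hJ ht

/-- Weakly smooth maps can be detected along smooth curves: Boman's theorem. -/
theorem weakSmoothOn_of_curves [FiniteDimensional ℝ V] {x : V → E} {W : Set V} (hW : IsOpen W)
    (h : ∀ c : ℝ → V, ContDiff ℝ ∞ c → (∀ t, c t ∈ W) → IsSmoothCurve fun t => x (c t)) :
    WeakSmoothOn x W :=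
  fun l => contDiffOn_of_smooth_along_curves hW fun c hc hcW => isSmoothCurve_iff.1 (h c hc hcW) l

theorem WeakSmoothOn.isSmoothCurve {x : V → E} {W : Set V} (hx : WeakSmoothOn x W) {c : ℝ → V}
    (hc : ContDiff ℝ ∞ c) (hcW : ∀ t, c t ∈ W) : IsSmoothCurve fun t => x (c t) :=
  weakSmoothOn_univ_iff.1 (hx.comp hc.contDiffOn fun t _ => hcW t)

/-- Localization of parameters: a smooth map of the line into the open set `J`, which is the
identity near a given point of `J`. -/
theorem exists_reparametrization {J : Set ℝ} (hJ : IsOpen J) {t : ℝ} (ht : t ∈ J) :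
    ∃ θ : ℝ → ℝ, ContDiff ℝ ∞ θ ∧ (∀ s, θ s ∈ J) ∧ ∀ᶠ s in 𝓝 t, θ s = s := by
  obtain ⟨r, hr, hrJ⟩ := Metric.isOpen_iff.1 hJ t ht
  let χ : ContDiffBump t := ⟨r / 2, r, by positivity, by linarith⟩
  refine ⟨fun s => t + χ s * (s - t), contDiff_const.add (χ.contDiff.mul
    (contDiff_id.sub contDiff_const)), fun s => hrJ ?_, ?_⟩
  · rw [Metric.mem_ball, dist_eq_norm, add_sub_cancel_left, norm_mul,
      Real.norm_of_nonneg χ.nonneg]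
    rcases lt_or_ge (dist s t) r with h | h
    · rw [← dist_eq_norm]
      exact lt_of_le_of_lt (mul_le_of_le_one_left dist_nonneg χ.le_one) h
    · rw [χ.zero_of_le_dist h, zero_mul]
      exact hr
  · filter_upwards [χ.eventuallyEq_one] with s hs
    rw [hs, Pi.one_apply, one_mul, add_sub_cancel]

/-- Openness for the `c^∞`-topology, expressed through smooth curves. -/
def IsCInfOpen (O : Set E) : Prop := ∀ c : ℝ → E, IsSmoothCurve c → IsOpen (c ⁻¹' O)

omit [ConvenientSpace E] in
theorem isCInfOpen_iff {O : Set E} : IsCInfOpen O ↔ IsOpen ((toCInf E).symm ⁻¹' O) := by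
  constructor
  · intro h
    refine isOpen_iSup_iff.2 fun c => ?_
    rw [isOpen_coinduced]
    exact h c.1 c.2
  · intro h c hc
    have := (isOpen_iSup_iff.1 h) ⟨c, hc⟩
    rwa [isOpen_coinduced] at this

theorem WeakSmoothOn.isOpen_inter_preimage [CompleteSpace V] {x : V → E} {W : Set V}
    (hx : WeakSmoothOn x W) (hW : IsOpen W) {O : Set E} (hO : IsCInfOpen O) :
    IsOpen (W ∩ x ⁻¹' O) := by
  refine isOpen_of_forall_curve fun c hc => isOpen_iff_mem_nhds.2 fun t ht => ?_
  obtain ⟨θ, hθ, hθJ, hθt⟩ := exists_reparametrization (hW.preimage hc.continuous) ht.1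
  have hsm : IsSmoothCurve fun s => x (c (θ s)) := hx.isSmoothCurve (hc.comp hθ) hθJ
  have h1 : ∀ᶠ s in 𝓝 t, x (c (θ s)) ∈ O := by
    refine (hO _ hsm).mem_nhds ?_
    rw [Set.mem_preimage, hθt.self_of_nhds]
    exact ht.2
  filter_upwards [h1, hθt, (hW.preimage hc.continuous).mem_nhds ht.1] with s hs hs' hs''
  rw [hs'] at hs
  exact ⟨hs'', hs⟩

variable {F : Type*} [AddCommGroup F] [Module ℝ F] [TopologicalSpace F] [ConvenientSpace F]

/-- Maps from a subset of `E` to `F` which map smooth curves to smooth curves. -/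
def ESmoothOn (f : E → F) (O : Set E) : Prop :=
  ∀ c : ℝ → E, IsSmoothCurve c → (∀ t, c t ∈ O) → IsSmoothCurve fun t => f (c t)

theorem ESmoothOn.comp_weakSmoothOn [FiniteDimensional ℝ V] {f : E → F} {O : Set E}
    (hf : ESmoothOn f O) {x : V → E} {W : Set V} (hW : IsOpen W) (hx : WeakSmoothOn x W)
    (h : ∀ p ∈ W, x p ∈ O) : WeakSmoothOn (fun p => f (x p)) W :=
  weakSmoothOn_of_curves hW fun _ hc hcW => hf _ (hx.isSmoothCurve hc hcW) fun t => h _ (hcW t)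

/-- Hadamard's lemma in convenient vector spaces. -/
theorem IsSmoothCurve.exists_eq_smul {g : ℝ → E} (hg : IsSmoothCurve g) (h0 : g 0 = 0) :
    ∃ z : ℝ → E, IsSmoothCurve z ∧ (∀ s, g s = s • z s) ∧ z 0 = deriv g 0 := by
  refine ⟨fun s => if s = 0 then deriv g 0 else s⁻¹ • g s, ?_, fun s => ?_, if_pos rfl⟩
  · rw [isSmoothCurve_iff]
    intro l
    convert! contDiff_quotient (isSmoothCurve_iff.1 hg l) (by rw [h0, map_zero]) using 1
    funext s
    split_ifs
    · exact (weakSmoothOn_univ_iff.2 hg).map_deriv isOpen_univ trivial l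
    · rw [map_smul, smul_eq_mul]
  · by_cases hs : s = 0
    · simp [hs, h0]
    · simp [hs, smul_smul]

/-! ### Directional derivatives -/

theorem WeakSmoothOn.hasDerivAt_line {Q : V → E} {W : Set V} (hQ : WeakSmoothOn Q W)
    (hW : IsOpen W) {p : V} (hp : p ∈ W) (v : V) :
    HasDerivAt (fun s : ℝ => Q (p + s • v)) (dirDeriv Q p v) 0 := by
  have hline : ContDiff ℝ ∞ fun s : ℝ => p + s • v :=
    contDiff_const.add (contDiff_id.smul contDiff_const)
  exact (hQ.comp hline.contDiffOn (W' := (fun s : ℝ => p + s • v) ⁻¹' W) fun _ h => h).hasDerivAt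
    (hW.preimage hline.continuous) (by simpa using hp)

omit [ConvenientSpace E] in
theorem WeakSmoothOn.differentiableAt {Q : V → E} {W : Set V} (hQ : WeakSmoothOn Q W)
    (hW : IsOpen W) {p : V} (hp : p ∈ W) (l : E →L[ℝ] ℝ) :
    DifferentiableAt ℝ (fun p => l (Q p)) p :=
  ((hQ l).differentiableOn (by simp)).differentiableAt (hW.mem_nhds hp)

theorem WeakSmoothOn.map_dirDeriv {Q : V → E} {W : Set V} (hQ : WeakSmoothOn Q W)
    (hW : IsOpen W) {p : V} (hp : p ∈ W) (v : V) (l : E →L[ℝ] ℝ) :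
    l (dirDeriv Q p v) = fderiv ℝ (fun p => l (Q p)) p v := by
  have h1 := HasDerivAt.clm_apply' (hQ.hasDerivAt_line hW hp v) l
  have hd := (hQ.differentiableAt hW hp l).hasFDerivAt
  have h2 : HasDerivAt (fun s : ℝ => p + s • v) v 0 := by
    simpa using ((hasDerivAt_id (0 : ℝ)).smul_const v).const_add p
  have h3 : HasFDerivAt (fun p => l (Q p)) (fderiv ℝ (fun p => l (Q p)) p) (p + (0 : ℝ) • v) := by
    simpa using hd
  have h4 := h3.comp_hasDerivAt (0 : ℝ) h2
  exact h1.unique h4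

theorem WeakSmoothOn.dirDeriv {Q : V → E} {W : Set V} (hQ : WeakSmoothOn Q W) (hW : IsOpen W)
    (v : V) : WeakSmoothOn (fun p => dirDeriv Q p v) W := fun l =>
  (((hQ l).fderiv_of_isOpen (m := ∞) hW (by simp)).clm_apply contDiffOn_const).congr
    fun _ hp => hQ.map_dirDeriv hW hp v l

theorem WeakSmoothOn.dirDeriv_lin {Q : V → E} {W : Set V} (hQ : WeakSmoothOn Q W) (hW : IsOpen W)
    {p : V} (hp : p ∈ W) (a b : ℝ) (v w : V) :
    ConvenientLie.dirDeriv Q p (a • v + b • w) =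
      a • ConvenientLie.dirDeriv Q p v + b • ConvenientLie.dirDeriv Q p w :=
  ext_dual fun l => by
    simp only [map_add, map_smul, hQ.map_dirDeriv hW hp]

theorem WeakSmoothOn.hasDerivAt_comp {Q : V → E} {W : Set V} (hQ : WeakSmoothOn Q W)
    (hW : IsOpen W) {φ : ℝ → V} {J : Set ℝ} (hJ : IsOpen J) (hφ : ContDiffOn ℝ ∞ φ J)
    (hφW : ∀ s ∈ J, φ s ∈ W) {t : ℝ} (ht : t ∈ J) {v : V} (hv : HasDerivAt φ v t) :
    HasDerivAt (fun s => Q (φ s)) (ConvenientLie.dirDeriv Q (φ t) v) t := by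
  refine (hQ.comp hφ hφW).hasDerivAt_of_dual hJ ht fun l => ?_
  rw [hQ.map_dirDeriv hW (hφW t ht)]
  exact (hQ.differentiableAt hW (hφW t ht) l).hasFDerivAt.comp_hasDerivAt t hv

section Maps

variable {f : E → F} {O : Set E}

omit [ConvenientSpace E] in
theorem weakSmoothOn_affine (x X Y : E) (W : Set (ℝ × ℝ)) :
    WeakSmoothOn (fun p : ℝ × ℝ => x + p.1 • X + p.2 • Y) W :=
  ((weakSmoothOn_const x W).add ((weakSmoothOn_const X W).smul contDiff_fst.contDiffOn)).add
    ((weakSmoothOn_const Y W).smul contDiff_snd.contDiffOn)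

theorem ESmoothOn.dirDeriv_lin (hO : IsCInfOpen O) (hf : ESmoothOn f O) {x : E} (hx : x ∈ O)
    (a b : ℝ) (X Y : E) :
    dirDeriv f x (a • X + b • Y) = a • dirDeriv f x X + b • dirDeriv f x Y := by
  set P : ℝ × ℝ → E := fun p => x + p.1 • X + p.2 • Y with hP
  have hPs : WeakSmoothOn P Set.univ := weakSmoothOn_affine x X Y _
  have hW := hPs.isOpen_inter_preimage isOpen_univ hO
  have hQ := hf.comp_weakSmoothOn hW (hPs.mono Set.inter_subset_left) fun p hp => hp.2
  have h0 : (0 : ℝ × ℝ) ∈ Set.univ ∩ P ⁻¹' O := ⟨trivial, by simpa [hP] using hx⟩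
  have key : ∀ v : ℝ × ℝ, dirDeriv (fun p => f (P p)) 0 v = dirDeriv f x (v.1 • X + v.2 • Y) := by
    intro v
    simp only [ConvenientLie.dirDeriv, hP]
    congr 1
    funext s
    congr 1
    simp only [Prod.smul_fst, Prod.smul_snd, zero_add, smul_add, smul_smul, smul_eq_mul, add_assoc]
  have h1 := hQ.dirDeriv_lin hW h0 a b (1, 0) (0, 1)
  simpa [key] using h1

/-- The derivative `d f (x)` of a smooth map, as a linear map. -/
noncomputable def ESmoothOn.dirDerivₗ (hO : IsCInfOpen O) (hf : ESmoothOn f O) {x : E}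
    (hx : x ∈ O) : E →ₗ[ℝ] F where
  toFun := dirDeriv f x
  map_add' X Y := by simpa using hf.dirDeriv_lin hO hx 1 1 X Y
  map_smul' a X := by simpa using hf.dirDeriv_lin hO hx a 0 X 0

theorem ESmoothOn.weakSmoothOn_dirDeriv [FiniteDimensional ℝ V] (hO : IsCInfOpen O)
    (hf : ESmoothOn f O) {W : Set V} (hW : IsOpen W) {x y : V → E} (hx : WeakSmoothOn x W)
    (hy : WeakSmoothOn y W) (hxO : ∀ p ∈ W, x p ∈ O) :
    WeakSmoothOn (fun p => ConvenientLie.dirDeriv f (x p) (y p)) W := by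
  have : CompleteSpace V := FiniteDimensional.complete ℝ V
  set P : V × ℝ → E := fun q => x q.1 + q.2 • y q.1 with hP
  have hW' : IsOpen (Prod.fst ⁻¹' W : Set (V × ℝ)) := hW.preimage continuous_fst
  have hPs : WeakSmoothOn P (Prod.fst ⁻¹' W) :=
    (hx.comp contDiff_fst.contDiffOn fun _ h => h).add
      ((hy.comp contDiff_fst.contDiffOn fun _ h => h).smul contDiff_snd.contDiffOn)
  have hΩ := hPs.isOpen_inter_preimage hW' hO
  have hQ := hf.comp_weakSmoothOn hΩ (hPs.mono Set.inter_subset_left) fun p hp => hp.2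
  refine ((hQ.dirDeriv hΩ (0, 1)).comp (φ := fun p : V => (p, (0 : ℝ)))
    (contDiff_id.prodMk contDiff_const).contDiffOn (W' := W)
    fun p hp => ⟨hp, by simpa [hP] using hxO p hp⟩).congr fun p _ => ?_
  simp [ConvenientLie.dirDeriv, hP]

/-- A linear map is bounded as soon as it is locally bounded along smooth curves. -/
theorem isBoundedLinear_of_curves (s : E →ₗ[ℝ] E)
    (h : ∀ y : ℝ → E, IsSmoothCurve y → y 0 = 0 → ∀ l : E →L[ℝ] ℝ,
      ∃ C, ∀ᶠ t in 𝓝 0, |l (s (y t))| ≤ C) : IsBoundedLinear s := by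
  intro B hB
  refine detectsBounded_univ _ fun l _ => ?_
  obtain ⟨C, hC⟩ := bounded_of_locally_bounded_along_curves ((l : E →ₗ[ℝ] ℝ).comp s)
    (fun y hy hy0 => h y hy hy0 l) hB
  refine ⟨C, ?_⟩
  rintro _ ⟨x, hx, rfl⟩
  exact hC x hx

theorem isBoundedLinear_of_smooth (s : E →ₗ[ℝ] E)
    (h : ∀ y : ℝ → E, IsSmoothCurve y → ∃ J, IsOpen J ∧ (0 : ℝ) ∈ J ∧
      WeakSmoothOn (fun t => s (y t)) J) : IsBoundedLinear s := by
  refine isBoundedLinear_of_curves s fun y hy _ l => ?_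
  obtain ⟨J, hJ, h0, hs⟩ := h y hy
  have hc : ContinuousAt (fun t => l (s (y t))) 0 :=
    (hs l).continuousOn.continuousAt (hJ.mem_nhds h0)
  refine ⟨|l (s (y 0))| + 1, ?_⟩
  filter_upwards [hc.abs.eventually (gt_mem_nhds (lt_add_one _))] with t ht using ht.le

theorem ESmoothOn.isBoundedLinear_dirDerivₗ {f : E → E} (hO : IsCInfOpen O)
    (hf : ESmoothOn f O) {x : E} (hx : x ∈ O) : IsBoundedLinear (hf.dirDerivₗ hO hx) :=
  isBoundedLinear_of_smooth _ fun _ hy => ⟨Set.univ, isOpen_univ, trivial,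
    hf.weakSmoothOn_dirDeriv hO isOpen_univ (weakSmoothOn_const x _)
      (weakSmoothOn_univ_iff.2 hy) fun _ _ => hx⟩

/-- The chain rule: the derivative of a smooth map along a curve depends on the velocity of the
curve only. The curve is compared with its tangent line through the plot
`(s, r) ↦ f (x + s • X + r • z s)`, where `c (t + s) = x + s • X + s ^ 2 • z s`. -/
theorem ESmoothOn.hasDerivAt_comp (hO : IsCInfOpen O) (hf : ESmoothOn f O) {c : ℝ → E} {J : Set ℝ}
    (hJ : IsOpen J) (hc : WeakSmoothOn c J) {t : ℝ} (ht : t ∈ J) (hcO : c t ∈ O) :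
    HasDerivAt (fun s => f (c s)) (ConvenientLie.dirDeriv f (c t) (deriv c t)) t := by
  have hJ' := hc.isOpen_inter_preimage hJ hO
  have hfc := hf.comp_weakSmoothOn hJ' (hc.mono Set.inter_subset_left) fun p hp => hp.2
  refine hfc.hasDerivAt_of_dual hJ' ⟨ht, hcO⟩ fun l => ?_
  set x := c t with hx
  set X := deriv c t with hX
  obtain ⟨θ, hθ, hθJ, hθt⟩ := exists_reparametrization hJ ht
  set g : ℝ → E := fun s => c (θ (t + s)) - (x + s • X) with hg
  have hlin : WeakSmoothOn (fun s : ℝ => x + s • X) Set.univ :=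
    (weakSmoothOn_const x _).add ((weakSmoothOn_const X _).smul contDiff_id.contDiffOn)
  have hcθ : WeakSmoothOn (fun s : ℝ => c (θ (t + s))) Set.univ :=
    hc.comp (hθ.comp (contDiff_const.add contDiff_id)).contDiffOn fun s _ => hθJ _
  have hgs : IsSmoothCurve g := weakSmoothOn_univ_iff.1 (hcθ.sub hlin)
  have hshift : Tendsto (fun s : ℝ => t + s) (𝓝 0) (𝓝 t) := by
    have h : Continuous fun s : ℝ => t + s := by fun_prop
    simpa using h.tendsto 0
  have hθ0 : ∀ᶠ s in 𝓝 (0 : ℝ), θ (t + s) = t + s := hshift.eventually hθt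
  have hg0 : g 0 = 0 := by
    have := hθ0.self_of_nhds
    simp [hg, hx, hθt.self_of_nhds]
  have hg' : deriv g 0 = 0 := by
    refine ext_dual fun l => ?_
    rw [(weakSmoothOn_univ_iff.2 hgs).map_deriv isOpen_univ trivial l, map_zero]
    refine HasDerivAt.deriv ?_
    have h1 : HasDerivAt (fun s => l (c s)) (l X) (t + 0) := by
      rw [add_zero]
      exact HasDerivAt.clm_apply' (hc.hasDerivAt hJ ht) l
    have h2 : HasDerivAt (fun s => l (c (t + s))) (l X) 0 := by
      have h3 : HasDerivAt (fun s : ℝ => t + s) 1 0 := (hasDerivAt_id (0 : ℝ)).const_add t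
      have h4 := h1.comp (0 : ℝ) h3
      rwa [mul_one] at h4
    have h4 : HasDerivAt (fun s : ℝ => l x + s * l X) (l X) 0 := by
      simpa using ((hasDerivAt_id (0 : ℝ)).mul_const (l X)).const_add (l x)
    have h5 := h2.sub h4
    rw [sub_self] at h5
    refine h5.congr_of_eventuallyEq ?_
    filter_upwards [hθ0] with s hs
    simp [hg, hs]
  obtain ⟨w, hw, hgw, hw0⟩ := hgs.exists_eq_smul hg0
  obtain ⟨z, hz, hwz, -⟩ := hw.exists_eq_smul (hw0.trans hg')
  set P : ℝ × ℝ → E := fun p => x + p.1 • X + p.2 • z p.1 with hP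
  have hPs : WeakSmoothOn P Set.univ :=
    ((weakSmoothOn_const x _).add ((weakSmoothOn_const X _).smul contDiff_fst.contDiffOn)).add
      (((weakSmoothOn_univ_iff.2 hz).comp contDiff_fst.contDiffOn
        fun _ _ => trivial).smul contDiff_snd.contDiffOn)
  have hW := hPs.isOpen_inter_preimage isOpen_univ hO
  have hQ := hf.comp_weakSmoothOn hW (hPs.mono Set.inter_subset_left) fun p hp => hp.2
  have h0 : (0 : ℝ × ℝ) ∈ Set.univ ∩ P ⁻¹' O := ⟨trivial, by simpa [hP] using hcO⟩
  have e1 : ConvenientLie.dirDeriv f x X = ConvenientLie.dirDeriv (fun p => f (P p)) 0 (1, 0) := by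
    simp [ConvenientLie.dirDeriv, hP]
  rw [e1, hQ.map_dirDeriv hW h0]
  have hφ : HasDerivAt (fun s : ℝ => (s - t, (s - t) ^ 2)) ((1 : ℝ), (0 : ℝ)) t := by
    have h1 : HasDerivAt (fun s : ℝ => s - t) 1 t := (hasDerivAt_id t).sub_const t
    have h2 : HasDerivAt (fun s : ℝ => (s - t) ^ 2) 0 t := by
      have h3 := h1.pow 2
      simp only [sub_self] at h3
      convert! h3 using 1
      simp
    exact h1.prodMk h2
  have hd := (hQ.differentiableAt hW h0 l).hasFDerivAt
  have hd' : HasFDerivAt (fun p => l (f (P p))) (fderiv ℝ (fun p => l (f (P p))) 0)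
      ((fun s : ℝ => (s - t, (s - t) ^ 2)) t) := by
    simpa [Prod.mk_zero_zero] using hd
  refine (hd'.comp_hasDerivAt t hφ).congr_of_eventuallyEq ?_
  filter_upwards [hθt] with s hs
  have h1 := hgw (s - t)
  rw [hwz] at h1
  simp only [hg, add_sub_cancel, hs] at h1
  have h2 : c s = P (s - t, (s - t) ^ 2) := by
    rw [sub_eq_iff_eq_add'.1 h1]
    simp only [hP, sq, mul_smul]
  simp only [Function.comp_apply, h2]

end Maps

end WeakSmooth

/-! ### Plots in manifolds -/

section Charts

variable {E : Type*} [AddCommGroup E] [Module ℝ E] [TopologicalSpace E]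
variable {G : Type*} [TopologicalSpace G]

/-- The chart `e` as a map with values in `E`. -/
def chartMap (e : OpenPartialHomeomorph G (CInf E)) (g : G) : E := (toCInf E).symm (e g)

/-- The inverse of the chart `e` as a map defined on `E`. -/
def chartInv (e : OpenPartialHomeomorph G (CInf E)) (x : E) : G := e.symm (toCInf E x)

/-- The range of the chart `e`, as a subset of `E`. -/
def chartRange (e : OpenPartialHomeomorph G (CInf E)) : Set E := {x | toCInf E x ∈ e.target}

variable {e : OpenPartialHomeomorph G (CInf E)}

theorem chartMap_mem {g : G} (hg : g ∈ e.source) : chartMap e g ∈ chartRange e := by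
  simpa [chartRange, chartMap] using e.map_source hg

theorem chartInv_mem {x : E} (hx : x ∈ chartRange e) : chartInv e x ∈ e.source :=
  e.map_target hx

theorem chartInv_chartMap {g : G} (hg : g ∈ e.source) : chartInv e (chartMap e g) = g := by
  simpa [chartInv, chartMap] using e.left_inv hg

theorem chartMap_chartInv {x : E} (hx : x ∈ chartRange e) : chartMap e (chartInv e x) = x := by
  have : e (e.symm (toCInf E x)) = toCInf E x := e.right_inv hx
  simp [chartInv, chartMap, this]

theorem isCInfOpen_chartRange [ConvenientSpace E] : IsCInfOpen (chartRange e) := by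
  rw [isCInfOpen_iff]
  have : (toCInf E).symm ⁻¹' chartRange e = e.target := by
    ext x
    simp [chartRange]
  rw [this]
  exact e.open_target

end Charts

section Plots

variable {E : Type*} [AddCommGroup E] [Module ℝ E] [TopologicalSpace E] [ConvenientSpace E]
variable {G : Type*} [TopologicalSpace G] [ChartedSpace (CInf E) G]
variable {V : Type*} [NormedAddCommGroup V] [NormedSpace ℝ V]
variable {V' : Type*} [NormedAddCommGroup V'] [NormedSpace ℝ V']

omit [ConvenientSpace E] in
theorem IsSmoothCurve.continuous_toCInf {x : ℝ → E} (hx : IsSmoothCurve x) :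
    Continuous fun t => toCInf E (x t) := by
  refine continuous_def.2 fun O hO => ?_
  exact (isCInfOpen_iff (O := toCInf E ⁻¹' O)).2 (by simpa using hO) x hx

theorem IsSmoothCurveIn.comp {c : ℝ → G} (hc : IsSmoothCurveIn E c) {θ : ℝ → ℝ}
    (hθ : ContDiff ℝ ∞ θ) : IsSmoothCurveIn E fun t => c (θ t) := by
  refine ⟨hc.1.comp hθ.continuous, fun φ hφ => ?_⟩
  refine (isSmoothCurveOn_iff (φ.open_source.preimage (hc.1.comp hθ.continuous))).2 fun l => ?_
  exact ((hc.2 φ hφ).contDiffOn (φ.open_source.preimage hc.1) l).comp hθ.contDiffOn fun _ h => h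

theorem isSmoothCurveIn_const (g : G) : IsSmoothCurveIn E fun _ : ℝ => g := by
  refine ⟨continuous_const, fun φ _ => ?_⟩
  rw [isSmoothCurveOn_iff (φ.open_source.preimage continuous_const)]
  exact fun _ => contDiffOn_const

/-- A map `P` from an open subset `W` of a normed space to the manifold is a plot if it maps smooth
curves to smooth curves. -/
def GSmoothOn (E : Type*) [AddCommGroup E] [Module ℝ E] [TopologicalSpace E]
    [ChartedSpace (CInf E) G] (P : V → G) (W : Set V) : Prop :=
  ∀ c : ℝ → V, ContDiff ℝ ∞ c → (∀ t, c t ∈ W) → IsSmoothCurveIn E fun t => P (c t)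

omit [ConvenientSpace E] in
theorem GSmoothOn.mono {P : V → G} {W W' : Set V} (hP : GSmoothOn E P W) (h : W' ⊆ W) :
    GSmoothOn E P W' := fun c hc hcW => hP c hc fun t => h (hcW t)

omit [ConvenientSpace E] in
theorem GSmoothOn.comp {P : V → G} {W : Set V} (hP : GSmoothOn E P W) {φ : V' → V} {W' : Set V'}
    (hφ : ContDiffOn ℝ ∞ φ W') (h : ∀ p ∈ W', φ p ∈ W) : GSmoothOn E (fun p => P (φ p)) W' :=
  fun _ hc hcW => hP _ (contDiffOn_univ.1 (hφ.comp hc.contDiffOn fun t _ => hcW t))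
    fun t => h _ (hcW t)

omit [ConvenientSpace E] in
theorem GSmoothOn.map {P : V → G} {W : Set V} (hP : GSmoothOn E P W) {T : G → G} {U : Set G}
    (hT : IsSmoothMapOn E T U) (h : ∀ p ∈ W, P p ∈ U) : GSmoothOn E (fun p => T (P p)) W :=
  fun c hc hcW => hT _ (hP c hc hcW) fun t => h _ (hcW t)

theorem gSmoothOn_const (g : G) (W : Set V) : GSmoothOn E (fun _ => g) W :=
  fun _ _ _ => isSmoothCurveIn_const g

theorem IsSmoothCurveIn.gSmoothOn {c : ℝ → G} (hc : IsSmoothCurveIn E c) :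
    GSmoothOn E c Set.univ := fun _ hθ _ => hc.comp hθ

omit [ConvenientSpace E] in
theorem GSmoothOn.isSmoothCurveIn {c : ℝ → G} (hc : GSmoothOn E c Set.univ) :
    IsSmoothCurveIn E c := hc id contDiff_id fun _ => trivial

omit [ConvenientSpace E] in
theorem GSmoothOn.isOpen_inter_preimage [CompleteSpace V] {P : V → G} {W : Set V}
    (hP : GSmoothOn E P W) (hW : IsOpen W) {U : Set G} (hU : IsOpen U) :
    IsOpen (W ∩ P ⁻¹' U) := by
  refine isOpen_of_forall_curve fun c hc => isOpen_iff_mem_nhds.2 fun t ht => ?_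
  obtain ⟨θ, hθ, hθJ, hθt⟩ := exists_reparametrization (hW.preimage hc.continuous) ht.1
  have hsm : IsSmoothCurveIn E fun s => P (c (θ s)) := hP _ (hc.comp hθ) hθJ
  have h1 : ∀ᶠ s in 𝓝 t, P (c (θ s)) ∈ U := by
    refine (hU.preimage hsm.1).mem_nhds ?_
    rw [Set.mem_preimage, hθt.self_of_nhds]
    exact ht.2
  filter_upwards [h1, hθt, (hW.preimage hc.continuous).mem_nhds ht.1] with s hs hs' hs''
  rw [hs'] at hs
  exact ⟨hs'', hs⟩

omit [ConvenientSpace E] in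
theorem IsSmoothCurveIn.isSmoothCurve_chartMap {c : ℝ → G} (hc : IsSmoothCurveIn E c)
    {e : OpenPartialHomeomorph G (CInf E)} (he : e ∈ atlas (CInf E) G)
    (h : ∀ t, c t ∈ e.source) : IsSmoothCurve fun t => chartMap e (c t) := by
  have h1 := hc.2 e he
  have h2 : c ⁻¹' e.source = Set.univ := Set.eq_univ_of_forall h
  rwa [h2] at h1

/-- Plots are smooth in charts. -/
theorem GSmoothOn.weakSmoothOn_chartMap [FiniteDimensional ℝ V] {P : V → G} {W : Set V}
    (hP : GSmoothOn E P W) (hW : IsOpen W) {e : OpenPartialHomeomorph G (CInf E)}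
    (he : e ∈ atlas (CInf E) G) (h : ∀ p ∈ W, P p ∈ e.source) :
    WeakSmoothOn (fun p => chartMap e (P p)) W :=
  weakSmoothOn_of_curves hW fun c hc hcW =>
    (hP c hc hcW).isSmoothCurve_chartMap he fun t => h _ (hcW t)

variable [Group G] [ConvenientLieGroup E G]

theorem IsSmoothCurve.chartInv {x : ℝ → E} (hx : IsSmoothCurve x)
    {e : OpenPartialHomeomorph G (CInf E)} (he : e ∈ atlas (CInf E) G)
    (h : ∀ t, x t ∈ chartRange e) : IsSmoothCurveIn E fun t => chartInv e (x t) := by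
  have hcont : Continuous fun t => ConvenientLie.chartInv e (x t) :=
    e.continuousOn_symm.comp_continuous hx.continuous_toCInf h
  refine ⟨hcont, fun ψ hψ => ?_⟩
  have hJ := ψ.open_source.preimage hcont
  rw [isSmoothCurveOn_iff hJ]
  intro l t ht
  obtain ⟨θ, hθ, hθJ, hθt⟩ := exists_reparametrization hJ ht
  have hxθ : IsSmoothCurve fun s => x (θ s) :=
    (weakSmoothOn_univ_iff.2 hx).isSmoothCurve hθ fun _ => trivial
  have h1 := ConvenientLieGroup.smooth_chart_change (G := G) e he ψ hψ _ hxθ fun s => by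
    rw [OpenPartialHomeomorph.trans_source]
    exact ⟨h (θ s), hθJ s⟩
  have h2 := (isSmoothCurve_iff.1 h1 l).contDiffAt (x := t)
  refine (h2.congr_of_eventuallyEq ?_).contDiffWithinAt
  filter_upwards [hθt] with s hs
  simp only [hs]
  rfl

theorem WeakSmoothOn.gSmoothOn {x : V → E} {W : Set V} (hx : WeakSmoothOn x W)
    {e : OpenPartialHomeomorph G (CInf E)} (he : e ∈ atlas (CInf E) G)
    (h : ∀ p ∈ W, x p ∈ chartRange e) : GSmoothOn E (fun p => chartInv e (x p)) W :=
  fun _ hc hcW => (hx.isSmoothCurve hc hcW).chartInv he fun t => h _ (hcW t)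

omit [ConvenientSpace E] in
theorem GSmoothOn.mul {P Q : V → G} {W : Set V} (hP : GSmoothOn E P W) (hQ : GSmoothOn E Q W) :
    GSmoothOn E (fun p => P p * Q p) W :=
  fun c hc hcW => ConvenientLieGroup.smooth_mul _ _ (hP c hc hcW) (hQ c hc hcW)

omit [ConvenientSpace E] in
theorem GSmoothOn.inv {P : V → G} {W : Set V} (hP : GSmoothOn E P W) :
    GSmoothOn E (fun p => (P p)⁻¹) W :=
  fun c hc hcW => ConvenientLieGroup.smooth_inv _ (hP c hc hcW)

/-! ### Tangent maps in charts -/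

/-- The local representative of `T : G → G` in the charts `e` and `e'`. -/
def localRep (e e' : OpenPartialHomeomorph G (CInf E)) (T : G → G) (x : E) : E :=
  chartMap e' (T (chartInv e x))

/-- The domain of the local representative in the charts `e` and `e'` of a map defined on `U`. -/
def localDom (e e' : OpenPartialHomeomorph G (CInf E)) (T : G → G) (U : Set G) : Set E :=
  {x | x ∈ chartRange e ∧ chartInv e x ∈ U ∧ T (chartInv e x) ∈ e'.source}

section LocalRep

variable {e e' : OpenPartialHomeomorph G (CInf E)} {T : G → G} {U : Set G}

theorem isCInfOpen_localDom (he : e ∈ atlas (CInf E) G)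
    (hU : IsOpen U) (hT : IsSmoothMapOn E T U) : IsCInfOpen (localDom e e' T U) := by
  intro c hc
  have h1 : IsOpen (c ⁻¹' chartRange e) := isCInfOpen_chartRange c hc
  have h2 : GSmoothOn E (fun t => chartInv e (c t)) (c ⁻¹' chartRange e) :=
    ((weakSmoothOn_univ_iff.2 hc).mono (Set.subset_univ _)).gSmoothOn he fun _ h => h
  have h3 := h2.isOpen_inter_preimage h1 hU
  have h4 : GSmoothOn E (fun t => T (chartInv e (c t)))
      (c ⁻¹' chartRange e ∩ (fun t => chartInv e (c t)) ⁻¹' U) :=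
    (h2.mono Set.inter_subset_left).map hT fun p hp => hp.2
  convert! h4.isOpen_inter_preimage h3 e'.open_source using 1
  ext t
  simp only [localDom, Set.mem_preimage, Set.mem_inter_iff, Set.mem_ofPred_eq]
  tauto

theorem eSmoothOn_localRep (he : e ∈ atlas (CInf E) G) (he' : e' ∈ atlas (CInf E) G)
    (hT : IsSmoothMapOn E T U) : ESmoothOn (localRep e e' T) (localDom e e' T U) := fun _ hc hcO =>
  (hT _ (hc.chartInv he fun t => (hcO t).1) fun t => (hcO t).2.1).isSmoothCurve_chartMap he'
    fun t => (hcO t).2.2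

omit [ConvenientSpace E] [ChartedSpace (CInf E) G] [Group G] [ConvenientLieGroup E G] in
theorem chartMap_mem_localDom {g : G} (hg : g ∈ e.source) (hgU : g ∈ U) (hTg : T g ∈ e'.source) :
    chartMap e g ∈ localDom e e' T U :=
  ⟨chartMap_mem hg, by rwa [chartInv_chartMap hg], by rwa [chartInv_chartMap hg]⟩

/-- The chain rule for a smooth map `T` of the manifold and a curve `a`, in charts. -/
theorem hasDerivAt_chartMap_comp (he : e ∈ atlas (CInf E) G) (he' : e' ∈ atlas (CInf E) G)
    (hU : IsOpen U) (hT : IsSmoothMapOn E T U) {a : ℝ → G} {J : Set ℝ} (hJ : IsOpen J)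
    (ha : GSmoothOn E a J) {t : ℝ} (ht : t ∈ J) (hat : a t ∈ e.source) (haU : a t ∈ U)
    (hTa : T (a t) ∈ e'.source) :
    HasDerivAt (fun s => chartMap e' (T (a s)))
      (dirDeriv (localRep e e' T) (chartMap e (a t)) (deriv (fun s => chartMap e (a s)) t)) t := by
  have hJ' := ha.isOpen_inter_preimage hJ e.open_source
  have hx := (ha.mono Set.inter_subset_left).weakSmoothOn_chartMap hJ' he fun p hp => hp.2
  have h1 := (eSmoothOn_localRep he he' hT).hasDerivAt_comp (isCInfOpen_localDom he hU hT) hJ' hx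
    ⟨ht, hat⟩ (chartMap_mem_localDom hat haU hTa)
  rw [hasDerivAt_iff_slope] at h1 ⊢
  refine h1.congr' ?_
  filter_upwards [hJ'.mem_nhds ⟨ht, hat⟩] with s hs
  simp only [localRep, chartInv_chartMap hs.2, chartInv_chartMap hat]

end LocalRep

end Plots

/-! ### Velocities at the identity and the adjoint action -/

/-- Having a derivative is a local property, also for curves in spaces without a norm. -/
theorem hasDerivAt_congr {F : Type*} [AddCommGroup F] [Module ℝ F] [TopologicalSpace F]
    [ContinuousSMul ℝ F] {c d : ℝ → F} {v : F} {t : ℝ} (hc : HasDerivAt c v t)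
    (h : d =ᶠ[𝓝 t] c) : HasDerivAt d v t := by
  rw [hasDerivAt_iff_slope] at hc ⊢
  refine hc.congr' ?_
  filter_upwards [h] with s hs
  rw [hs, h.self_of_nhds]

section Lie

variable (E : Type*) [AddCommGroup E] [Module ℝ E] [TopologicalSpace E]
variable (G : Type*) [TopologicalSpace G] [ChartedSpace (CInf E) G] [Group G]

/-- The preferred chart at the identity. -/
noncomputable abbrev idChart : OpenPartialHomeomorph G (CInf E) := chartAt (CInf E) (1 : G)

theorem idChart_mem_atlas : idChart E G ∈ atlas (CInf E) G := chart_mem_atlas _ _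

theorem one_mem_source : (1 : G) ∈ (idChart E G).source := mem_chart_source _ _

/-- The coordinates of the identity. -/
noncomputable def origin : E := chartMap (idChart E G) 1

theorem origin_mem : origin E G ∈ chartRange (idChart E G) := chartMap_mem (one_mem_source E G)

theorem chartInv_origin : chartInv (idChart E G) (origin E G) = 1 :=
  chartInv_chartMap (one_mem_source E G)

variable {G} [ConvenientSpace E]

/-- The curve `a` is smooth near the time `0`, passes at that time through the identity, and its
velocity in the preferred chart is `v`. -/
def HasVelocity (a : ℝ → G) (v : E) : Prop :=
  ∃ J : Set ℝ, IsOpen J ∧ 0 ∈ J ∧ GSmoothOn E a J ∧ a 0 = 1 ∧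
    HasDerivAt (fun s => chartMap (idChart E G) (a s)) v 0

variable {E}

theorem HasVelocity.deriv {a : ℝ → G} {v : E} (ha : HasVelocity E a v) :
    deriv (fun s => chartMap (idChart E G) (a s)) 0 = v := by
  obtain ⟨J, -, -, -, -, h⟩ := ha
  exact deriv_eq_of_hasDerivAt h

theorem HasVelocity.unique {a : ℝ → G} {v w : E} (hv : HasVelocity E a v)
    (hw : HasVelocity E a w) : v = w := hv.deriv.symm.trans hw.deriv

theorem hasVelocity_of_gSmoothOn {a : ℝ → G} {J : Set ℝ} (hJ : IsOpen J) (h0 : (0 : ℝ) ∈ J)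
    (ha : GSmoothOn E a J) (ha0 : a 0 = 1) :
    HasVelocity E a (_root_.deriv (fun s => chartMap (idChart E G) (a s)) 0) := by
  refine ⟨J, hJ, h0, ha, ha0, ?_⟩
  have hJ' := ha.isOpen_inter_preimage hJ (idChart E G).open_source
  exact ((ha.mono Set.inter_subset_left).weakSmoothOn_chartMap hJ' (idChart_mem_atlas E G)
    fun p hp => hp.2).hasDerivAt hJ' ⟨h0, by
      rw [Set.mem_preimage, ha0]
      exact one_mem_source E G⟩

theorem HasVelocity.congr {a b : ℝ → G} {v : E} (ha : HasVelocity E a v) {J : Set ℝ}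
    (hJ : IsOpen J) (h0 : (0 : ℝ) ∈ J) (hb : GSmoothOn E b J) (hab : b =ᶠ[𝓝 0] a) :
    HasVelocity E b v := by
  obtain ⟨-, -, -, -, ha0, hd⟩ := ha
  refine ⟨J, hJ, h0, hb, hab.self_of_nhds.trans ha0, hasDerivAt_congr hd ?_⟩
  filter_upwards [hab] with s hs
  rw [hs]

variable [ConvenientLieGroup E G]

omit [ConvenientLieGroup E G] in
theorem hasVelocity_one : HasVelocity E (fun _ : ℝ => (1 : G)) (0 : E) := by
  have h := hasVelocity_of_gSmoothOn (E := E) isOpen_univ (Set.mem_univ 0)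
    (gSmoothOn_const (1 : G) _) rfl
  have h0 : HasDerivAt (fun _ : ℝ => chartMap (idChart E G) 1) 0 0 := by
    rw [hasDerivAt_iff_slope]
    simp
  rwa [deriv_eq_of_hasDerivAt h0] at h

omit [ConvenientSpace E] in
theorem weakSmoothOn_line (x X : E) (J : Set ℝ) : WeakSmoothOn (fun s : ℝ => x + s • X) J :=
  (weakSmoothOn_const x J).add ((weakSmoothOn_const X J).smul contDiff_id.contDiffOn)

theorem hasDerivAt_line (x X : E) : HasDerivAt (fun s : ℝ => x + s • X) X 0 := by
  rw [hasDerivAt_iff_slope]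
  simp

variable (G) in
theorem hasVelocity_line (X : E) :
    HasVelocity E (fun s : ℝ => chartInv (idChart E G) (origin E G + s • X)) X := by
  have hs := weakSmoothOn_line (origin E G) X Set.univ
  have hJ := hs.isOpen_inter_preimage isOpen_univ (isCInfOpen_chartRange (e := idChart E G))
  refine ⟨_, hJ, ⟨trivial, by simpa using origin_mem E G⟩,
    (hs.mono Set.inter_subset_left).gSmoothOn (idChart_mem_atlas E G) fun p hp => hp.2,
    by simp [chartInv_origin], ?_⟩
  refine hasDerivAt_congr (hasDerivAt_line (origin E G) X) ?_
  filter_upwards [hJ.mem_nhds ⟨trivial, by simpa using origin_mem E G⟩] with s hs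
  exact chartMap_chartInv hs.2

/-- The product rule at the identity: the plot `(s, r) ↦ a s * b r` has a linear derivative at
`(0, 0)`, and its partial derivatives there are `v` and `w`. -/
theorem HasVelocity.mul {a b : ℝ → G} {v w : E} (ha : HasVelocity E a v)
    (hb : HasVelocity E b w) : HasVelocity E (fun s => a s * b s) (v + w) := by
  have hav := ha.deriv
  have hbw := hb.deriv
  obtain ⟨J, hJ, h0, has, ha0, -⟩ := ha
  obtain ⟨J', hJ', h0', hbs, hb0, -⟩ := hb
  have hab : GSmoothOn E (fun s => a s * b s) (J ∩ J') :=
    (has.mono Set.inter_subset_left).mul (hbs.mono Set.inter_subset_right)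
  have hres := hasVelocity_of_gSmoothOn (hJ.inter hJ') ⟨h0, h0'⟩ hab (by simp [ha0, hb0])
  have hP : GSmoothOn E (fun p : ℝ × ℝ => a p.1 * b p.2) (J ×ˢ J') :=
    (has.comp contDiff_fst.contDiffOn fun p hp => hp.1).mul
      (hbs.comp contDiff_snd.contDiffOn fun p hp => hp.2)
  have hW := hP.isOpen_inter_preimage (hJ.prod hJ') (idChart E G).open_source
  have hQ := (hP.mono Set.inter_subset_left).weakSmoothOn_chartMap hW (idChart_mem_atlas E G)
    fun p hp => hp.2
  have h00 : (0 : ℝ × ℝ) ∈ J ×ˢ J' ∩ (fun p : ℝ × ℝ => a p.1 * b p.2) ⁻¹' (idChart E G).source :=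
    ⟨⟨h0, h0'⟩, by simp [ha0, hb0]⟩
  have hlin := hQ.dirDeriv_lin hW h00 1 1 (1, 0) (0, 1)
  have key : ∀ v : ℝ × ℝ, dirDeriv (fun p : ℝ × ℝ => chartMap (idChart E G) (a p.1 * b p.2)) 0 v =
      _root_.deriv (fun s => chartMap (idChart E G) (a (s * v.1) * b (s * v.2))) 0 := by
    intro v
    simp [dirDeriv]
  simp only [key] at hlin
  simp only [one_smul, Prod.mk_add_mk, mul_one, mul_zero, add_zero, zero_add, ha0, hb0,
    one_mul, hav, hbw] at hlin
  rwa [hlin] at hres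

theorem HasVelocity.inv {a : ℝ → G} {v : E} (ha : HasVelocity E a v) :
    HasVelocity E (fun s => (a s)⁻¹) (-v) := by
  have ha' := ha
  obtain ⟨J, hJ, h0, has, ha0, -⟩ := ha
  have hi := hasVelocity_of_gSmoothOn hJ h0 has.inv (by simp [ha0])
  have h1 := ha'.mul hi
  simp only [mul_inv_cancel] at h1
  have h2 := h1.unique hasVelocity_one
  rwa [eq_neg_of_add_eq_zero_right h2] at hi

/-- The chain rule at the identity for a smooth map fixing the identity. -/
theorem HasVelocity.map {a : ℝ → G} {v : E} (ha : HasVelocity E a v) {T : G → G} {U : Set G}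
    (hU : IsOpen U) (h1 : 1 ∈ U) (hT : IsSmoothMapOn E T U) (hT1 : T 1 = 1) :
    HasVelocity E (fun s => T (a s))
      (dirDeriv (localRep (idChart E G) (idChart E G) T) (origin E G) v) := by
  have hav := ha.deriv
  obtain ⟨J, hJ, h0, has, ha0, -⟩ := ha
  have hJ' := has.isOpen_inter_preimage hJ hU
  refine ⟨_, hJ', ⟨h0, by simpa [ha0] using h1⟩, (has.mono Set.inter_subset_left).map hT
    fun p hp => hp.2, by simp [ha0, hT1], ?_⟩
  have := hasDerivAt_chartMap_comp (idChart_mem_atlas E G) (idChart_mem_atlas E G) hU hT hJ has h0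
    (by rw [ha0]; exact one_mem_source E G) (by rwa [ha0])
    (by rw [ha0, hT1]; exact one_mem_source E G)
  rwa [hav, ha0] at this

theorem isSmoothMapOn_mul_left (g : G) :
    IsSmoothMapOn E (fun x => g * x) Set.univ :=
  fun c hc _ => ConvenientLieGroup.smooth_mul _ c (isSmoothCurveIn_const g) hc

theorem isSmoothMapOn_mul_right (g : G) :
    IsSmoothMapOn E (fun x => x * g) Set.univ :=
  fun c hc _ => ConvenientLieGroup.smooth_mul c _ hc (isSmoothCurveIn_const g)

theorem isSmoothMapOn_conj (h : G) :
    IsSmoothMapOn E (fun x => h * x * h⁻¹) Set.univ :=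
  fun c hc _ => ConvenientLieGroup.smooth_mul _ _
    (ConvenientLieGroup.smooth_mul _ c (isSmoothCurveIn_const h) hc) (isSmoothCurveIn_const h⁻¹)

theorem HasVelocity.conj {a : ℝ → G} {v : E} (ha : HasVelocity E a v) (h : G) :
    HasVelocity E (fun s => h * a s * h⁻¹) (Ad E h v) :=
  ha.map isOpen_univ trivial (isSmoothMapOn_conj h) (by simp)

theorem Ad_lin (h : G) (a b : ℝ) (X Y : E) :
    Ad E h (a • X + b • Y) = a • Ad E h X + b • Ad E h Y := by
  have hT := isSmoothMapOn_conj (E := E) h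
  refine (eSmoothOn_localRep (idChart_mem_atlas E G) (idChart_mem_atlas E G) hT).dirDeriv_lin
    (isCInfOpen_localDom (idChart_mem_atlas E G) isOpen_univ hT)
    (chartMap_mem_localDom (one_mem_source E G) trivial ?_) a b X Y
  simp

/-- The adjoint action as a linear map. -/
noncomputable def AdLinear (h : G) : E →ₗ[ℝ] E where
  toFun := Ad E h
  map_add' X Y := by simpa using Ad_lin h 1 1 X Y
  map_smul' a X := by simpa using Ad_lin h a 0 X (0 : E)

@[simp]
theorem AdLinear_apply (h : G) (X : E) : AdLinear h X = Ad E h X := rfl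

theorem Ad_mul (g h : G) (X : E) : Ad E (g * h) X = Ad E g (Ad E h X) := by
  have h1 := ((hasVelocity_line G X).conj h).conj g
  refine ((hasVelocity_line G X).conj (g * h)).unique ?_
  convert! h1 using 2
  simp [mul_assoc]

theorem Ad_one (X : E) : Ad E (1 : G) X = X :=
  ((hasVelocity_line G X).conj 1).unique (by simpa using hasVelocity_line G X)

variable {V : Type*} [NormedAddCommGroup V] [NormedSpace ℝ V] [FiniteDimensional ℝ V]

/-- The adjoint action is smooth in both variables. -/
theorem weakSmoothOn_Ad {b : V → G} {y : V → E} {W : Set V} (hW : IsOpen W)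
    (hb : GSmoothOn E b W) (hy : WeakSmoothOn y W) :
    WeakSmoothOn (fun p => Ad E (b p) (y p)) W := by
  have : CompleteSpace V := FiniteDimensional.complete ℝ V
  have hW' : IsOpen (Prod.fst ⁻¹' W : Set (V × ℝ)) := hW.preimage continuous_fst
  have hx : WeakSmoothOn (fun p : V × ℝ => origin E G + p.2 • y p.1) (Prod.fst ⁻¹' W) :=
    (weakSmoothOn_const _ _).add ((hy.comp contDiff_fst.contDiffOn fun _ h => h).smul
      contDiff_snd.contDiffOn)
  have hΩ := hx.isOpen_inter_preimage hW' (isCInfOpen_chartRange (e := idChart E G))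
  have hb' := hb.comp (φ := fun p : V × ℝ => p.1) contDiff_fst.contDiffOn
    (W' := Prod.fst ⁻¹' W ∩ (fun p : V × ℝ => origin E G + p.2 • y p.1) ⁻¹'
      chartRange (idChart E G)) fun p hp => hp.1
  have hP := (hb'.mul ((hx.mono Set.inter_subset_left).gSmoothOn (idChart_mem_atlas E G)
    fun p hp => hp.2)).mul hb'.inv
  have hΩ' := hP.isOpen_inter_preimage hΩ (idChart E G).open_source
  have hQ := ((hP.mono Set.inter_subset_left).weakSmoothOn_chartMap hΩ' (idChart_mem_atlas E G)
    fun p hp => hp.2).dirDeriv hΩ' (0, 1)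
  refine (hQ.comp (φ := fun p : V => (p, (0 : ℝ)))
    (contDiff_id.prodMk contDiff_const).contDiffOn (W' := W)
    fun p hp => ⟨⟨hp, ?_⟩, ?_⟩).congr fun p _ => ?_
  · simpa using origin_mem E G
  · simp [chartInv_origin]
  · simp only [dirDeriv, Prod.fst_add, Prod.smul_fst, smul_zero, Prod.snd_add,
      Prod.smul_snd, smul_eq_mul, mul_one, add_zero, zero_add]
    rfl

theorem isBoundedLinear_Ad (h : G) : IsBoundedLinear (AdLinear h : E →ₗ[ℝ] E) :=
  isBoundedLinear_of_smooth _ fun _ hy => ⟨Set.univ, isOpen_univ, trivial,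
    weakSmoothOn_Ad isOpen_univ (gSmoothOn_const h _) (weakSmoothOn_univ_iff.2 hy)⟩

/-! ### The Lie bracket as the derivative of the adjoint action -/

omit [ConvenientSpace E] [ConvenientLieGroup E G] in
theorem leftInvariantField_eq {g : G} (hg : g ∈ (idChart E G).source) (X : E) :
    leftInvariantField E G X (chartMap (idChart E G) g) =
      dirDeriv (localRep (idChart E G) (idChart E G) fun x => g * x) (origin E G) X := by
  have : coordSymm E (1 : G) (chartMap (idChart E G) g) = g := chartInv_chartMap hg
  rw [leftInvariantField, this]
  rfl

theorem HasVelocity.hasDerivAt_mul_left {a : ℝ → G} {v : E} (ha : HasVelocity E a v) {g : G}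
    (hg : g ∈ (idChart E G).source) :
    HasDerivAt (fun s => chartMap (idChart E G) (g * a s))
      (leftInvariantField E G v (chartMap (idChart E G) g)) 0 := by
  have hav := ha.deriv
  obtain ⟨J, hJ, h0, has, ha0, -⟩ := ha
  rw [leftInvariantField_eq hg]
  have := hasDerivAt_chartMap_comp (idChart_mem_atlas E G) (idChart_mem_atlas E G) isOpen_univ
    (isSmoothMapOn_mul_left g) hJ has h0 (by rw [ha0]; exact one_mem_source E G) trivial
    (by rwa [ha0, mul_one])
  rwa [hav, ha0] at this

theorem leftInvariantField_neg {g : G} (hg : g ∈ (idChart E G).source) (X : E) :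
    leftInvariantField E G (-X) (chartMap (idChart E G) g) =
      -leftInvariantField E G X (chartMap (idChart E G) g) := by
  have hT := isSmoothMapOn_mul_left (E := E) g
  rw [leftInvariantField_eq hg, leftInvariantField_eq hg]
  have := (eSmoothOn_localRep (idChart_mem_atlas E G) (idChart_mem_atlas E G) hT).dirDeriv_lin
    (isCInfOpen_localDom (idChart_mem_atlas E G) isOpen_univ hT)
    (chartMap_mem_localDom (one_mem_source E G) trivial (by simpa using hg)) (-1) 0 X 0
  simpa [origin] using this

theorem eSmoothOn_leftInvariantField (X : E) :
    ESmoothOn (leftInvariantField E G X) (chartRange (idChart E G)) := by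
  intro c hc hcO
  rw [← weakSmoothOn_univ_iff]
  have hx : WeakSmoothOn (fun p : ℝ × ℝ => origin E G + p.2 • X) Set.univ :=
    (weakSmoothOn_const _ _).add ((weakSmoothOn_const X _).smul contDiff_snd.contDiffOn)
  have hΩ := hx.isOpen_inter_preimage isOpen_univ (isCInfOpen_chartRange (e := idChart E G))
  have hP := ((hc.chartInv (idChart_mem_atlas E G) hcO).gSmoothOn.comp
    (φ := fun p : ℝ × ℝ => p.1) contDiff_fst.contDiffOn
    (W' := Set.univ ∩ (fun p : ℝ × ℝ => origin E G + p.2 • X) ⁻¹' chartRange (idChart E G))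
    fun _ _ => trivial).mul
    ((hx.mono Set.inter_subset_left).gSmoothOn (idChart_mem_atlas E G) fun p hp => hp.2)
  have hΩ' := hP.isOpen_inter_preimage hΩ (idChart E G).open_source
  have hQ := ((hP.mono Set.inter_subset_left).weakSmoothOn_chartMap hΩ' (idChart_mem_atlas E G)
    fun p hp => hp.2).dirDeriv hΩ' (0, 1)
  refine (hQ.comp (φ := fun p : ℝ => (p, (0 : ℝ)))
    (contDiff_id.prodMk contDiff_const).contDiffOn (W' := Set.univ)
    fun p hp => ⟨⟨trivial, ?_⟩, ?_⟩).congr fun p _ => ?_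
  · simpa using origin_mem E G
  · simpa [chartInv_origin] using chartInv_mem (hcO p)
  · simp only [dirDeriv, Prod.fst_add, Prod.smul_fst, Prod.snd_add,
      Prod.smul_snd, smul_eq_mul, mul_one, mul_zero, add_zero, zero_add]
    rfl

theorem leftInvariantField_origin (X : E) : leftInvariantField E G X (origin E G) = X := by
  have h1 := (hasVelocity_line G X).hasDerivAt_mul_left (one_mem_source E G)
  simp only [one_mul] at h1
  exact (deriv_eq_of_hasDerivAt h1).symm.trans (hasVelocity_line G X).deriv

theorem lieBracket_eq (X Y : E) :
    lieBracket E G X Y = dirDeriv (leftInvariantField E G Y) (origin E G) X -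
      dirDeriv (leftInvariantField E G X) (origin E G) Y := by
  have h : ∀ X : E, leftInvariantField E G X (coord E (1 : G) 1) = X := leftInvariantField_origin
  simp only [lieBracket, h]
  rfl

theorem lieBracket_neg_symm (X Y : E) : lieBracket E G X Y = -lieBracket E G Y X := by
  rw [lieBracket_eq, lieBracket_eq, neg_sub]

omit [FiniteDimensional ℝ V] in
/-- Mixed directional derivatives commute. -/
theorem WeakSmoothOn.dirDeriv_comm {Q : V → E} {W : Set V} (hQ : WeakSmoothOn Q W) (hW : IsOpen W)
    {p : V} (hp : p ∈ W) (v w : V) :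
    ConvenientLie.dirDeriv (fun q => ConvenientLie.dirDeriv Q q v) p w =
      ConvenientLie.dirDeriv (fun q => ConvenientLie.dirDeriv Q q w) p v := by
  have key : ∀ (l : E →L[ℝ] ℝ) (v w : V),
      l (ConvenientLie.dirDeriv (fun q => ConvenientLie.dirDeriv Q q v) p w) =
        fderiv ℝ (fderiv ℝ fun q => l (Q q)) p w v := by
    intro l v w
    rw [(hQ.dirDeriv hW v).map_dirDeriv hW hp]
    have h1 : (fun q => l (ConvenientLie.dirDeriv Q q v)) =ᶠ[𝓝 p]
        fun q => fderiv ℝ (fun q => l (Q q)) q v := by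
      filter_upwards [hW.mem_nhds hp] with q hq using hQ.map_dirDeriv hW hq v l
    rw [h1.fderiv_eq]
    have h2 : DifferentiableAt ℝ (fderiv ℝ fun q => l (Q q)) p :=
      (((hQ l).fderiv_of_isOpen (m := ∞) hW (by simp)).differentiableOn (by simp)).differentiableAt
        (hW.mem_nhds hp)
    rw [fderiv_clm_apply h2 (differentiableAt_const v)]
    simp
  refine ext_dual fun l => ?_
  rw [key, key]
  have hs : IsSymmSndFDerivAt ℝ (fun q => l (Q q)) p :=
    ((hQ l).contDiffAt (hW.mem_nhds hp)).isSymmSndFDerivAt (by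
      simp only [minSmoothness_of_isRCLikeNormedField]
      exact WithTop.coe_le_coe.2 (le_top : (2 : ℕ∞) ≤ ⊤))
  exact hs w v

/-- The derivative of the adjoint action along a curve through the identity is the Lie bracket. The
two terms of the bracket come from the two occurrences of `a` in the plot
`(s, r, q) ↦ a s * exp r * (a q)⁻¹`. -/
theorem HasVelocity.hasDerivAt_Ad {a : ℝ → G} {Y : E} (ha : HasVelocity E a Y) (Z : E) :
    HasDerivAt (fun s => Ad E (a s) Z) (lieBracket E G Y Z) 0 := by
  have ha' := ha
  obtain ⟨J, hJ, h0, has, ha0, haY⟩ := ha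
  set z : ℝ → G := fun r => chartInv (idChart E G) (origin E G + r • Z) with hz
  obtain ⟨K, hK, h0K, hzs, hz0, -⟩ := hasVelocity_line G Z
  rw [← hz] at hzs
  have hz0' : z 0 = 1 := hz0
  have hD : IsOpen (J ×ˢ K ×ˢ J) := hJ.prod (hK.prod hJ)
  have hP : GSmoothOn E (fun p : ℝ × ℝ × ℝ => a p.1 * z p.2.1 * (a p.2.2)⁻¹) (J ×ˢ K ×ˢ J) :=
    ((has.comp contDiff_fst.contDiffOn fun p hp => hp.1).mul
      (hzs.comp (contDiff_fst.comp contDiff_snd).contDiffOn fun p hp => hp.2.1)).mul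
      (has.comp (contDiff_snd.comp contDiff_snd).contDiffOn fun p hp => hp.2.2).inv
  have hΩ := hP.isOpen_inter_preimage hD (idChart E G).open_source
  set H : ℝ × ℝ × ℝ → E :=
    fun p => chartMap (idChart E G) (a p.1 * z p.2.1 * (a p.2.2)⁻¹) with hH
  set Ω := J ×ˢ K ×ˢ J ∩ (fun p : ℝ × ℝ × ℝ => a p.1 * z p.2.1 * (a p.2.2)⁻¹) ⁻¹'
    (idChart E G).source with hΩdef
  have hHs : WeakSmoothOn H Ω := (hP.mono Set.inter_subset_left).weakSmoothOn_chartMap hΩ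
    (idChart_mem_atlas E G) fun p hp => hp.2
  have hmem : ∀ s ∈ J, ((s, 0, s) : ℝ × ℝ × ℝ) ∈ Ω := fun s hs =>
    ⟨⟨hs, h0K, hs⟩, by simp [hz0']⟩
  have h000 : (0 : ℝ × ℝ × ℝ) ∈ Ω := hmem 0 h0
  have hR := hHs.dirDeriv hΩ (0, 1, 0)
  set R : ℝ × ℝ × ℝ → E := fun p => dirDeriv H p (0, 1, 0) with hRdef
  have hAd : ∀ s, Ad E (a s) Z = R (s, 0, s) := by
    intro s
    simp only [hRdef, dirDeriv, hH, hz]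
    simp only [Prod.fst_add, Prod.snd_add, Prod.smul_fst, Prod.smul_snd,
      smul_eq_mul, mul_one, mul_zero, add_zero, zero_add]
    rfl
  simp only [hAd]
  have hφ : HasDerivAt (fun s : ℝ => ((s, 0, s) : ℝ × ℝ × ℝ)) (1, 0, 1) 0 :=
    (hasDerivAt_id 0).prodMk ((hasDerivAt_const 0 0).prodMk (hasDerivAt_id 0))
  have hmain := hR.hasDerivAt_comp hΩ hJ
    (contDiff_id.prodMk (contDiff_const.prodMk contDiff_id)).contDiffOn hmem h0 hφ
  convert! hmain using 1
  have hlin := hR.dirDeriv_lin hΩ h000 1 1 (1, 0, 0) (0, 0, 1)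
  simp only [one_smul, Prod.mk_add_mk, add_zero, zero_add] at hlin
  change _ = dirDeriv R 0 (1, 0, 1)
  rw [hlin, lieBracket_eq, sub_eq_add_neg]
  have hJ' := has.isOpen_inter_preimage hJ (idChart E G).open_source
  have h0J' : (0 : ℝ) ∈ J ∩ a ⁻¹' (idChart E G).source :=
    ⟨h0, by rw [Set.mem_preimage, ha0]; exact one_mem_source E G⟩
  congr 1
  · -- The derivative in the direction of `s`.
    have h1 : ∀ s ∈ J ∩ a ⁻¹' (idChart E G).source,
        R (s, 0, 0) = leftInvariantField E G Z (chartMap (idChart E G) (a s)) := by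
      intro s hs
      have h2 := (hasVelocity_line G Z).hasDerivAt_mul_left hs.2
      rw [← deriv_eq_of_hasDerivAt h2]
      simp [hRdef, dirDeriv, hH, hz, ha0]
    have h3 := (eSmoothOn_leftInvariantField (G := G) Z).hasDerivAt_comp isCInfOpen_chartRange hJ'
      ((has.mono Set.inter_subset_left).weakSmoothOn_chartMap hJ' (idChart_mem_atlas E G)
        fun p hp => hp.2) h0J' (by rw [ha0]; exact origin_mem E G)
    rw [ha0, deriv_eq_of_hasDerivAt haY] at h3
    refine (deriv_eq_of_hasDerivAt (hasDerivAt_congr h3 ?_)).symm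
    filter_upwards [hJ'.mem_nhds h0J'] with s hs
    rw [← h1 s hs]
    simp
  · -- The derivative in the direction of `q`, where the two derivatives are exchanged first.
    rw [hRdef, hHs.dirDeriv_comm hΩ h000]
    have hline := weakSmoothOn_line (origin E G) Z Set.univ
    have hK' := hline.isOpen_inter_preimage isOpen_univ (isCInfOpen_chartRange (e := idChart E G))
    have h0K' : (0 : ℝ) ∈ Set.univ ∩ (fun s : ℝ => origin E G + s • Z) ⁻¹'
        chartRange (idChart E G) := ⟨trivial, by simpa using origin_mem E G⟩
    have h1 : ∀ r ∈ Set.univ ∩ (fun s : ℝ => origin E G + s • Z) ⁻¹' chartRange (idChart E G),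
        dirDeriv H (0, r, 0) (0, 0, 1) = -leftInvariantField E G Y (origin E G + r • Z) := by
      intro r hr
      have hzr : z r ∈ (idChart E G).source := chartInv_mem hr.2
      have hzr' : chartMap (idChart E G) (z r) = origin E G + r • Z := chartMap_chartInv hr.2
      have h2 := ha'.inv.hasDerivAt_mul_left hzr
      rw [leftInvariantField_neg hzr, hzr'] at h2
      rw [← deriv_eq_of_hasDerivAt h2]
      simp [dirDeriv, hH, ha0]
    have h3 := (eSmoothOn_leftInvariantField (G := G) Y).hasDerivAt_comp isCInfOpen_chartRange hK'
      (hline.mono Set.inter_subset_left) h0K' (by simpa using origin_mem E G)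
    rw [deriv_eq_of_hasDerivAt (hasDerivAt_line (origin E G) Z)] at h3
    simp only [zero_smul, add_zero] at h3
    have h4 := hasDerivAt_smul (-1) h3
    simp only [neg_one_smul] at h4
    refine (deriv_eq_of_hasDerivAt (hasDerivAt_congr h4 ?_)).symm
    filter_upwards [hK'.mem_nhds h0K'] with r hr
    rw [Pi.neg_apply, ← h1 r hr]
    simp

end Lie

/-! ### Integrals of smooth curves -/

section Integral

/-- Riemann sums over `2 ^ n` intervals converge exponentially fast, as Mackey completeness
requires. -/
theorem riemann_sum_bound {g : ℝ → ℝ} (hg : ContDiff ℝ ∞ g) :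
    ∃ C, ∀ n : ℕ, |(1 / 2 : ℝ) ^ n * ∑ k ∈ Finset.range (2 ^ n), g (k * (1 / 2) ^ n) -
      ∫ t in (0 : ℝ)..1, g t| ≤ C * (1 / 2) ^ n := by
  have hg' : Continuous (deriv g) := hg.continuous_deriv (by simp)
  obtain ⟨L, hL⟩ := (isCompact_Icc (a := (0 : ℝ)) (b := 1)).exists_bound_of_continuousOn
    hg'.continuousOn
  have hL0 : 0 ≤ L := (norm_nonneg _).trans (hL 0 ⟨le_rfl, zero_le_one⟩)
  set Φ : ℝ → ℝ := fun t => ∫ u in (0 : ℝ)..t, g u with hΦ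
  have hΦ' : ∀ t, HasDerivAt Φ (g t) t := fun t =>
    intervalIntegral.integral_hasDerivAt_right (hg.continuous.intervalIntegrable _ _)
      hg.continuous.aestronglyMeasurable.stronglyMeasurableAtFilter hg.continuous.continuousAt
  have step : ∀ x ∈ Set.Icc (0 : ℝ) 1, ∀ y ∈ Set.Icc (0 : ℝ) 1,
      |Φ y - Φ x - (y - x) * g x| ≤ L * |y - x| * |y - x| := by
    intro x hx y hy
    have hsub : Set.uIcc x y ⊆ Set.Icc 0 1 := Set.uIcc_subset_Icc hx hy
    have h1 : ∀ s ∈ Set.uIcc x y, |g s - g x| ≤ L * |y - x| := by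
      intro s hs
      have := (convex_uIcc x y).norm_image_sub_le_of_norm_deriv_le
        (fun u _ => hg.differentiable (by simp) u) (fun u hu => hL u (hsub hu))
        Set.left_mem_uIcc hs
      refine this.trans ?_
      gcongr
      simpa [Real.norm_eq_abs, abs_sub_comm] using Set.abs_sub_left_of_mem_uIcc hs
    have h2 := (convex_uIcc x y).norm_image_sub_le_of_norm_hasDerivWithin_le
      (f := fun s => Φ s - s * g x) (f' := fun s => g s - 1 * g x) (C := L * |y - x|)
      (fun u _ => ((hΦ' u).sub ((hasDerivAt_id u).mul_const _)).hasDerivWithinAt)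
      (fun u hu => by simpa using h1 u hu) Set.left_mem_uIcc Set.right_mem_uIcc
    rw [Real.norm_eq_abs, Real.norm_eq_abs] at h2
    calc |Φ y - Φ x - (y - x) * g x| = |Φ y - y * g x - (Φ x - x * g x)| := by congr 1; ring
      _ ≤ _ := h2
  refine ⟨L, fun n => ?_⟩
  set h : ℝ := (1 / 2) ^ n with hh
  have hpos : 0 < h := by positivity
  have hN : ((2 ^ n : ℕ) : ℝ) * h = 1 := by
    rw [hh]; push_cast; rw [← mul_pow]; norm_num
  have hmem : ∀ k : ℕ, k ≤ 2 ^ n → (k : ℝ) * h ∈ Set.Icc (0 : ℝ) 1 := by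
    intro k hk
    refine ⟨by positivity, ?_⟩
    rw [← hN]
    gcongr
  have htel : ∫ t in (0 : ℝ)..1, g t =
      ∑ k ∈ Finset.range (2 ^ n), (Φ ((k + 1 : ℕ) * h) - Φ (k * h)) := by
    rw [Finset.sum_range_sub (fun k : ℕ => Φ (k * h)), hN]
    simp [hΦ]
  rw [htel, Finset.mul_sum, ← Finset.sum_sub_distrib]
  calc _ ≤ ∑ k ∈ Finset.range (2 ^ n), L * h * h := by
        refine (Finset.abs_sum_le_sum_abs _ _).trans (Finset.sum_le_sum fun k hk => ?_)
        have hk' : k + 1 ≤ 2 ^ n := Finset.mem_range.1 hk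
        have h1 := step _ (hmem k (by omega)) _ (hmem (k + 1) hk')
        have h2 : ((k + 1 : ℕ) : ℝ) * h - k * h = h := by push_cast; ring
        rw [h2, abs_of_pos hpos] at h1
        rwa [abs_sub_comm]
    _ = L * h * (((2 ^ n : ℕ) : ℝ) * h) := by
        rw [Finset.sum_const, Finset.card_range, nsmul_eq_mul]
        ring
    _ = L * h := by rw [hN, mul_one]

variable {E : Type*} [AddCommGroup E] [Module ℝ E] [TopologicalSpace E] [ConvenientSpace E]

/-- Smooth curves have integrals, and bounded linear functionals commute with them. -/
theorem IsSmoothCurve.exists_integral {c : ℝ → E} (hc : IsSmoothCurve c) :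
    ∃ I : E, ∀ f : E →ₗ[ℝ] ℝ,
      (∀ B : Set E, Bornology.IsVonNBounded ℝ B → ∃ C, ∀ x ∈ B, |f x| ≤ C) →
      (ContDiff ℝ ∞ fun t => f (c t)) → f I = ∫ t in (0 : ℝ)..1, f (c t) := by
  set R : ℕ → E := fun n => (1 / 2 : ℝ) ^ n • ∑ k ∈ Finset.range (2 ^ n), c (k * (1 / 2) ^ n)
    with hR
  have hbd : ∀ l : E →L[ℝ] ℝ, ∃ C, ∀ n, |l (R n) - ∫ t in (0 : ℝ)..1, l (c t)| ≤
      C * (1 / 2) ^ n := by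
    intro l
    obtain ⟨C, hC⟩ := riemann_sum_bound (isSmoothCurve_iff.1 hc l)
    refine ⟨C, fun n => ?_⟩
    simpa only [hR, map_smul, map_sum, smul_eq_mul] using hC n
  obtain ⟨I, hI⟩ := detectsBounded_univ.exists_tendsto fun l _ => ⟨_, hbd l⟩
  have hlI : ∀ l : E →L[ℝ] ℝ, l I = ∫ t in (0 : ℝ)..1, l (c t) := by
    intro l
    obtain ⟨C, hC⟩ := hbd l
    refine tendsto_nhds_unique ((l.continuous.tendsto I).comp hI) ?_
    rw [tendsto_iff_norm_sub_tendsto_zero]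
    have h0 : Tendsto (fun n : ℕ => C * (1 / 2 : ℝ) ^ n) atTop (𝓝 0) := by
      simpa using tendsto_half_pow.const_mul C
    exact squeeze_zero (fun _ => norm_nonneg _) hC h0
  have hB : Bornology.IsVonNBounded ℝ (Set.range fun n : ℕ => (2 : ℝ) ^ n • (R n - I)) := by
    refine detectsBounded_univ _ fun l _ => ?_
    obtain ⟨C, hC⟩ := hbd l
    refine ⟨C, ?_⟩
    rintro _ ⟨n, rfl⟩
    simp only [map_smul, map_sub, smul_eq_mul, abs_mul, abs_pow, Nat.abs_ofNat, hlI]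
    calc (2 : ℝ) ^ n * _ ≤ 2 ^ n * (C * (1 / 2) ^ n) := by gcongr; exact hC n
      _ = C * (2 * (1 / 2)) ^ n := by rw [mul_pow]; ring
      _ = C := by norm_num
  refine ⟨I, fun f hf hfc => ?_⟩
  obtain ⟨C, hC⟩ := riemann_sum_bound hfc
  obtain ⟨D, hD⟩ := hf _ hB
  have h1 : ∀ n : ℕ, |f (R n) - f I| ≤ D * (1 / 2) ^ n := by
    intro n
    have := hD _ ⟨n, rfl⟩
    simp only [map_smul, map_sub, smul_eq_mul, abs_mul, abs_pow, Nat.abs_ofNat] at this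
    rw [one_div, inv_pow, ← div_eq_mul_inv, le_div_iff₀ (by positivity)]
    linarith
  have h2 : ∀ n : ℕ, |f I - ∫ t in (0 : ℝ)..1, f (c t)| ≤ (C + D) * (1 / 2) ^ n := by
    intro n
    have h3 := hC n
    have h4 := h1 n
    have h5 : f (R n) = (1 / 2 : ℝ) ^ n * ∑ k ∈ Finset.range (2 ^ n), f (c (k * (1 / 2) ^ n)) := by
      simp only [hR, map_smul, map_sum, smul_eq_mul]
    rw [← h5] at h3
    calc |f I - ∫ t in (0 : ℝ)..1, f (c t)|
        = |(f (R n) - ∫ t in (0 : ℝ)..1, f (c t)) - (f (R n) - f I)| := by congr 1; ring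
      _ ≤ _ := abs_sub _ _
      _ ≤ _ := by linarith
  have h3 : Tendsto (fun n : ℕ => (C + D) * (1 / 2 : ℝ) ^ n) atTop (𝓝 0) := by
    simpa using tendsto_half_pow.const_mul (C + D)
  have h4 := ge_of_tendsto' h3 h2
  exact sub_eq_zero.1 (abs_eq_zero.1 (le_antisymm h4 (abs_nonneg _)))

omit [ConvenientSpace E] in
theorem IsBoundedLinear.comp {s s' : E →ₗ[ℝ] E} (hs : IsBoundedLinear s)
    (hs' : IsBoundedLinear s') : IsBoundedLinear (s.comp s') := by
  intro B hB
  have := hs _ (hs' B hB)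
  rwa [Set.image_image] at this

omit [ConvenientSpace E] in
theorem IsBoundedLinear.functional {s : E →ₗ[ℝ] E} (hs : IsBoundedLinear s) (l : E →L[ℝ] ℝ) :
    ∀ B : Set E, Bornology.IsVonNBounded ℝ B → ∃ C, ∀ x ∈ B, |l (s x)| ≤ C := by
  intro B hB
  obtain ⟨C, hC⟩ := exists_bound_of_isVonNBounded l (hs B hB)
  exact ⟨C, fun x hx => hC _ ⟨x, hx, rfl⟩⟩

end Integral

/-! ### The inequality between the numbers of the Lie algebra and of the adjoint action -/

section AdInequality

variable {E : Type*} [AddCommGroup E] [Module ℝ E] [TopologicalSpace E] [ConvenientSpace E]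
variable {G : Type*} [TopologicalSpace G] [ChartedSpace (CInf E) G] [Group G]
variable [ConvenientLieGroup E G]

variable (G) in
/-- The map `Z ↦ [Y, Z]`. -/
noncomputable def adBracket (Y : E) : E →ₗ[ℝ] E where
  toFun := lieBracket E G Y
  map_add' Z Z' := by
    have h := (hasVelocity_line G Y).hasDerivAt_Ad (Z + Z')
    have h1 := (hasVelocity_line G Y).hasDerivAt_Ad Z
    have h2 := (hasVelocity_line G Y).hasDerivAt_Ad Z'
    rw [← deriv_eq_of_hasDerivAt h, ← deriv_eq_of_hasDerivAt (hasDerivAt_add h1 h2)]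
    congr 1
    funext s
    exact map_add (AdLinear _) Z Z'
  map_smul' a Z := by
    have h := (hasVelocity_line G Y).hasDerivAt_Ad (a • Z)
    have h1 := (hasVelocity_line G Y).hasDerivAt_Ad Z
    rw [← deriv_eq_of_hasDerivAt h, RingHom.id_apply,
      ← deriv_eq_of_hasDerivAt (hasDerivAt_smul a h1)]
    congr 1
    funext s
    exact map_smul (AdLinear _) a Z

@[simp]
theorem adBracket_apply (Y Z : E) : adBracket G Y Z = lieBracket E G Y Z := rfl

theorem weakSmoothOn_lieBracket (Y : E) {y : ℝ → E} (hy : IsSmoothCurve y) :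
    WeakSmoothOn (fun t => lieBracket E G Y (y t)) Set.univ := by
  obtain ⟨J, hJ, h0, ha, ha0, -⟩ := hasVelocity_line G Y
  have hW : IsOpen (Prod.snd ⁻¹' J : Set (ℝ × ℝ)) := hJ.preimage continuous_snd
  have hQ := weakSmoothOn_Ad hW (ha.comp (φ := fun p : ℝ × ℝ => p.2) contDiff_snd.contDiffOn
    fun p hp => hp) ((weakSmoothOn_univ_iff.2 hy).comp (φ := fun p : ℝ × ℝ => p.1)
    contDiff_fst.contDiffOn fun _ _ => trivial)
  refine ((hQ.dirDeriv hW (0, 1)).comp (φ := fun t : ℝ => (t, (0 : ℝ)))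
    (contDiff_id.prodMk contDiff_const).contDiffOn (W' := Set.univ)
    fun p _ => h0).congr fun t _ => ?_
  rw [← deriv_eq_of_hasDerivAt ((hasVelocity_line G Y).hasDerivAt_Ad (y t))]
  simp [dirDeriv]

theorem isBoundedLinear_adBracket (Y : E) : IsBoundedLinear (adBracket G Y) :=
  isBoundedLinear_of_smooth _ fun _ hy => ⟨Set.univ, isOpen_univ, trivial,
    weakSmoothOn_lieBracket Y hy⟩

section AdIntegral

variable {a : ℝ → G}

theorem isSmoothCurve_Ad (ha : IsSmoothCurveIn E a) (X : E) :
    IsSmoothCurve fun t => Ad E (a t) X :=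
  weakSmoothOn_univ_iff.1 (weakSmoothOn_Ad isOpen_univ ha.gSmoothOn (weakSmoothOn_const X _))

/-- The integral of `Ad (a t) X` over `t ∈ [0, 1]`, as a linear map of `X`. -/
noncomputable def adIntegral (ha : IsSmoothCurveIn E a) : E →ₗ[ℝ] E :=
  have key : ∀ (X : E) (l : E →L[ℝ] ℝ), l (isSmoothCurve_Ad ha X).exists_integral.choose =
      ∫ t in (0 : ℝ)..1, l (Ad E (a t) X) := fun X l =>
    (isSmoothCurve_Ad ha X).exists_integral.choose_spec l
      (fun _ hB => exists_bound_of_isVonNBounded l hB)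
      (isSmoothCurve_iff.1 (isSmoothCurve_Ad ha X) l)
  have hint : ∀ (X : E) (l : E →L[ℝ] ℝ),
      IntervalIntegrable (fun t => l (Ad E (a t) X)) MeasureTheory.volume 0 1 := fun X l =>
    (isSmoothCurve_iff.1 (isSmoothCurve_Ad ha X) l).continuous.intervalIntegrable _ _
  { toFun := fun X => (isSmoothCurve_Ad ha X).exists_integral.choose
    map_add' := fun X Y => ext_dual fun l => by
      rw [map_add, key, key, key, ← intervalIntegral.integral_add (hint X l) (hint Y l)]
      refine intervalIntegral.integral_congr fun t _ => ?_
      simp only [← map_add]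
      congr 1
      exact map_add (AdLinear (a t)) X Y
    map_smul' := fun r X => ext_dual fun l => by
      rw [RingHom.id_apply, map_smul, key, key, smul_eq_mul,
        ← intervalIntegral.integral_const_mul]
      refine intervalIntegral.integral_congr fun t _ => ?_
      simp only [← smul_eq_mul, ← map_smul]
      congr 1
      exact map_smul (AdLinear (a t)) r X }

theorem map_adIntegral (ha : IsSmoothCurveIn E a) (X : E) (f : E →ₗ[ℝ] ℝ)
    (hf : ∀ B : Set E, Bornology.IsVonNBounded ℝ B → ∃ C, ∀ x ∈ B, |f x| ≤ C)
    (hfc : ContDiff ℝ ∞ fun t => f (Ad E (a t) X)) :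
    f (adIntegral ha X) = ∫ t in (0 : ℝ)..1, f (Ad E (a t) X) :=
  (isSmoothCurve_Ad ha X).exists_integral.choose_spec f hf hfc

theorem clm_adIntegral (ha : IsSmoothCurveIn E a) (X : E) (l : E →L[ℝ] ℝ) :
    l (adIntegral ha X) = ∫ t in (0 : ℝ)..1, l (Ad E (a t) X) :=
  map_adIntegral ha X l (fun _ hB => exists_bound_of_isVonNBounded l hB)
    (isSmoothCurve_iff.1 (isSmoothCurve_Ad ha X) l)

theorem isBoundedLinear_adIntegral (ha : IsSmoothCurveIn E a) :
    IsBoundedLinear (adIntegral ha) := by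
  refine isBoundedLinear_of_curves _ fun y hy _ l => ?_
  have hs : WeakSmoothOn (fun p : ℝ × ℝ => Ad E (a p.2) (y p.1)) Set.univ :=
    weakSmoothOn_Ad isOpen_univ (ha.gSmoothOn.comp (φ := fun p : ℝ × ℝ => p.2)
      contDiff_snd.contDiffOn fun _ _ => trivial)
      ((weakSmoothOn_univ_iff.2 hy).comp (φ := fun p : ℝ × ℝ => p.1)
        contDiff_fst.contDiffOn fun _ _ => trivial)
  have hc : Continuous fun p : ℝ × ℝ => l (Ad E (a p.2) (y p.1)) :=
    (contDiffOn_univ.1 (hs l)).continuous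
  have hcont : Continuous fun t => l (adIntegral ha (y t)) := by
    simp only [clm_adIntegral]
    exact intervalIntegral.continuous_parametric_intervalIntegral_of_continuous'
      (f := fun t u => l (Ad E (a u) (y t))) hc 0 1
  refine ⟨|l (adIntegral ha (y 0))| + 1, ?_⟩
  filter_upwards [hcont.continuousAt.abs.eventually (gt_mem_nhds (lt_add_one _))] with t ht
    using ht.le

end AdIntegral

/-- Along a one-parameter subgroup the adjoint action solves
`d / dt Ad (a t) X = [Y, Ad (a t) X]`. -/
theorem hasDerivAt_Ad_oneParameter {a : ℝ → G} {Y : E} (ha : IsSmoothCurveIn E a) (ha0 : a 0 = 1)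
    (hadd : ∀ s t, a (s + t) = a s * a t)
    (hY : deriv (fun s : ℝ => coord E (1 : G) (a s)) 0 = Y) (X : E) (t : ℝ) :
    HasDerivAt (fun t => Ad E (a t) X) (lieBracket E G Y (Ad E (a t) X)) t := by
  have hv : HasVelocity E a Y := by
    rw [← hY]
    exact hasVelocity_of_gSmoothOn isOpen_univ trivial ha.gSmoothOn ha0
  have h1 := hv.hasDerivAt_Ad (Ad E (a t) X)
  refine (weakSmoothOn_univ_iff.2 (isSmoothCurve_Ad ha X)).hasDerivAt_of_dual isOpen_univ trivial
    fun l => ?_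
  have h2 := HasDerivAt.clm_apply' h1 l
  have h3 : HasDerivAt (fun u : ℝ => u - t) 1 t := (hasDerivAt_id t).sub_const t
  have h4 : HasDerivAt (fun s => l (Ad E (a s) (Ad E (a t) X)))
      (l (lieBracket E G Y (Ad E (a t) X))) (t - t) := by rwa [sub_self]
  have h5 := HasDerivAt.comp (h := fun u : ℝ => u - t) t h4 h3
  rw [mul_one] at h5
  refine h5.congr_of_eventuallyEq (Eventually.of_forall fun u => ?_)
  simp only [Function.comp_apply]
  rw [← Ad_mul, ← hadd, sub_add_cancel]

/-- The bracket with `Y` inverts integration along the one-parameter subgroup of `Y`. -/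
theorem lieBracket_adIntegral {a : ℝ → G} {Y : E} (ha : IsSmoothCurveIn E a) (ha0 : a 0 = 1)
    (hadd : ∀ s t, a (s + t) = a s * a t)
    (hY : deriv (fun s : ℝ => coord E (1 : G) (a s)) 0 = Y) (X : E) :
    lieBracket E G (adIntegral ha X) Y = X - Ad E (a 1) X := by
  rw [lieBracket_neg_symm, neg_eq_iff_eq_neg, neg_sub]
  refine ext_dual fun l => ?_
  have hsm := isSmoothCurve_Ad ha X
  have hl := isSmoothCurve_iff.1 hsm l
  have hbr := contDiffOn_univ.1 (weakSmoothOn_lieBracket (G := G) Y hsm l)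
  have h1 := map_adIntegral ha X ((l : E →ₗ[ℝ] ℝ).comp (adBracket G Y))
    ((isBoundedLinear_adBracket Y).functional l) hbr
  simp only [LinearMap.comp_apply, adBracket_apply, ContinuousLinearMap.coe_coe] at h1
  rw [h1, intervalIntegral.integral_eq_sub_of_hasDerivAt (f := fun t => l (Ad E (a t) X))
    (fun t _ => HasDerivAt.clm_apply' (hasDerivAt_Ad_oneParameter ha ha0 hadd hY X t) l)
    (hbr.continuous.intervalIntegrable _ _), ha0, Ad_one, map_sub]

variable (E G) in
/-- If the maps `s i` solve the equation for the adjoint action of `exp (Y i)`, then `∫ Ad ∘ s i`,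
the integral being taken along the one-parameter subgroup of `Y i`, solves the one for the
bracket. -/
theorem lieAlgebraNumber_le_adNumber :
    lieAlgebraNumber (lieBracket E G) ≤ adNumber E G := by
  refine sInf_le_sInf ?_
  rintro _ ⟨N, rfl, hN⟩
  refine ⟨N, rfl, ?_⟩
  obtain ⟨Y, h, hYh, s, hs, hsum⟩ := hN Set.univ isOpen_univ trivial
  choose a ha ha0 hadd haY hah using fun i => (hYh i).1
  refine ⟨Y, fun i => (adIntegral (ha i)).comp (s i),
    fun i => (isBoundedLinear_adIntegral (ha i)).comp (hs i), fun X => ?_⟩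
  refine Eq.trans (Finset.sum_congr rfl fun i _ => ?_) (hsum X)
  rw [LinearMap.comp_apply, lieBracket_adIntegral (ha i) (ha0 i) (hadd i) (haY i), hah i]

/-! ### The inequality between the numbers of the adjoint action and of the group -/

/-- The velocity of a commutator with a fixed element. -/
theorem HasVelocity.commutator {a : ℝ → G} {v : E} (ha : HasVelocity E a v) (h : G) :
    HasVelocity E (fun s => a s * h * (a s)⁻¹ * h⁻¹) (v - Ad E h v) := by
  have h1 := ha.mul (ha.inv.conj h)
  have h2 : Ad E h (-v) = -Ad E h v := map_neg (AdLinear h) v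
  rw [h2, ← sub_eq_add_neg] at h1
  convert! h1 using 2
  group

theorem hasVelocity_prod_ofFn {N : ℕ} {a : Fin N → ℝ → G} {v : Fin N → E}
    (ha : ∀ i, HasVelocity E (a i) (v i)) :
    HasVelocity E (fun s => (List.ofFn fun i => a i s).prod) (∑ i, v i) := by
  induction N with
  | zero => simpa using hasVelocity_one (E := E) (G := G)
  | succ N ih =>
    simp only [List.ofFn_succ, List.prod_cons, Fin.sum_univ_succ]
    exact (ha 0).mul (ih fun i => ha i.succ)

variable (E G) in
/-- The derivatives at the identity of the maps `S i` solve the linearized equation. -/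
theorem adNumber_le_groupNumber : adNumber E G ≤ groupNumber E G := by
  refine sInf_le_sInf ?_
  rintro _ ⟨N, rfl, hN⟩
  refine ⟨N, rfl, fun U hU h1U => ?_⟩
  obtain ⟨Y, h, hYh, V, hV, h1V, S, hS, hprod⟩ := hN U hU h1U
  have hO : ∀ i, IsCInfOpen (localDom (idChart E G) (idChart E G) (S i) V) := fun i =>
    isCInfOpen_localDom (idChart_mem_atlas E G) hV (hS i).1
  have hf := fun i => eSmoothOn_localRep (idChart_mem_atlas E G) (idChart_mem_atlas E G) (hS i).1
  have hmem : ∀ i, origin E G ∈ localDom (idChart E G) (idChart E G) (S i) V := fun i =>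
    chartMap_mem_localDom (one_mem_source E G) h1V (by rw [(hS i).2]; exact one_mem_source E G)
  refine ⟨Y, h, hYh, fun i => (hf i).dirDerivₗ (hO i) (hmem i),
    fun i => (hf i).isBoundedLinear_dirDerivₗ (hO i) (hmem i), fun X => ?_⟩
  have hX := hasVelocity_line G X
  have hcomm := hasVelocity_prod_ofFn fun i =>
    (hX.map hV h1V (hS i).1 (hS i).2).commutator (h i)
  obtain ⟨J, hJ, h0, hJs, hJ1, -⟩ := id hX
  have hJ' := hJs.isOpen_inter_preimage hJ hV
  refine (hcomm.congr hJ h0 hJs ?_).unique hX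
  filter_upwards [hJ'.mem_nhds ⟨h0, by simpa [chartInv_origin] using h1V⟩] with s hs
  exact (hprod _ hs.2).symm

end AdInequality

/-! ### One-parameter subgroups of regular Lie groups -/

section OneParameter

variable {E : Type*} [AddCommGroup E] [Module ℝ E] [TopologicalSpace E] [ConvenientSpace E]
variable {G : Type*} [TopologicalSpace G] [ChartedSpace (CInf E) G] [Group G]
variable [ConvenientLieGroup E G]

omit [ConvenientSpace E] in
theorem IsSmoothCurveIn.mul {a b : ℝ → G} (ha : IsSmoothCurveIn E a) (hb : IsSmoothCurveIn E b) :
    IsSmoothCurveIn E fun t => a t * b t := ConvenientLieGroup.smooth_mul a b ha hb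

omit [ConvenientSpace E] in
theorem IsSmoothCurveIn.inv {a : ℝ → G} (ha : IsSmoothCurveIn E a) :
    IsSmoothCurveIn E fun t => (a t)⁻¹ := ConvenientLieGroup.smooth_inv a ha

/-- A curve whose velocity at the time `t` is the right translate of `X` has at this time the right
logarithmic derivative `X`. Right translation by `(γ t)⁻¹`, applied to `γ` and to a translated line
with the same velocity, turns the preferred chart at `γ t` into the one at the identity. -/
theorem hasVelocity_of_velocity_eq {γ : ℝ → G} (hγ : IsSmoothCurveIn E γ) {X : E} {t : ℝ}
    (h : velocity E γ t = tangentMapAt E (fun g => g * γ t) 1 X) :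
    HasVelocity E (fun r => γ (r + t) * (γ t)⁻¹) X := by
  set e := chartAt (CInf E) (γ t) with he
  have hmem : γ t ∈ e.source := mem_chart_source _ _
  have hea : e ∈ atlas (CInf E) G := chart_mem_atlas _ _
  have hT := isSmoothMapOn_mul_right (E := E) (γ t)⁻¹
  have h1 := hasDerivAt_chartMap_comp hea (idChart_mem_atlas E G) isOpen_univ hT isOpen_univ
    hγ.gSmoothOn trivial hmem trivial (by rw [mul_inv_cancel]; exact one_mem_source E G)
  have hline := hasVelocity_line G X
  obtain ⟨J, hJ, h0, has, ha0, ha⟩ := id hline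
  have hb := has.mul (gSmoothOn_const (E := E) (γ t) J)
  have h2 := hasDerivAt_chartMap_comp hea (idChart_mem_atlas E G) isOpen_univ hT hJ
    hb h0 (by simpa [chartInv_origin] using hmem) trivial
    (by simp [chartInv_origin])
  have hX := hline.deriv
  have hv : deriv (fun s => chartMap e (γ s)) t = deriv (fun s : ℝ => chartMap e
      (chartInv (idChart E G) (origin E G + s • X) * γ t)) 0 := by
    rw [tangentMapAt, one_mul] at h
    exact h
  have hb0 : chartInv (idChart E G) (origin E G + (0 : ℝ) • X) * γ t = γ t := by
    simp [chartInv_origin]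
  rw [hb0, ← hv] at h2
  simp only [mul_inv_cancel_right] at h2
  rw [← deriv_eq_of_hasDerivAt h2, hX] at h1
  have hs : IsSmoothCurveIn E fun r => γ (r + t) * (γ t)⁻¹ :=
    (hγ.comp (contDiff_id.add contDiff_const)).mul (isSmoothCurveIn_const _)
  refine ⟨Set.univ, isOpen_univ, trivial, hs.gSmoothOn, by simp, ?_⟩
  have hs' := hs.gSmoothOn.isOpen_inter_preimage isOpen_univ (idChart E G).open_source
  refine ((hs.gSmoothOn.mono Set.inter_subset_left).weakSmoothOn_chartMap hs'
    (idChart_mem_atlas E G) fun p hp => hp.2).hasDerivAt_of_dual hs'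
    ⟨trivial, by simp⟩ fun l => ?_
  have h3 := HasDerivAt.clm_apply' h1 l
  rw [← zero_add t] at h3
  have h4 := h3.comp_add_const 0 t
  simpa using h4

omit [ConvenientLieGroup E G] in
theorem leftInvariantField_zero {g : G} (hg : g ∈ (idChart E G).source) :
    leftInvariantField E G (0 : E) (chartMap (idChart E G) g) = 0 := by
  rw [leftInvariantField_eq hg, dirDeriv]
  simp only [smul_zero, add_zero]
  refine deriv_eq_of_hasDerivAt ?_
  rw [hasDerivAt_iff_slope]
  simp

/-- A curve with vanishing left logarithmic derivative is constant. -/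
theorem eq_of_hasVelocity_zero {β : ℝ → G} (hβ : IsSmoothCurveIn E β)
    (h : ∀ s, HasVelocity E (fun r => (β s)⁻¹ * β (r + s)) (0 : E)) (s t : ℝ) : β s = β t := by
  refine IsLocallyConstant.apply_eq_of_isPreconnected
    ((IsLocallyConstant.iff_eventually_eq β).2 fun s₀ => ?_) isPreconnected_univ trivial trivial
  have hδ : IsSmoothCurveIn E fun s => (β s₀)⁻¹ * β s := (isSmoothCurveIn_const _).mul hβ
  have hJ := hδ.gSmoothOn.isOpen_inter_preimage isOpen_univ (idChart E G).open_source
  set J := Set.univ ∩ (fun s => (β s₀)⁻¹ * β s) ⁻¹' (idChart E G).source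
  have h0 : s₀ ∈ J := ⟨trivial, by simp⟩
  have hd : ∀ s ∈ J, ∀ l : E →L[ℝ] ℝ,
      HasDerivAt (fun s => l (chartMap (idChart E G) ((β s₀)⁻¹ * β s))) 0 s := by
    intro s hs l
    have h1 := (h s).hasDerivAt_mul_left hs.2
    rw [leftInvariantField_zero hs.2] at h1
    have h2 : HasDerivAt (fun r => l (chartMap (idChart E G)
        ((β s₀)⁻¹ * β s * ((β s)⁻¹ * β (r + s))))) 0 (s - s) := by
      have h2 := HasDerivAt.clm_apply' h1 l
      rw [map_zero] at h2
      rwa [sub_self]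
    have h3 := h2.comp_sub_const s s
    refine h3.congr_of_eventuallyEq (Eventually.of_forall fun r => ?_)
    simp [mul_assoc]
  obtain ⟨ε, hε, hball⟩ := Metric.isOpen_iff.1 hJ s₀ h0
  filter_upwards [Metric.ball_mem_nhds s₀ hε] with s hs
  have key : chartMap (idChart E G) ((β s₀)⁻¹ * β s) =
      chartMap (idChart E G) ((β s₀)⁻¹ * β s₀) := by
    refine ext_dual fun l => ?_
    refine Metric.isOpen_ball.is_const_of_deriv_eq_zero
      (f := fun s => l (chartMap (idChart E G) ((β s₀)⁻¹ * β s)))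
      (convex_ball s₀ ε).isPreconnected
      (fun r hr => (hd r (hball hr) l).differentiableAt.differentiableWithinAt)
      (fun r hr => (hd r (hball hr) l).deriv) hs (Metric.mem_ball_self hε)
  have h1 := chartInv_chartMap (hball hs).2
  rw [key, chartInv_chartMap h0.2] at h1
  exact (mul_left_cancel h1).symm

/-- In a regular Lie group each element of the Lie algebra generates a one-parameter subgroup: the
evolution of the constant curve. -/
theorem IsRegular.exists_oneParameter (hG : IsRegular E G) (X : E) :
    ∃ γ : ℝ → G, IsSmoothCurveIn E γ ∧ γ 0 = 1 ∧ (∀ s t, γ (s + t) = γ s * γ t) ∧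
      HasVelocity E γ X := by
  obtain ⟨evol, hev, -⟩ := hG
  obtain ⟨γ, hγ, hγ0, hvel, -⟩ := hev ⟨fun _ => X, weakSmoothOn_univ_iff.1 (weakSmoothOn_const X _)⟩
  have hlog : ∀ t, HasVelocity E (fun r => γ (r + t) * (γ t)⁻¹) X := fun t =>
    hasVelocity_of_velocity_eq hγ (hvel t)
  refine ⟨γ, hγ, hγ0, fun s t => ?_, by simpa [hγ0] using hlog 0⟩
  -- Both `s ↦ γ s * γ t` and `s ↦ γ (s + t)` have the right logarithmic derivative `X`, so that the
  -- left logarithmic derivative of the following curve vanishes.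
  have hβ : IsSmoothCurveIn E fun s => (γ s)⁻¹ * γ (s + t) :=
    hγ.inv.mul (hγ.comp (contDiff_id.add contDiff_const))
  have h := eq_of_hasVelocity_zero hβ (fun s => ?_) s 0
  · simp only [hγ0, zero_add, inv_one, one_mul] at h
    rw [← h, mul_inv_cancel_left]
  · have h1 := ((hlog s).inv.mul (hlog (s + t))).conj (γ (s + t))⁻¹
    rw [neg_add_cancel] at h1
    have h2 : Ad E (γ (s + t))⁻¹ (0 : E) = 0 := map_zero (AdLinear _)
    rw [h2] at h1
    convert! h1 using 2 with r
    simp only [mul_inv_rev, inv_inv, mul_assoc, add_assoc, inv_mul_cancel, mul_one]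

omit [ConvenientLieGroup E G] in
theorem isExp_of_oneParameter {γ : ℝ → G} {Y : E} (hγ : IsSmoothCurveIn E γ) (h0 : γ 0 = 1)
    (hadd : ∀ s t, γ (s + t) = γ s * γ t) (hY : HasVelocity E γ Y) (τ : ℝ) :
    IsExp E (τ • Y) (γ τ) := by
  refine ⟨fun s => γ (s * τ), hγ.comp (contDiff_id.mul contDiff_const), by simpa using h0,
    fun s t => by simp only [add_mul, hadd], ?_, by simp⟩
  have hs : IsSmoothCurveIn E fun s => γ (s * τ) := hγ.comp (contDiff_id.mul contDiff_const)
  have hJ := hs.gSmoothOn.isOpen_inter_preimage isOpen_univ (idChart E G).open_source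
  refine deriv_eq_of_hasDerivAt (((hs.gSmoothOn.mono Set.inter_subset_left).weakSmoothOn_chartMap hJ
    (idChart_mem_atlas E G) fun p hp => hp.2).hasDerivAt_of_dual hJ
    ⟨trivial, by simp [h0]⟩ fun l => ?_)
  obtain ⟨-, -, -, -, -, hd⟩ := hY
  have h1 := HasDerivAt.clm_apply' hd l
  rw [← zero_mul τ] at h1
  have h2 := HasDerivAt.comp (h := fun s : ℝ => s * τ) 0 h1 ((hasDerivAt_id (0 : ℝ)).mul_const τ)
  rw [map_smul, smul_eq_mul]
  simpa [Function.comp_def, mul_comm] using h2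

end OneParameter

/-! ### Smoothness in Banach spaces -/

section Banach

universe u

variable {E : Type u} [NormedAddCommGroup E] [NormedSpace ℝ E] [CompleteSpace E]
variable {F : Type u} [NormedAddCommGroup F] [NormedSpace ℝ F] [CompleteSpace F]

instance convenientSpace_of_completeSpace : ConvenientSpace E where
  exists_tendsto_of_isMackeyCauchy := by
    rintro x ⟨B, hB, μ, hμ, h⟩
    obtain ⟨C, hC⟩ := isBounded_iff_forall_norm_le.1 ((NormedSpace.isVonNBounded_iff ℝ).1 hB)
    refine cauchySeq_tendsto_of_complete (cauchySeq_iff_tendsto_dist_atTop_0.2 ?_)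
    have h0 : Tendsto (fun p : ℕ × ℕ => |μ p| * C) atTop (𝓝 0) := by
      simpa using hμ.abs.mul_const C
    refine squeeze_zero (fun _ => dist_nonneg) (fun p => ?_) h0
    obtain ⟨b, hb, hp⟩ := h p.1 p.2
    rw [dist_eq_norm, hp, norm_smul, Real.norm_eq_abs]
    exact mul_le_mul_of_nonneg_left (hC b hb) (abs_nonneg _)

omit [CompleteSpace E] in
theorem isSmoothCurve_iff_contDiff {c : ℝ → E} : IsSmoothCurve c ↔ ContDiff ℝ ∞ c := by
  constructor
  · intro h
    refine contDiff_of_differentiable_iteratedDeriv fun m _ t => ?_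
    rw [iteratedDeriv_eq_iterate]
    exact h m t trivial
  · intro h n t _
    rw [← iteratedDeriv_eq_iterate]
    exact h.differentiable_iteratedDeriv n (by exact_mod_cast WithTop.coe_lt_top n) t

theorem isCInfOpen_iff_isOpen {O : Set E} : IsCInfOpen O ↔ IsOpen O :=
  ⟨fun h => isOpen_of_forall_curve fun c hc => h c (isSmoothCurve_iff_contDiff.2 hc),
    fun h _ hc => h.preimage (isSmoothCurve_iff_contDiff.1 hc).continuous⟩

omit [CompleteSpace F] in
theorem ESmoothOn.continuousOn {f : E → F} {O : Set E} (hf : ESmoothOn f O) (hO : IsOpen O) :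
    ContinuousOn f O := by
  refine (continuousOn_open_iff hO).2 fun U hU => isOpen_of_forall_curve fun c hc =>
    isOpen_iff_mem_nhds.2 fun t ht => ?_
  obtain ⟨θ, hθ, hθJ, hθt⟩ := exists_reparametrization (hO.preimage hc.continuous) ht.1
  have hsm := isSmoothCurve_iff_contDiff.1
    (hf _ (isSmoothCurve_iff_contDiff.2 (hc.comp hθ)) hθJ)
  have h1 : ∀ᶠ s in 𝓝 t, f (c (θ s)) ∈ U := by
    refine (hU.preimage hsm.continuous).mem_nhds ?_
    rw [Set.mem_preimage, Function.comp_apply, hθt.self_of_nhds]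
    exact ht.2
  filter_upwards [h1, hθt, (hO.preimage hc.continuous).mem_nhds ht.1] with s hs hs' hs''
  rw [hs'] at hs
  exact ⟨hs'', hs⟩

/-- The uniform boundedness principle: bounded sets of operators are detected by the functionals
`T ↦ l (T v)`. -/
theorem detectsBounded_operators :
    DetectsBounded {φ : (E →L[ℝ] F) →L[ℝ] ℝ | ∃ (l : F →L[ℝ] ℝ) (v : E), ∀ T, φ T = l (T v)} := by
  intro B hB
  rw [NormedSpace.isVonNBounded_iff, isBounded_iff_forall_norm_le]
  have h1 : ∀ v : E, ∃ C, ∀ T : B, ‖(T : E →L[ℝ] F) v‖ ≤ C := by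
    intro v
    have h2 : Bornology.IsVonNBounded ℝ ((fun T : E →L[ℝ] F => T v) '' B) := by
      refine detectsBounded_univ _ fun l _ => ?_
      obtain ⟨C, hC⟩ := hB (l.comp (ContinuousLinearMap.apply ℝ F v)) ⟨l, v, fun T => rfl⟩
      refine ⟨C, ?_⟩
      rintro _ ⟨T, hT, rfl⟩
      exact hC T hT
    obtain ⟨C, hC⟩ := isBounded_iff_forall_norm_le.1 ((NormedSpace.isVonNBounded_iff ℝ).1 h2)
    exact ⟨C, fun T => hC _ ⟨T, T.2, rfl⟩⟩
  obtain ⟨C, hC⟩ := banach_steinhaus h1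
  exact ⟨C, fun T hT => hC ⟨T, hT⟩⟩

/-- A curve of operators is smooth if it is pointwise smooth. -/
theorem isSmoothCurve_operators {A : ℝ → E →L[ℝ] F}
    (h : ∀ v, IsSmoothCurve fun t => A t v) : IsSmoothCurve A := by
  refine detectsBounded_operators.isSmoothCurveOn isOpen_univ ?_
  rintro φ ⟨l, v, hφ⟩
  simp only [hφ]
  exact (isSmoothCurve_iff.1 (h v) l).contDiffOn

omit [CompleteSpace F] in
theorem continuous_of_isSmoothCurve_comp (s : E →ₗ[ℝ] F)
    (h : ∀ y : ℝ → E, IsSmoothCurve y → IsSmoothCurve fun t => s (y t)) : Continuous s :=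
  continuousOn_univ.1 (ESmoothOn.continuousOn (fun c hc _ => h c hc) isOpen_univ)

open Classical in
/-- The derivative of a smooth map on the open set `O`, as a map with values in the operators, and
zero outside of `O`. -/
noncomputable def operatorDeriv (f : E → F) (O : Set E) (x : E) : E →L[ℝ] F :=
  if h : IsOpen O ∧ ESmoothOn f O ∧ x ∈ O then
    { toLinearMap := h.2.1.dirDerivₗ (isCInfOpen_iff_isOpen.2 h.1) h.2.2
      cont := continuous_of_isSmoothCurve_comp _ fun _ hy => weakSmoothOn_univ_iff.1
        (h.2.1.weakSmoothOn_dirDeriv (isCInfOpen_iff_isOpen.2 h.1) isOpen_univ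
          (weakSmoothOn_const x _) (weakSmoothOn_univ_iff.2 hy) fun _ _ => h.2.2) }
  else 0

theorem operatorDeriv_apply {f : E → F} {O : Set E} (hO : IsOpen O) (hf : ESmoothOn f O) {x : E}
    (hx : x ∈ O) (v : E) : operatorDeriv f O x v = dirDeriv f x v := by
  rw [operatorDeriv, dif_pos ⟨hO, hf, hx⟩]
  rfl

theorem eSmoothOn_operatorDeriv {f : E → F} {O : Set E} (hO : IsOpen O) (hf : ESmoothOn f O) :
    ESmoothOn (operatorDeriv f O) O := by
  intro c hc hcO
  refine isSmoothCurve_operators fun v => ?_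
  simp only [operatorDeriv_apply hO hf (hcO _)]
  exact weakSmoothOn_univ_iff.1 (hf.weakSmoothOn_dirDeriv (isCInfOpen_iff_isOpen.2 hO) isOpen_univ
    (weakSmoothOn_univ_iff.2 hc) (weakSmoothOn_const v _) fun t _ => hcO t)

/-- Smooth maps between Banach spaces are Fréchet differentiable, since their directional
derivatives form a continuous map into the space of operators. -/
theorem ESmoothOn.hasFDerivAt {f : E → F} {O : Set E} (hO : IsOpen O) (hf : ESmoothOn f O) {x : E}
    (hx : x ∈ O) : HasFDerivAt f (operatorDeriv f O x) x := by
  have hA := ((eSmoothOn_operatorDeriv hO hf).continuousOn hO).continuousAt (hO.mem_nhds hx)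
  rw [hasFDerivAt_iff_isLittleO, Asymptotics.isLittleO_iff]
  intro ε hε
  obtain ⟨δ, hδ, hball⟩ := Metric.mem_nhds_iff.1
    (inter_mem (hO.mem_nhds hx) (hA.preimage_mem_nhds (Metric.closedBall_mem_nhds _ hε)))
  filter_upwards [Metric.ball_mem_nhds x hδ] with y hy
  set c : ℝ → E := fun s => x + s • (y - x) with hc
  have hcs : ContDiff ℝ ∞ c := contDiff_const.add (contDiff_id.smul contDiff_const)
  have hcd : ∀ s, HasDerivAt c (y - x) s := fun s => by
    have h1 := ((hasDerivAt_id s).smul_const (y - x)).const_add x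
    rw [one_smul] at h1
    exact h1
  have hcb : ∀ s ∈ Set.Icc (0 : ℝ) 1, c s ∈ Metric.ball x δ := by
    intro s hs
    rw [Metric.mem_ball, dist_eq_norm] at hy ⊢
    rw [hc, add_sub_cancel_left, norm_smul, Real.norm_eq_abs, abs_of_nonneg hs.1]
    exact (mul_le_of_le_one_left (norm_nonneg _) hs.2).trans_lt hy
  have hd : ∀ s ∈ Set.Icc (0 : ℝ) 1, HasDerivAt (fun s => f (c s) - s • operatorDeriv f O x (y - x))
      ((operatorDeriv f O (c s) - operatorDeriv f O x) (y - x)) s := by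
    intro s hs
    have hsO : c s ∈ O := (hball (hcb s hs)).1
    have h1 := hf.hasDerivAt_comp (isCInfOpen_iff_isOpen.2 hO) isOpen_univ
      (weakSmoothOn_univ_iff.2 (isSmoothCurve_iff_contDiff.2 hcs)) (t := s) trivial hsO
    rw [(hcd s).deriv, ← operatorDeriv_apply hO hf hsO] at h1
    have h2 := h1.sub ((hasDerivAt_id s).smul_const (operatorDeriv f O x (y - x)))
    rw [one_smul] at h2
    exact h2
  have h := norm_image_sub_le_of_norm_deriv_le_segment_01'
    (fun s hs => (hd s hs).hasDerivWithinAt) (C := ε * ‖y - x‖) fun s hs => by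
      refine (ContinuousLinearMap.le_opNorm _ _).trans ?_
      gcongr
      have := (hball (hcb s ⟨hs.1, hs.2.le⟩)).2
      rwa [Set.mem_preimage, mem_closedBall_iff_norm] at this
  simp only [hc, one_smul, zero_smul, add_zero, sub_zero, add_sub_cancel] at h
  rwa [sub_right_comm]

theorem ESmoothOn.contDiffOn {f : E → F} {O : Set E} (hO : IsOpen O) (hf : ESmoothOn f O) :
    ContDiffOn ℝ ∞ f O := by
  refine contDiffOn_infty.2 fun n => ?_
  induction n generalizing F with
  | zero => exact contDiffOn_zero.2 (hf.continuousOn hO)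
  | succ n ih =>
    push_cast
    rw [contDiffOn_succ_iff_fderiv_of_isOpen hO]
    exact ⟨fun x hx => (hf.hasFDerivAt hO hx).differentiableAt.differentiableWithinAt, by simp,
      (ih (eSmoothOn_operatorDeriv hO hf)).congr fun x hx => (hf.hasFDerivAt hO hx).fderiv⟩

omit [CompleteSpace E] in
theorem IsBoundedLinear.continuous {s : E →ₗ[ℝ] E} (hs : IsBoundedLinear s) : Continuous s :=
  s.continuous_of_locally_bounded hs

end Banach

/-! ### Banach–Lie groups -/

section BanachLie

variable {E : Type*} [AddCommGroup E] [Module ℝ E] [TopologicalSpace E]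
variable {G : Type*} [TopologicalSpace G] [ChartedSpace (CInf E) G] [Group G]
variable [ConvenientLieGroup E G]

theorem GSmoothOn.prod_ofFn [ConvenientSpace E] {V : Type*} [NormedAddCommGroup V]
    [NormedSpace ℝ V] {N : ℕ} {P : Fin N → V → G} {W : Set V}
    (hP : ∀ i, GSmoothOn E (P i) W) : GSmoothOn E (fun p => (List.ofFn fun i => P i p).prod) W := by
  induction N with
  | zero => simpa using gSmoothOn_const (E := E) (1 : G) W
  | succ N ih =>
    simp only [List.ofFn_succ, List.prod_cons]
    exact (hP 0).mul (ih fun i => hP i.succ)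

end BanachLie

section BanachInequality

variable {E : Type*} [NormedAddCommGroup E] [NormedSpace ℝ E] [CompleteSpace E]
variable {G : Type*} [TopologicalSpace G] [ChartedSpace (CInf E) G] [Group G]
variable [ConvenientLieGroup E G]

/-- The adjoint action as a continuous linear map. -/
noncomputable def AdOperator (h : G) : E →L[ℝ] E :=
  ⟨AdLinear h, (isBoundedLinear_Ad h).continuous⟩

@[simp]
theorem AdOperator_apply (h : G) (X : E) : AdOperator h X = Ad E h X := rfl

theorem isSmoothCurve_AdOperator {γ : ℝ → G} (hγ : IsSmoothCurveIn E γ) :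
    IsSmoothCurve fun t => (AdOperator (γ t) : E →L[ℝ] E) :=
  isSmoothCurve_operators fun X => isSmoothCurve_Ad hγ X

/-- The derivative of `X ↦ ∏ i, [exp (σ i X), h i]` at the origin, see
`hasFDerivAt_commutatorProd`. -/
noncomputable def commutatorOperator {N : ℕ} (σ : Fin N → E →L[ℝ] E) (h : Fin N → G) : E →L[ℝ] E :=
  ∑ i, (σ i - (AdOperator (h i)).comp (σ i))

theorem commutatorOperator_apply {N : ℕ} (σ : Fin N → E →L[ℝ] E) (h : Fin N → G) (X : E) :
    commutatorOperator σ h X = ∑ i, (σ i X - Ad E (h i) (σ i X)) := by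
  simp [commutatorOperator]

/-- If `∑ i, [σ i X, Y i] = X` for all `X`, then the operators `∑ i, (id - Ad (γ i t)) ∘ σ i` have
the derivative `id` at `t = 0`, so that they are invertible for small `t ≠ 0`. -/
theorem eventually_isUnit_commutatorOperator {N : ℕ} {σ : Fin N → E →L[ℝ] E} {Y : Fin N → E}
    (hsum : ∀ X, ∑ i, lieBracket E G (σ i X) (Y i) = X) {γ : Fin N → ℝ → G}
    (hγ : ∀ i, IsSmoothCurveIn E (γ i)) (hY : ∀ i, HasVelocity E (γ i) (Y i)) :
    ∀ᶠ t in 𝓝[≠] (0 : ℝ), IsUnit (commutatorOperator σ fun i => γ i t) := by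
  have hK : HasDerivAt (fun t => commutatorOperator σ fun i => γ i t) 1 0 := by
    have h1 : ∀ i, HasDerivAt (fun t => (AdOperator (γ i t) : E →L[ℝ] E))
        (deriv (fun t => (AdOperator (γ i t) : E →L[ℝ] E)) 0) 0 := fun i =>
      (((isSmoothCurve_iff_contDiff.1 (isSmoothCurve_AdOperator (hγ i))).differentiable
        (by simp)) 0).hasDerivAt
    have h2 : HasDerivAt (fun t => commutatorOperator σ fun i => γ i t) (∑ i, (0 -
        (deriv (fun t => (AdOperator (γ i t) : E →L[ℝ] E)) 0).comp (σ i))) 0 := by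
      refine HasDerivAt.fun_sum fun i _ => (hasDerivAt_const (0 : ℝ) (σ i)).sub ?_
      have := (h1 i).clm_comp (hasDerivAt_const (0 : ℝ) (σ i))
      simpa using this
    convert! h2 using 1
    ext X
    have h3 : ∀ i Z, deriv (fun t => (AdOperator (γ i t) : E →L[ℝ] E)) 0 Z =
        lieBracket E G (Y i) Z := by
      intro i Z
      have h4 := (h1 i).clm_apply (hasDerivAt_const (0 : ℝ) Z)
      simp only [map_zero, add_zero] at h4
      exact h4.unique ((hY i).hasDerivAt_Ad Z)
    simp only [zero_sub, sum_apply, neg_apply,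
      ContinuousLinearMap.comp_apply, h3, ← lieBracket_neg_symm, hsum]
    rfl
  have hK0 : (commutatorOperator σ fun i => γ i 0) = 0 := by
    ext X
    have h0 : ∀ i, γ i 0 = 1 := fun i => by
      obtain ⟨-, -, -, -, h, -⟩ := hY i
      exact h
    simp [commutatorOperator_apply, h0, Ad_one]
  have hslope := hasDerivAt_iff_tendsto_slope.1 hK
  filter_upwards [hslope.eventually (Units.isOpen.mem_nhds isUnit_one), self_mem_nhdsWithin]
    with t ht ht0
  rw [slope_def_module, hK0, sub_zero, sub_zero] at ht
  have ht0' : t⁻¹ ≠ 0 := inv_ne_zero ht0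
  exact (isUnit_smul_iff (Units.mk0 _ ht0') _).1 ht

section LocalSolution

variable {N : ℕ} (σ : Fin N → E →L[ℝ] E) (h : Fin N → G)

/-- The product of commutators `∏ i, [exp (σ i X), h i]`, where `exp` stands for the inverse of the
preferred chart at the identity. -/
noncomputable def commutatorProd (X : E) : G :=
  (List.ofFn fun i => chartInv (idChart E G) (origin E G + σ i X) * h i *
    (chartInv (idChart E G) (origin E G + σ i X))⁻¹ * (h i)⁻¹).prod

/-- The set of those `X` for which the product of commutators is defined and lies in the domain of
the preferred chart at the identity. -/
def commutatorDom : Set E :=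
  {X | (∀ i, origin E G + σ i X ∈ chartRange (idChart E G)) ∧
    commutatorProd σ h X ∈ (idChart E G).source}

variable {σ h}

omit [CompleteSpace E] [ConvenientLieGroup E G] in
theorem isSmoothCurve_origin_add {c : ℝ → E} (hc : IsSmoothCurve c) (T : E →L[ℝ] E) :
    IsSmoothCurve fun t => origin E G + T (c t) :=
  isSmoothCurve_iff_contDiff.2 (contDiff_const.add
    (T.contDiff.comp (isSmoothCurve_iff_contDiff.1 hc)))

theorem gSmoothOn_commutatorProd {c : ℝ → E} (hc : IsSmoothCurve c) {J : Set ℝ}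
    (hJ : ∀ t ∈ J, ∀ i, origin E G + σ i (c t) ∈ chartRange (idChart E G)) :
    GSmoothOn E (fun t => commutatorProd σ h (c t)) J := by
  refine GSmoothOn.prod_ofFn fun i => ?_
  have h1 : GSmoothOn E (fun t => chartInv (idChart E G) (origin E G + σ i (c t))) J :=
    ((weakSmoothOn_univ_iff.2 (isSmoothCurve_origin_add hc (σ i))).mono
      (Set.subset_univ _)).gSmoothOn (idChart_mem_atlas E G) fun t ht => hJ t ht i
  exact ((h1.mul (gSmoothOn_const (h i) J)).mul h1.inv).mul (gSmoothOn_const _ J)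

theorem isOpen_commutatorDom : IsOpen (commutatorDom σ h) := by
  refine isCInfOpen_iff_isOpen.1 fun c hc => ?_
  set J : Set ℝ := {t | ∀ i, origin E G + σ i (c t) ∈ chartRange (idChart E G)} with hJdef
  have hJ : IsOpen J := by
    rw [hJdef, Set.ofPred_forall]
    exact isOpen_iInter_of_finite fun i =>
      isCInfOpen_chartRange _ (isSmoothCurve_origin_add hc (σ i))
  exact (gSmoothOn_commutatorProd (σ := σ) (h := h) hc (J := J)
    fun t ht => ht).isOpen_inter_preimage hJ (idChart E G).open_source

omit [CompleteSpace E] [ConvenientLieGroup E G] in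
theorem commutatorProd_zero : commutatorProd σ h 0 = 1 := by
  simp [commutatorProd, chartInv_origin]

omit [CompleteSpace E] [ConvenientLieGroup E G] in
theorem zero_mem_commutatorDom : 0 ∈ commutatorDom σ h :=
  ⟨fun i => by simpa using origin_mem E G, by
    rw [commutatorProd_zero]
    exact one_mem_source E G⟩

theorem eSmoothOn_commutatorProd :
    ESmoothOn (fun X => chartMap (idChart E G) (commutatorProd σ h X)) (commutatorDom σ h) :=
  fun _ hc hcO => ((gSmoothOn_commutatorProd hc (J := Set.univ)
    fun t _ => (hcO t).1).isSmoothCurveIn).isSmoothCurve_chartMap (idChart_mem_atlas E G)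
      fun t => (hcO t).2

theorem hasFDerivAt_commutatorProd :
    HasFDerivAt (fun X => chartMap (idChart E G) (commutatorProd σ h X))
      (commutatorOperator σ h) 0 := by
  have h1 := (eSmoothOn_commutatorProd (σ := σ) (h := h)).hasFDerivAt isOpen_commutatorDom
    zero_mem_commutatorDom
  convert! h1 using 1
  ext X
  rw [operatorDeriv_apply isOpen_commutatorDom eSmoothOn_commutatorProd zero_mem_commutatorDom,
    commutatorOperator_apply]
  have h2 := hasVelocity_prod_ofFn fun i => (hasVelocity_line G (σ i X)).commutator (h i)
  rw [← h2.deriv, dirDeriv]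
  simp [commutatorProd]

/-- The inverse function theorem for products of commutators: if the derivative of the product of
commutators is invertible, all `g` near the identity are such products, in a smooth way. -/
theorem exists_local_solution (hK : IsUnit (commutatorOperator σ h)) :
    ∃ V : Set G, IsOpen V ∧ (1 : G) ∈ V ∧
      ∃ S : Fin N → G → G, (∀ i, IsSmoothMapOn E (S i) V ∧ S i 1 = 1) ∧
        ∀ g ∈ V, (List.ofFn fun i => S i g * h i * (S i g)⁻¹ * (h i)⁻¹).prod = g := by
  set f : E → E := fun X => chartMap (idChart E G) (commutatorProd σ h X) with hf
  set O : Set E := commutatorDom σ h with hO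
  have hOo : IsOpen O := isOpen_commutatorDom
  have h0O : 0 ∈ O := zero_mem_commutatorDom
  have hfs : ContDiffOn ℝ ∞ f O := eSmoothOn_commutatorProd.contDiffOn hOo
  have hf0 : f 0 = origin E G := by rw [hf, origin]; simp only [commutatorProd_zero]
  have hfd : HasFDerivAt f (commutatorOperator σ h) 0 := hasFDerivAt_commutatorProd
  obtain ⟨u, hu⟩ := hK
  have hfd' : HasFDerivAt f
      ((ContinuousLinearEquiv.unitsEquiv ℝ E u : E ≃L[ℝ] E) : E →L[ℝ] E) 0 := by
    convert! hfd using 1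
  set Φ := (hfs.contDiffAt (hOo.mem_nhds h0O)).toOpenPartialHomeomorph f hfd' (by simp) with hΦ
  have hΦf : ∀ X, Φ X = f X := fun X => rfl
  have h0Φ : (0 : E) ∈ Φ.source :=
    (hfs.contDiffAt (hOo.mem_nhds h0O)).mem_toOpenPartialHomeomorph_source hfd' (by simp)
  -- The derivative is invertible on a neighbourhood of the origin, not at the origin only.
  have hfc : ContinuousOn (fderiv ℝ f) O := hfs.continuousOn_fderiv_of_isOpen hOo (by simp)
  set M : Set E := O ∩ fderiv ℝ f ⁻¹' {T | IsUnit T} with hM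
  have hMo : IsOpen M := hfc.isOpen_inter_preimage hOo Units.isOpen
  have h0M : (0 : E) ∈ M := ⟨h0O, by
    rw [Set.mem_preimage, hfd.fderiv, ← hu]
    exact u.isUnit⟩
  set Q : Set E := Φ.target ∩ Φ.symm ⁻¹' M with hQ
  have hQo : IsOpen Q := Φ.isOpen_inter_preimage_symm hMo
  have hsymm0 : Φ.symm (origin E G) = 0 := by
    rw [← hf0, ← hΦf, Φ.left_inv h0Φ]
  have h0Q : origin E G ∈ Q := ⟨by rw [← hf0, ← hΦf]; exact Φ.map_source h0Φ, by
    rw [Set.mem_preimage, hsymm0]; exact h0M⟩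
  have hsymm : ContDiffOn ℝ ∞ Φ.symm Q := by
    intro y hy
    obtain ⟨w, hw⟩ := hy.2.2
    have hd : HasFDerivAt Φ ((ContinuousLinearEquiv.unitsEquiv ℝ E w : E ≃L[ℝ] E) : E →L[ℝ] E)
        (Φ.symm y) := by
      have h1 := ((hfs.contDiffAt (hOo.mem_nhds hy.2.1)).differentiableAt (by simp)).hasFDerivAt
      rw [← hw] at h1
      exact h1
    exact (Φ.contDiffAt_symm hy.1 hd
      (hfs.contDiffAt (hOo.mem_nhds hy.2.1))).contDiffWithinAt
  have hQ' : IsOpen ((toCInf E).symm ⁻¹' Q) := isCInfOpen_iff.1 (isCInfOpen_iff_isOpen.2 hQo)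
  have hmem1 : (1 : G) ∈ (idChart E G).source ∩ (idChart E G) ⁻¹' ((toCInf E).symm ⁻¹' Q) :=
    ⟨one_mem_source E G, h0Q⟩
  refine ⟨(idChart E G).source ∩ (idChart E G) ⁻¹' ((toCInf E).symm ⁻¹' Q),
    (idChart E G).isOpen_inter_preimage hQ', hmem1,
    fun i g => chartInv (idChart E G) (origin E G + σ i (Φ.symm (chartMap (idChart E G) g))),
    fun i => ⟨?_, ?_⟩, ?_⟩
  · intro c hc hcV
    have h1 := isSmoothCurve_iff_contDiff.1
      (hc.isSmoothCurve_chartMap (idChart_mem_atlas E G) fun t => (hcV t).1)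
    have h2 : ContDiff ℝ ∞ fun t => Φ.symm (chartMap (idChart E G) (c t)) :=
      contDiffOn_univ.1 (hsymm.comp h1.contDiffOn fun t _ => (hcV t).2)
    exact (isSmoothCurve_origin_add (isSmoothCurve_iff_contDiff.2 h2) (σ i)).chartInv
      (idChart_mem_atlas E G) fun t => (hcV t).2.2.1.1 i
  · have : chartMap (idChart E G) (1 : G) = origin E G := rfl
    simp only [this, hsymm0, map_zero, add_zero, chartInv_origin]
  · intro g hg
    have hgQ : chartMap (idChart E G) g ∈ Q := hg.2
    have h1 : f (Φ.symm (chartMap (idChart E G) g)) = chartMap (idChart E G) g :=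
      Φ.right_inv hgQ.1
    have h2 := chartInv_chartMap hgQ.2.1.2
    exact h2.symm.trans ((congrArg _ h1).trans (chartInv_chartMap hg.1))

end LocalSolution

/-- In a Banach–Lie group the maps `σ i` with `∑ i, [σ i X, Y i] = X` and small times on the
one-parameter subgroups of the `Y i` give commutators that cover a neighbourhood of the identity. -/
theorem groupNumber_le_lieAlgebraNumber (hG : IsRegular E G) :
    groupNumber E G ≤ lieAlgebraNumber (lieBracket E G) := by
  refine sInf_le_sInf ?_
  rintro _ ⟨N, rfl, Y, s, hs, hsum⟩
  refine ⟨N, rfl, fun U hU h1U => ?_⟩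
  choose γ hγ hγ0 hadd hY using fun i => hG.exists_oneParameter (Y i)
  set σ : Fin N → E →L[ℝ] E := fun i => ⟨s i, (hs i).continuous⟩ with hσ
  have hunit := eventually_isUnit_commutatorOperator (σ := σ) hsum hγ hY
  have hmem : ∀ᶠ t in 𝓝[≠] (0 : ℝ), ∀ i, γ i t ∈ U := by
    refine eventually_all.2 fun i => nhdsWithin_le_nhds ?_
    exact (hU.preimage (hγ i).1).mem_nhds (by rw [Set.mem_preimage, hγ0 i]; exact h1U)
  obtain ⟨t, htK, htU⟩ := (hunit.and hmem).exists
  exact ⟨fun i => t • Y i, fun i => γ i t,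
    fun i => ⟨isExp_of_oneParameter (hγ i) (hγ0 i) (hadd i) (hY i) t, htU i⟩,
    exists_local_solution htK⟩

end BanachInequality

/-- The inequality in topological terms: a locally convex Banach space carries a norm that defines
its topology, and for this norm `ConvenientLie.groupNumber_le_lieAlgebraNumber` applies. -/
theorem IsBanachSpace.groupNumber_le_lieAlgebraNumber {E : Type*} [AddCommGroup E] [Module ℝ E]
    [τ : TopologicalSpace E] [ConvenientSpace E] {G : Type*} [TopologicalSpace G]
    [ChartedSpace (CInf E) G] [Group G] [ConvenientLieGroup E G] (hE : IsBanachSpace E)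
    (hG : IsRegular E G) : groupNumber E G ≤ lieAlgebraNumber (lieBracket E G) := by
  obtain ⟨p, hp, hcomplete⟩ := hE
  have hp0 : ∀ x, p x = 0 → x = 0 := fun x hx => by
    by_contra hne
    obtain ⟨-, h⟩ := (hp.separating_iff_T1.2 inferInstance) x hne
    exact h hx
  let iN : NormedAddCommGroup E :=
    { p.toAddGroupSeminorm.toSeminormedAddCommGroup with
      eq_of_dist_eq_zero := fun {x y} h => by
        have h1 : p (-x + y) = 0 := h
        exact (neg_add_eq_zero.1 (hp0 _ h1)) }
  let iS : NormedSpace ℝ E := { norm_smul_le := fun a x => (map_smul_eq_mul p a x).le }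
  have htop : τ = iN.toPseudoMetricSpace.toUniformSpace.toTopologicalSpace := by
    refine ((SeminormFamily.withSeminorms_iff_topologicalSpace_eq_iInf _).1 hp).trans ?_
    exact ciInf_unique
  -- From here on the topology of `E` is the one of the norm by definition.
  subst htop
  have : CompleteSpace E := Metric.complete_of_cauchySeq_tendsto fun x hx => by
    refine hcomplete x fun ε hε => ?_
    obtain ⟨N, hN⟩ := Metric.cauchySeq_iff.1 hx ε hε
    refine ⟨N, fun m hm n hn => ?_⟩
    have h := hN m hm n hn
    rwa [dist_eq_norm] at h
  exact ConvenientLie.groupNumber_le_lieAlgebraNumber hG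

end ConvenientLie

theorem mainTheorem4 {E : Type*} [AddCommGroup E] [Module ℝ E] [TopologicalSpace E]
    [ConvenientLie.ConvenientSpace E]
    {G : Type*} [TopologicalSpace G] [ChartedSpace (ConvenientLie.CInf E) G] [Group G]
    [ConvenientLie.ConvenientLieGroup E G] (hG : ConvenientLie.IsRegular E G) :
    (ConvenientLie.lieAlgebraNumber (ConvenientLie.lieBracket E G) ≤ ConvenientLie.adNumber E G ∧
      ConvenientLie.adNumber E G ≤ ConvenientLie.groupNumber E G) ∧
    (ConvenientLie.IsBanachSpace E →
      ConvenientLie.lieAlgebraNumber (ConvenientLie.lieBracket E G) = ConvenientLie.adNumber E G ∧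
      ConvenientLie.adNumber E G = ConvenientLie.groupNumber E G) := by
  have h1 := ConvenientLie.lieAlgebraNumber_le_adNumber E G
  have h2 := ConvenientLie.adNumber_le_groupNumber E G
  refine ⟨⟨h1, h2⟩, fun hE => ?_⟩
  have h3 := hE.groupNumber_le_lieAlgebraNumber hG
  exact ⟨le_antisymm h1 (h2.trans h3), le_antisymm h2 (h3.trans h1)⟩
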